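/- Let $M$ be a compact smooth manifold without boundary of dimension $2n+1$, $n\ge 0$, with a contact form $\theta$ (a smooth $1$-form with $\theta\wedge(d\theta)^n\neq 0$ everywhere) and Reeb field $E$ (so $\theta(E)=1$, $\iota_E d\theta=0$). Let $g$ be a Riemannian metric on $M$ such that $(M,\theta,g)$ is $K$-contact, i.e. $\theta(u)=(u,E)_g$ for all $u\in TM$, there is a $(1,1)$-tensor field $\phi$ with $\phi^2u=-u+\theta(u)E$ and $d\theta(u,v)=(u,\phi v)_g$ for all $u,v$, and the flow of $E$ consists of isometries. Let $\mu$ be the Riemannian volume measure of $g$. Let $\mathcal D_\theta(M)$ be the group of diffeomorphisms $\eta$ of $M$ such that $\eta^*\theta$ is a positive functional multiple of $\theta$. Its Lie algebra $T_e\mathcal D_\theta(M)$ consists of the smooth vector fields $u$ with $\mathcal L_u\theta=\lambda\theta$ for some function $\lambda$; for each $f\in C^\infty(M)$ there is exactly one such field $u$ with $\theta(u)=f$, denoted $S_\theta f$. The tangent space at $\eta$ is $\{X\circ\eta : X\in T_e\mathcal D_\theta(M)\}$. Put $\{f,h\}=S_\theta f(h)-hE(f)$, and give $\mathcal D_\theta(M)$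 the right-invariant metric determined by $$\langle S_\theta f,S_\theta h\rangle=\int_M fh\,d\mu .$$ On $T_e\mathcal D_\theta(M)$, identified with the right-invariant vector fields on the group, this metric has a Levi-Civita connection $\nabla$, i.e. a bilinear operation with $\nabla_XY-\nabla_YX=[X,Y]$ and $\langle\nabla_XY,Z\rangle+\langle Y,\nabla_XZ\rangle=0$. There is also an operator $B$ on $T_e\mathcal D_\theta(M)$ with $\langle B(X,Y),Z\rangle=\langle X,\mathrm{ad}_YZ\rangle$ for all $Z$, where $\mathrm{ad}_XY=-[X,Y]$. Let $R(X,Y)Z=\nabla_X\nabla_YZ-\nabla_Y\nabla_XZ-\nabla_{[X,Y]}Z$ and $C(X,Y)=\langle R(X,Y)Y,X\rangle$. Then for all $f,h\in C^\infty(M)$, with $X=S_\theta f$ and $Y=S_\theta h$, $$C(X,Y)=\langle d,d\rangle+2\langle a,b\rangle-3\langle a,a\rangle-4\langle B_X,B_Y\rangle=\frac14\int_M\bigl[\{f,h\}-(n+3)\bigl(fE(h)-hE(f)\bigr)\bigr]^2d\mu ,$$ where $2d=B(X,Y)+B(Y,X)$, $2b=B(X,Y)-B(Y,X)$, $2a=\mathrm{ad}_XY$,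 $2B_X=B(X,X)$, $2B_Y=B(Y,Y)$, and the integrand is integrable. Consequently the sectional curvature of $\mathcal D_\theta(M)$ is nonnegative everywhere: for every $\eta\in\mathcal D_\theta(M)$ and all linearly independent $U=X\circ\eta$ and $V=Y\circ\eta$ in $T_\eta\mathcal D_\theta(M)$, one has $|X\wedge Y|^2=\langle X,X\rangle\langle Y,Y\rangle-\langle X,Y\rangle^2>0$ and the sectional curvature $K_\eta(U,V)=C(X,Y)/|X\wedge Y|^2$ is $\ge 0$. -/

import Mathlib

open scoped Manifold ContDiff Topology
open MeasureTheory Bundle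

noncomputable section

namespace ContactCurvature

/-- A (not necessarily smooth) vector field on an `m`-dimensional manifold. -/
abbrev VField (m : ℕ) (M : Type*) [TopologicalSpace M]
    [ChartedSpace (EuclideanSpace ℝ (Fin m)) M] : Type _ :=
  (x : M) → TangentSpace (𝓡 m) x

/-- A (not necessarily smooth) differential 1-form on an `m`-dimensional manifold. -/
abbrev OneForm (m : ℕ) (M : Type*) [TopologicalSpace M]
    [ChartedSpace (EuclideanSpace ℝ (Fin m)) M] : Type _ :=
  (x : M) → (TangentSpace (𝓡 m) x →L[ℝ] ℝ)

/-- A smooth Riemannian metric on an `m`-dimensional manifold. -/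
abbrev SmoothMetric (m : ℕ) (M : Type*) [TopologicalSpace M]
    [ChartedSpace (EuclideanSpace ℝ (Fin m)) M] [IsManifold (𝓡 m) ∞ M] : Type _ :=
  ContMDiffRiemannianMetric (𝓡 m) ∞ (EuclideanSpace ℝ (Fin m))
    (fun x : M => TangentSpace (𝓡 m) x)

section Differential

variable {m : ℕ} {M : Type*} [TopologicalSpace M] [ChartedSpace (EuclideanSpace ℝ (Fin m)) M]

/-- Smoothness of a real function. -/
def SmoothFun (m : ℕ) {M : Type*} [TopologicalSpace M]
    [ChartedSpace (EuclideanSpace ℝ (Fin m)) M] (f : M → ℝ) : Prop :=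
  ContMDiff (𝓡 m) 𝓘(ℝ, ℝ) ∞ f

/-- The derivative `u(f)` of the function `f` along the vector field `u`. -/
def dirDeriv (u : VField m M) (f : M → ℝ) (x : M) : ℝ :=
  mfderiv (𝓡 m) 𝓘(ℝ, ℝ) f x (u x)

/-- The function `θ(u)`. -/
def applyForm (θ : OneForm m M) (u : VField m M) (x : M) : ℝ := θ x (u x)

/-- The local expression of `θ` in the preferred chart at `x₀`, i.e. the pullback of `θ` under the
inverse of the chart. -/
def formInChart (θ : OneForm m M) (x₀ : M) (y : EuclideanSpace ℝ (Fin m)) :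
    EuclideanSpace ℝ (Fin m) →L[ℝ] ℝ :=
  (θ ((extChartAt (𝓡 m) x₀).symm y)).comp
    (mfderiv 𝓘(ℝ, EuclideanSpace ℝ (Fin m)) (𝓡 m) (extChartAt (𝓡 m) x₀).symm y)

/-- The exterior derivative `dθ`, with `dθ(u,v) = u(θ(v)) - v(θ(u)) - θ([u,v])`: it is
`∑ ∂ᵢθⱼ (uᵢ vⱼ - vᵢ uⱼ)` in the preferred chart at `x`. -/
def extD (θ : OneForm m M) (x : M) (u v : TangentSpace (𝓡 m) x) : ℝ :=
  fderiv ℝ (formInChart θ x) (extChartAt (𝓡 m) x x)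
      (mfderiv (𝓡 m) 𝓘(ℝ, EuclideanSpace ℝ (Fin m)) (extChartAt (𝓡 m) x) x u)
      (mfderiv (𝓡 m) 𝓘(ℝ, EuclideanSpace ℝ (Fin m)) (extChartAt (𝓡 m) x) x v)
    - fderiv ℝ (formInChart θ x) (extChartAt (𝓡 m) x x)
      (mfderiv (𝓡 m) 𝓘(ℝ, EuclideanSpace ℝ (Fin m)) (extChartAt (𝓡 m) x) x v)
      (mfderiv (𝓡 m) 𝓘(ℝ, EuclideanSpace ℝ (Fin m)) (extChartAt (𝓡 m) x) x u)

/-- The Reeb field `E`: `θ(E) = 1` and `ι_E dθ = 0`. (It exists and is unique for a contact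
form.) -/
def reeb (θ : OneForm m M) : VField m M := fun x =>
  Classical.epsilon fun e : TangentSpace (𝓡 m) x =>
    θ x e = 1 ∧ ∀ v : TangentSpace (𝓡 m) x, extD θ x e v = 0

/-- The value of the Lie derivative `L_u θ` on a vector field `v`:
`(L_u θ)(v) = u(θ(v)) - θ([u,v])`. -/
def lieDerivForm (θ : OneForm m M) (u v : VField m M) (x : M) : ℝ :=
  dirDeriv u (applyForm θ v) x - θ x (VectorField.mlieBracket (𝓡 m) u v x)

end Differential

section Smooth

variable {m : ℕ} {M : Type*} [TopologicalSpace M] [ChartedSpace (EuclideanSpace ℝ (Fin m)) M]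
  [IsManifold (𝓡 m) ∞ M]

/-- Smoothness of a vector field. -/
def SmoothVField (u : VField m M) : Prop :=
  ContMDiff (𝓡 m) (𝓡 m).tangent ∞ (fun x => (⟨x, u x⟩ : TangentBundle (𝓡 m) M))

/-- Smoothness of a 1-form. -/
def SmoothForm (θ : OneForm m M) : Prop :=
  ContMDiff (𝓡 m) ((𝓡 m).prod 𝓘(ℝ, EuclideanSpace ℝ (Fin m) →L[ℝ] ℝ)) ∞
    (fun x => TotalSpace.mk' (EuclideanSpace ℝ (Fin m) →L[ℝ] ℝ)
      (E := fun x : M => TangentSpace (𝓡 m) x →L[ℝ] ℝ) x (θ x))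

/-- Smoothness of a `(1,1)`-tensor field. -/
def SmoothTensor11 (φ : (x : M) → (TangentSpace (𝓡 m) x →L[ℝ] TangentSpace (𝓡 m) x)) : Prop :=
  ContMDiff (𝓡 m)
    ((𝓡 m).prod 𝓘(ℝ, EuclideanSpace ℝ (Fin m) →L[ℝ] EuclideanSpace ℝ (Fin m))) ∞
    (fun x => TotalSpace.mk' (EuclideanSpace ℝ (Fin m) →L[ℝ] EuclideanSpace ℝ (Fin m))
      (E := fun x : M => TangentSpace (𝓡 m) x →L[ℝ] TangentSpace (𝓡 m) x) x (φ x))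

/-- The vector field `u` is complete and its flow consists of isometries of `g`. -/
def IsKilling (g : SmoothMetric m M) (u : VField m M) : Prop :=
  ∃ ψ : ℝ → M → M,
    (∀ x, ψ 0 x = x ∧ IsMIntegralCurve (I := 𝓡 m) (fun t => ψ t x) u) ∧
    (∀ t, ContMDiff (𝓡 m) (𝓡 m) ∞ (ψ t)) ∧
    ∀ (t : ℝ) (x : M) (v w : TangentSpace (𝓡 m) x),
      g.inner (ψ t x) (mfderiv (𝓡 m) (𝓡 m) (ψ t) x v) (mfderiv (𝓡 m) (𝓡 m) (ψ t) x w)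
        = g.inner x v w

/-- The metric `g` is associated to the form `θ`, with Reeb field `E`: `θ(u) = (u,E)`, and there is
a `(1,1)`-tensor field `φ` with `φ² u = -u + θ(u) E` and `dθ(u,v) = (u, φ v)`. -/
def IsAssociated (θ : OneForm m M) (g : SmoothMetric m M) : Prop :=
  (∀ (x : M) (u : TangentSpace (𝓡 m) x), θ x u = g.inner x u (reeb θ x)) ∧
  ∃ φ : (x : M) → (TangentSpace (𝓡 m) x →L[ℝ] TangentSpace (𝓡 m) x), SmoothTensor11 φ ∧
    (∀ (x : M) (u : TangentSpace (𝓡 m) x), φ x (φ x u) = -u + θ x u • reeb θ x) ∧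
    ∀ (x : M) (u v : TangentSpace (𝓡 m) x), extD θ x u v = g.inner x u (φ x v)

/-- The Gram matrix `(g_ij)` of `g` in the preferred chart at `x₀`, at the point with
coordinates `y`. -/
def gram (g : SmoothMetric m M) (x₀ : M) (y : EuclideanSpace ℝ (Fin m)) :
    Matrix (Fin m) (Fin m) ℝ :=
  Matrix.of fun i j => g.inner ((extChartAt (𝓡 m) x₀).symm y)
    (mfderiv 𝓘(ℝ, EuclideanSpace ℝ (Fin m)) (𝓡 m) (extChartAt (𝓡 m) x₀).symm y
      (EuclideanSpace.single i (1 : ℝ)))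
    (mfderiv 𝓘(ℝ, EuclideanSpace ℝ (Fin m)) (𝓡 m) (extChartAt (𝓡 m) x₀).symm y
      (EuclideanSpace.single j (1 : ℝ)))

/-- The measure `√(det g_ij) dy` of the preferred chart at `x₀`, carried by the domain of this
chart. -/
def chartVolume [MeasurableSpace M] (g : SmoothMetric m M) (x₀ : M) : Measure M :=
  (((volume : Measure (EuclideanSpace ℝ (Fin m))).restrict
      (extChartAt (𝓡 m) x₀).target).withDensity
    (fun y => ENNReal.ofReal (Real.sqrt (gram g x₀ y).det))).map (extChartAt (𝓡 m) x₀).symm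

/-- The Riemannian volume measure `μ`. The chart measures are the restrictions of `μ` to the
chart domains, and so `μ` is the least measure above all of them. -/
def riemVolume [MeasurableSpace M] (g : SmoothMetric m M) : Measure M :=
  ⨆ x₀ : M, chartVolume g x₀

/-- `u` is a contact vector field, i.e. an element of the Lie algebra `T_e D_θ(M)` of the
contactomorphism group: `u` is smooth and `L_u θ = l θ` for some function `l`. -/
def IsContactField (θ : OneForm m M) (u : VField m M) : Prop :=
  SmoothVField u ∧ ∃ l : M → ℝ, ∀ v : VField m M, SmoothVField v →
    ∀ x, lieDerivForm θ u v x = l x * θ x (v x)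

/-- The contact operator: `S_θ f` is the contact vector field `u` with `θ(u) = f`. -/
def contactOp (θ : OneForm m M) (f : M → ℝ) : VField m M :=
  Classical.epsilon fun u : VField m M => IsContactField θ u ∧ ∀ x, θ x (u x) = f x

/-- The contact Poisson bracket `{f,h} = S_θ f (h) - h E(f)`. -/
def contactPoisson (θ : OneForm m M) (f h : M → ℝ) (x : M) : ℝ :=
  dirDeriv (contactOp θ f) h x - h x * dirDeriv (reeb θ) f x

variable [MeasurableSpace M]

/-- The `L²` inner product of the stream functions, `⟨X,Y⟩ = ∫ θ(X) θ(Y) dμ`; in particular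
`⟨S_θ f, S_θ h⟩ = ∫ f h dμ`. -/
def streamInner (θ : OneForm m M) (g : SmoothMetric m M) (X Y : VField m M) : ℝ :=
  ∫ x, θ x (X x) * θ x (Y x) ∂(riemVolume g)

/-- `|X ∧ Y|²`. -/
def areaSq (θ : OneForm m M) (g : SmoothMetric m M) (X Y : VField m M) : ℝ :=
  streamInner θ g X X * streamInner θ g Y Y - streamInner θ g X Y ^ 2

/-- The Levi-Civita connection of the right-invariant metric, on right-invariant vector fields on
the group. These are identified with their values `X, Y, …` at the identity; their bracket is the
bracket of the vector fields `X, Y` on `M`, and `⟨X,Y⟩` is constant on the group. Hence the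
connection is the bilinear operation `∇` on `T_e D_θ(M)` with `∇_X Y - ∇_Y X = [X,Y]` and
`0 = ⟨∇_X Y, Z⟩ + ⟨Y, ∇_X Z⟩`. (Values of `∇` outside `T_e D_θ(M)` play no role.) -/
structure IsLeviCivita (θ : OneForm m M) (g : SmoothMetric m M)
    (nabla : VField m M → VField m M → VField m M) : Prop where
  mem : ∀ X Y, IsContactField θ X → IsContactField θ Y → IsContactField θ (nabla X Y)
  add_left : ∀ X X' Y, IsContactField θ X → IsContactField θ X' → IsContactField θ Y →
    nabla (X + X') Y = nabla X Y + nabla X' Y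
  smul_left : ∀ (c : ℝ) (X Y), IsContactField θ X → IsContactField θ Y →
    nabla (c • X) Y = c • nabla X Y
  add_right : ∀ X Y Y', IsContactField θ X → IsContactField θ Y → IsContactField θ Y' →
    nabla X (Y + Y') = nabla X Y + nabla X Y'
  smul_right : ∀ (c : ℝ) (X Y), IsContactField θ X → IsContactField θ Y →
    nabla X (c • Y) = c • nabla X Y
  torsion_free : ∀ X Y, IsContactField θ X → IsContactField θ Y →
    nabla X Y - nabla Y X = VectorField.mlieBracket (𝓡 m) X Y
  metric : ∀ X Y Z, IsContactField θ X → IsContactField θ Y → IsContactField θ Z →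
    streamInner θ g (nabla X Y) Z + streamInner θ g Y (nabla X Z) = 0

/-- The Levi-Civita connection of the right-invariant metric on the contactomorphism group. -/
def leviCivita (θ : OneForm m M) (g : SmoothMetric m M) :
    VField m M → VField m M → VField m M :=
  Classical.epsilon (IsLeviCivita θ g)

/-- The Riemann curvature tensor `R(X,Y)Z = ∇_X ∇_Y Z - ∇_Y ∇_X Z - ∇_[X,Y] Z` of the group at the
identity. -/
def curvatureTensor (θ : OneForm m M) (g : SmoothMetric m M) (X Y Z : VField m M) : VField m M :=
  leviCivita θ g X (leviCivita θ g Y Z) - leviCivita θ g Y (leviCivita θ g X Z)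
    - leviCivita θ g (VectorField.mlieBracket (𝓡 m) X Y) Z

/-- The unnormalized sectional curvature `C(X,Y) = ⟨R(X,Y)Y, X⟩` of the group at the identity. -/
def curvC (θ : OneForm m M) (g : SmoothMetric m M) (X Y : VField m M) : ℝ :=
  streamInner θ g (curvatureTensor θ g X Y Y) X

/-- The sectional curvature `K(X,Y) = C(X,Y) / |X ∧ Y|²` of the group at the identity. -/
def sectionalCurv (θ : OneForm m M) (g : SmoothMetric m M) (X Y : VField m M) : ℝ :=
  curvC θ g X Y / areaSq θ g X Y

/-- `ad_X Y = -[X,Y]`. -/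
def adOp (X Y : VField m M) : VField m M := -VectorField.mlieBracket (𝓡 m) X Y

/-- `W = B(X,Y) = ad*_Y X`, i.e. `⟨W,Z⟩ = ⟨X, ad_Y Z⟩` for all `Z` in the Lie algebra. -/
def IsB (θ : OneForm m M) (g : SmoothMetric m M) (X Y W : VField m M) : Prop :=
  IsContactField θ W ∧ ∀ Z, IsContactField θ Z →
    streamInner θ g W Z = streamInner θ g X (adOp Y Z)

/-- The bilinear operator `B(X,Y) = ad*_Y X`. -/
def opB (θ : OneForm m M) (g : SmoothMetric m M) (X Y : VField m M) : VField m M :=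
  Classical.epsilon (IsB θ g X Y)

/-- Arnold's expression `⟨d,d⟩ + 2⟨a,b⟩ - 3⟨a,a⟩ - 4⟨B_X,B_Y⟩` with
`2d = B(X,Y) + B(Y,X)`, `2b = B(X,Y) - B(Y,X)`, `2a = ad_X Y`, `2B_X = B(X,X)`,
`2B_Y = B(Y,Y)`. -/
def arnoldC (θ : OneForm m M) (g : SmoothMetric m M) (X Y : VField m M) : ℝ :=
  let d : VField m M := (1 / 2 : ℝ) • (opB θ g X Y + opB θ g Y X)
  let b : VField m M := (1 / 2 : ℝ) • (opB θ g X Y - opB θ g Y X)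
  let a : VField m M := (1 / 2 : ℝ) • adOp X Y
  let BX : VField m M := (1 / 2 : ℝ) • opB θ g X X
  let BY : VField m M := (1 / 2 : ℝ) • opB θ g Y Y
  streamInner θ g d d + 2 * streamInner θ g a b - 3 * streamInner θ g a a
    - 4 * streamInner θ g BX BY

/-- `η` is a contactomorphism, i.e. an element of `D_θ(M)`: `η^* θ` is a positive functional
multiple of `θ`. -/
def IsContactomorphism (θ : OneForm m M) (η : M ≃ₘ^∞⟮𝓡 m, 𝓡 m⟯ M) : Prop :=
  ∃ ρ : M → ℝ, (∀ x, 0 < ρ x) ∧ ∀ (x : M) (v : TangentSpace (𝓡 m) x),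
    θ (η x) (mfderiv (𝓡 m) (𝓡 m) η x v) = ρ x * θ x v

/-- `U ∈ T_η D_θ(M)`: `U = X ∘ η` is the right translate of some `X ∈ T_e D_θ(M)`. -/
def IsTangentAt (θ : OneForm m M) (η : M ≃ₘ^∞⟮𝓡 m, 𝓡 m⟯ M)
    (U : (x : M) → TangentSpace (𝓡 m) (η x)) : Prop :=
  ∃ X : VField m M, IsContactField θ X ∧ ∀ x, X (η x) = U x

/-- The right translate `U ∘ η⁻¹` to the identity, i.e. the vector field `X` with `X ∘ η = U`. -/
def rightTranslate (η : M ≃ₘ^∞⟮𝓡 m, 𝓡 m⟯ M) (U : (x : M) → TangentSpace (𝓡 m) (η x)) :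
    VField m M :=
  Classical.epsilon fun X : VField m M => ∀ x, X (η x) = U x

/-- `|U ∧ V|²` at the point `η` of the group, for the right-invariant metric. -/
def areaSqAt (θ : OneForm m M) (g : SmoothMetric m M) (η : M ≃ₘ^∞⟮𝓡 m, 𝓡 m⟯ M)
    (U V : (x : M) → TangentSpace (𝓡 m) (η x)) : ℝ :=
  areaSq θ g (rightTranslate η U) (rightTranslate η V)

/-- The sectional curvature of the right-invariant metric at the point `η` of the group. Right
translations are isometries, so it is computed at the identity. -/
def sectionalCurvAt (θ : OneForm m M) (g : SmoothMetric m M) (η : M ≃ₘ^∞⟮𝓡 m, 𝓡 m⟯ M)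
    (U V : (x : M) → TangentSpace (𝓡 m) (η x)) : ℝ :=
  sectionalCurv θ g (rightTranslate η U) (rightTranslate η V)

end Smooth

section KContact

variable {n : ℕ} {M : Type*} [TopologicalSpace M]
  [ChartedSpace (EuclideanSpace ℝ (Fin (2 * n + 1))) M]

/-- The top-degree form `θ ∧ (dθ)^n`. -/
def contactVolumeForm (θ : OneForm (2 * n + 1) M) (x : M)
    (v : Fin (2 * n + 1) → TangentSpace (𝓡 (2 * n + 1)) x) : ℝ :=
  (1 / 2 ^ n : ℝ) * ∑ σ : Equiv.Perm (Fin (2 * n + 1)),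
    ((Equiv.Perm.sign σ : ℤ) : ℝ) * (θ x (v (σ 0)) *
      ∏ i : Fin n, extD θ x (v (σ ⟨2 * i.val + 1, by omega⟩)) (v (σ ⟨2 * i.val + 2, by omega⟩)))

/-- `θ` is a contact form: it is smooth and `θ ∧ (dθ)^n ≠ 0` everywhere. -/
def IsContactForm [IsManifold (𝓡 (2 * n + 1)) ∞ M] (θ : OneForm (2 * n + 1) M) : Prop :=
  SmoothForm θ ∧ ∀ x : M, ∃ v, contactVolumeForm θ x v ≠ 0

/-- `(M,θ,g)` is a K-contact manifold of dimension `2n+1`. -/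
structure IsKContact [IsManifold (𝓡 (2 * n + 1)) ∞ M] (θ : OneForm (2 * n + 1) M)
    (g : SmoothMetric (2 * n + 1) M) : Prop where
  contact : IsContactForm θ
  associated : IsAssociated θ g
  killing : IsKilling g (reeb θ)

end KContact

end ContactCurvature

end

open ContactCurvature

noncomputable section

namespace ContactCurvature

set_option linter.unusedSectionVars false

/-! Everything is transported to stream functions. With f = θ(u), a field u is contact exactly when
df + ι_u dθ = E(f) θ. Since β = dθ + θ ⊗ θ is nondegenerate, f determines u, and every smooth f
occurs. For f = θ(X) and h = θ(Y), Cartan's formula gives θ([X,Y]) = X(h) - h E(f) = {f,h}, so the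
geometry of the group becomes a computation with functions, first-order operators and integrals over
M.

The analytic input is one divergence formula. Put m = 2n+1; then a contact field X satisfies div X =
(m+1)/2 E(f) = (n+1) E(f), and in particular div E = 0. Indeed β(u,v) = (u, ψv) with ψ = φ + θ ⊗ E
and ψ⁴ = 1, so det g = |det β| in every chart (`ContactMetric.det_gram`). With l = E(f), the Lie
derivative of β along X is l β + l θ ⊗ θ + dl ⊗ θ - θ ⊗ dl. Its trace with respect to β is (m+1) l,
because the last two terms cancel (`trace_adjugate_mul`, `fderiv_det_contactMatrix`). A partition of
unity makes this global (`ContactMetric.integral_divergence`).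

Integration by parts then shows that θ(∇_X Y) = ½({f,h} + (n+3)(f E(h) + h E(f))) defines a
torsion-free metric connection, and that B(X,Y) has stream function Y(f) + (n+2) f E(h). Uniqueness
follows from Koszul's formula and the definiteness of the L² product. The metric property reduces
C(X,Y) to an integral of first-order expressions in f, h and {f,h}. Its integrand differs from
¼[{f,h} - (n+3)(f E(h) - h E(f))]² only by divergences (`ContactMetric.curvC_eq`), while Arnold's
integrand equals this square pointwise (`ContactMetric.arnoldC_eq`). Nonnegativity is then immediate
at the identity, and right translation carries it to every η. -/

/-! ### Linear algebra: skew forms and derivatives of determinants -/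

/-- A skew-symmetric bilinear form on an odd-dimensional space is degenerate. -/
theorem exists_ne_zero_of_skew {m : ℕ} (hm : Odd m)
    (B : EuclideanSpace ℝ (Fin m) → EuclideanSpace ℝ (Fin m) → ℝ)
    (hadd : ∀ a b c, B a (b + c) = B a b + B a c) (hsmul : ∀ (r : ℝ) a b, B a (r • b) = r * B a b)
    (hskew : ∀ a b, B a b = -B b a) : ∃ e ≠ 0, ∀ v, B v e = 0 := by
  let L : EuclideanSpace ℝ (Fin m) → EuclideanSpace ℝ (Fin m) →ₗ[ℝ] ℝ := fun a =>
    { toFun := B a, map_add' := hadd a, map_smul' := fun r b => hsmul r a b }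
  let e := EuclideanSpace.basisFun (Fin m) ℝ
  let A : Matrix (Fin m) (Fin m) ℝ := Matrix.of fun i j => B (e i) (e j)
  have hA : A.transpose = -A := by ext i j; exact hskew _ _
  have hdet : A.det = 0 := by
    have h1 := congrArg Matrix.det hA
    rw [Matrix.det_transpose, Matrix.det_neg, Fintype.card_fin, hm.neg_one_pow] at h1
    linarith
  obtain ⟨v, hv0, hv⟩ := Matrix.exists_mulVec_eq_zero_iff.2 hdet
  have key : ∀ i, B (e i) (WithLp.toLp 2 v) = 0 := by
    intro i
    have h := congrFun hv i
    have h2 : (WithLp.toLp 2 v : EuclideanSpace ℝ (Fin m)) = ∑ j, v j • e j := by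
      exact (e.sum_repr (WithLp.toLp 2 v)).symm
    change L (e i) _ = 0
    rw [h2, map_sum]
    simp only [map_smul, smul_eq_mul]
    simpa [Matrix.mulVec, dotProduct, A, L, mul_comm] using h
  refine ⟨WithLp.toLp 2 v, fun h => hv0 ?_, fun w => ?_⟩
  · ext i; simpa using congrFun (congrArg WithLp.ofLp h) i
  · rw [hskew, neg_eq_zero]
    change L (WithLp.toLp 2 v) w = 0
    rw [← e.sum_repr w, map_sum]
    refine Finset.sum_eq_zero fun i _ => ?_
    rw [map_smul]
    change _ • B _ _ = 0
    rw [hskew, key]; simp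

/-- Jacobi's formula for the derivative of a determinant. -/
theorem hasFDerivAt_det {W ι : Type*} [NormedAddCommGroup W] [NormedSpace ℝ W] [Fintype ι]
    [DecidableEq ι] {A : W → Matrix ι ι ℝ} {A' : ι → ι → W →L[ℝ] ℝ} {y : W}
    (h : ∀ i j, HasFDerivAt (fun z => A z i j) (A' i j) y) :
    HasFDerivAt (fun z => (A z).det) (∑ i, ∑ j, (A y).adjugate j i • A' i j) y := by
  let D : ContinuousMultilinearMap ℝ (fun _ : ι => ι → ℝ) ℝ :=
    ⟨(Matrix.detRowAlternating (R := ℝ) (n := ι)).toMultilinearMap, by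
      change Continuous fun A : ι → ι → ℝ => Matrix.det A
      exact Continuous.matrix_det continuous_id⟩
  have hA : HasFDerivAt (fun z => (fun i j => A z i j : ι → ι → ℝ))
      (ContinuousLinearMap.pi fun i => ContinuousLinearMap.pi fun j => A' i j) y :=
    hasFDerivAt_pi.2 fun i => hasFDerivAt_pi.2 fun j => h i j
  have := (D.hasFDerivAt (fun i j => A y i j)).comp y hA
  convert! this using 1
  ext w
  simp only [ContinuousLinearMap.comp_apply, ContinuousMultilinearMap.linearDeriv_apply,
    sum_apply, smul_apply, smul_eq_mul]
  refine Finset.sum_congr rfl fun i _ => ?_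
  -- Replacing row i by b and expanding along that row produces the cofactors, which are column i of
  -- the adjugate.
  have h3 : ∀ b : ι → ℝ, D (Function.update (fun i j => A y i j) i b)
      = ∑ j, (A y).adjugate j i * b j := by
    intro b
    have h4 : ((A y).updateRow i b).det = ∑ j, (A y).adjugate j i * b j := by
      rw [← Matrix.cramer_transpose_apply, Matrix.cramer_eq_adjugate_mulVec,
        ← Matrix.adjugate_transpose]
      rfl
    exact h4
  rw [h3]
  rfl

/-- The trace identity behind the divergence of a contact field: `A` is the matrix of
`dθ + θ ⊗ θ`, `A'` that of its Lie derivative corrected by the Jacobian `J`. -/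
theorem trace_adjugate_mul {ι : Type*} [Fintype ι] [DecidableEq ι] (A J : Matrix ι ι ℝ)
    (t l e : ι → ℝ) (c : ℝ) (h1 : A.mulVec e = t) (h2 : Matrix.vecMul e A = t)
    (h3 : dotProduct t e = 1) :
    (A.adjugate * (-(J.transpose * A) - A * J + c • A + c • Matrix.vecMulVec t t
      + Matrix.vecMulVec l t - Matrix.vecMulVec t l)).trace
      = A.det * (-2 * J.trace + (Fintype.card ι + 1) * c) := by
  have k1 : (A.adjugate * (J.transpose * A)).trace = A.det * J.trace := by
    rw [← mul_assoc, Matrix.trace_mul_comm, ← mul_assoc, Matrix.mul_adjugate, Matrix.smul_mul,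
      one_mul, Matrix.trace_smul, Matrix.trace_transpose, smul_eq_mul]
  have k2 : (A.adjugate * (A * J)).trace = A.det * J.trace := by
    rw [← mul_assoc, Matrix.adjugate_mul, Matrix.smul_mul,
      one_mul, Matrix.trace_smul, smul_eq_mul]
  have k3 : (A.adjugate * A).trace = A.det * Fintype.card ι := by
    rw [Matrix.adjugate_mul, Matrix.trace_smul, Matrix.trace_one, smul_eq_mul]
  -- Since t is both A e and e A, the adjugate sends t to det A · e from either side. So t ⊗ t
  -- contributes det A, and the traces of l ⊗ t and t ⊗ l are equal and cancel.
  have m1 : A.adjugate.mulVec t = A.det • e := by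
    rw [← h1, Matrix.mulVec_mulVec, Matrix.adjugate_mul, Matrix.smul_mulVec, Matrix.one_mulVec]
  have m2 : Matrix.vecMul t A.adjugate = A.det • e := by
    rw [← h2, Matrix.vecMul_vecMul, Matrix.mul_adjugate, Matrix.vecMul_smul, Matrix.vecMul_one]
  have k4 : (A.adjugate * Matrix.vecMulVec t t).trace = A.det := by
    rw [Matrix.mul_vecMulVec, m1, Matrix.trace_vecMulVec, smul_dotProduct, dotProduct_comm, h3]
    simp
  have k5 : (A.adjugate * Matrix.vecMulVec t l).trace = A.det * dotProduct e l := by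
    rw [Matrix.mul_vecMulVec, m1, Matrix.trace_vecMulVec, smul_dotProduct]
    simp
  have k6 : (A.adjugate * Matrix.vecMulVec l t).trace = A.det * dotProduct e l := by
    rw [Matrix.mul_vecMulVec, Matrix.trace_vecMulVec, dotProduct_comm,
      Matrix.dotProduct_mulVec, m2, smul_dotProduct]
    simp
  simp only [Matrix.mul_add, Matrix.mul_sub, Matrix.mul_neg, Matrix.mul_smul, Matrix.trace_add,
    Matrix.trace_sub, Matrix.trace_neg, Matrix.trace_smul, smul_eq_mul, k1, k2, k3, k4, k5, k6]
  ring

/-! ### The form dθ + θ ⊗ θ on a vector space and its derivative along a contact field -/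

section NormedSpace

variable {W ι : Type*} [NormedAddCommGroup W] [NormedSpace ℝ W] [Fintype ι] [DecidableEq ι]

/-- The exterior derivative of a 1-form on a normed space. -/
def flatD (t : W → W →L[ℝ] ℝ) (y a b : W) : ℝ := fderiv ℝ t y a b - fderiv ℝ t y b a

/-- The matrix of the bilinear form `dθ + θ ⊗ θ`. -/
def contactMatrix (v : Module.Basis ι ℝ W) (t : W → W →L[ℝ] ℝ) (y : W) : Matrix ι ι ℝ :=
  Matrix.of fun i j => flatD t y (v i) (v j) + t y (v i) * t y (v j)

set_option synthInstance.maxHeartbeats 400000 in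
/-- The derivative of `det (dθ + θ ⊗ θ)` along a contact field. -/
theorem fderiv_det_contactMatrix (v : Module.Basis ι ℝ W) {t : W → W →L[ℝ] ℝ}
    {u : W → W} {l : W → ℝ} {y e : W} (ht : ContDiffAt ℝ 2 t y) (hu : ContDiffAt ℝ 2 u y)
    (hl : DifferentiableAt ℝ l y)
    (hc : ∀ᶠ z in 𝓝 y, ∀ w, fderiv ℝ t z (u z) w + t z (fderiv ℝ u z w) = l z * t z w)
    (he1 : t y e = 1) (he : ∀ b, flatD t y e b = 0) :
    DifferentiableAt ℝ (fun z => (contactMatrix v t z).det) y ∧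
    fderiv ℝ (fun z => (contactMatrix v t z).det) y (u y)
      = (contactMatrix v t y).det
        * (-2 * (∑ i, v.repr (fderiv ℝ u y (v i)) i) + (Fintype.card ι + 1) * l y) := by
  have ht1 : HasFDerivAt t (fderiv ℝ t y) y := (ht.differentiableAt (by simp)).hasFDerivAt
  have hu1 : HasFDerivAt u (fderiv ℝ u y) y := (hu.differentiableAt (by simp)).hasFDerivAt
  have ht2 : HasFDerivAt (fderiv ℝ t) (fderiv ℝ (fderiv ℝ t) y) y :=
    ((ht.fderiv_right (m := 1) (by norm_num)).differentiableAt (by simp)).hasFDerivAt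
  have hu2 : HasFDerivAt (fderiv ℝ u) (fderiv ℝ (fderiv ℝ u) y) y :=
    ((hu.fderiv_right (m := 1) (by norm_num)).differentiableAt (by simp)).hasFDerivAt
  have hts : IsSymmSndFDerivAt ℝ t y := ht.isSymmSndFDerivAt (by simp)
  have hus : IsSymmSndFDerivAt ℝ u y := hu.isSymmSndFDerivAt (by simp)
  have hc0 := hc.self_of_nhds
  -- This is the contact equation, paired with w and differentiated in the direction a.
  have key : ∀ a w, fderiv ℝ (fderiv ℝ t) y a (u y) w + fderiv ℝ t y (fderiv ℝ u y a) w
      + fderiv ℝ t y a (fderiv ℝ u y w) + t y (fderiv ℝ (fderiv ℝ u) y a w)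
      = fderiv ℝ l y a * t y w + l y * fderiv ℝ t y a w := by
    intro a w
    have d1 : HasFDerivAt (fun z => fderiv ℝ t z (u z) w + t z (fderiv ℝ u z w)) _ y :=
      ((ht2.clm_apply hu1).clm_apply (hasFDerivAt_const w y)).add
        (ht1.clm_apply (hu2.clm_apply (hasFDerivAt_const w y)))
    have d2 : HasFDerivAt (fun z => l z * t z w) _ y :=
      hl.hasFDerivAt.mul (ht1.clm_apply (hasFDerivAt_const w y))
    have heq : (fun z => fderiv ℝ t z (u z) w + t z (fderiv ℝ u z w))
        =ᶠ[𝓝 y] fun z => l z * t z w := hc.mono fun z hz => hz w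
    have := congrArg (fun L => L a) ((d1.congr_of_eventuallyEq heq.symm).unique d2)
    simp at this
    linarith
  have hentry : ∀ i j, HasFDerivAt (fun z => contactMatrix v t z i j) _ y := fun i j =>
    (((ht2.clm_apply (hasFDerivAt_const (v i) y)).clm_apply
      (hasFDerivAt_const (v j) y)).sub
      ((ht2.clm_apply (hasFDerivAt_const (v j) y)).clm_apply
      (hasFDerivAt_const (v i) y))).add
      ((ht1.clm_apply (hasFDerivAt_const (v i) y)).mul
        (ht1.clm_apply (hasFDerivAt_const (v j) y)))
  have hdet := hasFDerivAt_det hentry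
  refine ⟨hdet.differentiableAt, ?_⟩
  rw [hdet.fderiv]
  set J : Matrix ι ι ℝ := Matrix.of fun i j => v.repr (fderiv ℝ u y (v j)) i with hJ
  set τ : ι → ℝ := fun i => t y (v i) with hτ
  set ℓ : ι → ℝ := fun i => fderiv ℝ l y (v i) with hℓ
  have exp1 : ∀ (L : W →ₗ[ℝ] ℝ) (w : W), L w = ∑ k, v.repr w k * L (v k) := by
    intro L w
    conv_lhs => rw [← v.sum_repr w, map_sum]
    simp
  have hD : ∀ i, ∀ w, flatD t y w (v i) = ∑ k, v.repr w k * flatD t y (v k) (v i) := fun i w =>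
    exp1 ⟨⟨fun w => flatD t y w (v i), fun a b => by simp [flatD]; ring⟩,
      fun r b => by simp [flatD]; ring⟩ w
  have hD' : ∀ i, ∀ w, flatD t y (v i) w = ∑ k, v.repr w k * flatD t y (v i) (v k) := fun i w =>
    exp1 ⟨⟨fun w => flatD t y (v i) w, fun a b => by simp [flatD]; ring⟩,
      fun r b => by simp [flatD]; ring⟩ w
  have hT : ∀ w, t y w = ∑ k, v.repr w k * t y (v k) := fun w => exp1 (t y : W →ₗ[ℝ] ℝ) w
  have hmul : ∀ i w, flatD t y w (v i) + t y w * t y (v i)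
      = ∑ k, v.repr w k * contactMatrix v t y k i := by
    intro i w
    rw [hD, hT, Finset.sum_mul, ← Finset.sum_add_distrib]
    exact Finset.sum_congr rfl fun k _ => by simp only [contactMatrix, Matrix.of_apply]; ring
  have hmul' : ∀ i w, flatD t y (v i) w + t y (v i) * t y w
      = ∑ k, v.repr w k * contactMatrix v t y i k := by
    intro i w
    rw [hD', hT w, Finset.mul_sum, ← Finset.sum_add_distrib]
    exact Finset.sum_congr rfl fun k _ => by simp only [contactMatrix, Matrix.of_apply]; ring
  -- The coordinates of e play the role of the vector e in `trace_adjugate_mul`: θ(e) = 1 and ι_e dθ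
  -- = 0 say that e is dual to θ under dθ + θ ⊗ θ on both sides.
  have h1 : (contactMatrix v t y).mulVec (v.repr e) = τ := by
    ext i
    have := hmul' i e
    rw [he1] at this
    have h0 : flatD t y (v i) e = 0 := by
      have := he (v i); simp only [flatD] at this ⊢; linarith
    rw [h0] at this
    simp only [Matrix.mulVec, dotProduct, hτ]
    rw [← zero_add (t y (v i)), ← mul_one (t y (v i)), this]
    exact Finset.sum_congr rfl fun k _ => mul_comm _ _
  have h2 : Matrix.vecMul (v.repr e) (contactMatrix v t y) = τ := by
    ext i
    have := hmul i e
    rw [he1, he] at this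
    simp only [Matrix.vecMul, dotProduct, hτ]
    rw [← this]; ring
  have h3 : dotProduct τ (v.repr e) = 1 := by
    rw [← he1, hT e]
    exact Finset.sum_congr rfl fun k _ => mul_comm _ _
  have htr := trace_adjugate_mul (contactMatrix v t y) J τ ℓ (v.repr e) (l y) h1 h2 h3
  have hJt : J.trace = ∑ i, v.repr (fderiv ℝ u y (v i)) i := rfl
  rw [← hJt, ← htr, Matrix.trace, Finset.sum_comm]
  simp only [sum_apply, Matrix.diag_apply]
  refine Finset.sum_congr rfl fun i _ => ?_
  rw [Matrix.mul_apply]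
  refine Finset.sum_congr rfl fun j _ => ?_
  rw [smul_apply, smul_eq_mul]
  congr 1
  have e1 : (J.transpose * contactMatrix v t y) j i
      = flatD t y (fderiv ℝ u y (v j)) (v i) + t y (fderiv ℝ u y (v j)) * t y (v i) := by
    rw [hmul, Matrix.mul_apply]; rfl
  have e2 : (contactMatrix v t y * J) j i
      = flatD t y (v j) (fderiv ℝ u y (v i)) + t y (v j) * t y (fderiv ℝ u y (v i)) := by
    rw [hmul', Matrix.mul_apply]; exact Finset.sum_congr rfl fun k _ => mul_comm _ _
  simp only [Matrix.add_apply, Matrix.sub_apply, Matrix.neg_apply, Matrix.smul_apply,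
    Matrix.vecMulVec_apply, e1, e2, smul_eq_mul]
  -- The difference of these two instances is L_u dθ = dl ∧ θ + l dθ in coordinates; the second
  -- derivatives of u cancel by symmetry. The instances c1 and c2 of the contact equation account
  -- for θ ⊗ θ.
  have k1 := key (v j) (v i)
  have k2 := key (v i) (v j)
  rw [hus.eq] at k2
  have c1 := hc0 (v i)
  have c2 := hc0 (v j)
  simp [contactMatrix, flatD, hτ, hℓ]
  -- Symmetry of the second derivative of t turns derivatives of the contact equation into
  -- derivatives of the matrix entries along u.
  have s1 := hts.eq (v j) (u y)
  have s2 := hts.eq (v i) (u y)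
  rw [s1] at k1
  rw [s2] at k2
  linear_combination k1 - k2 + t y (v i) * c2 + t y (v j) * c1

end NormedSpace

/-! ### Divergence of contact fields on an open subset of a vector space -/

section NormedSpace

variable {W ι : Type*} [NormedAddCommGroup W] [NormedSpace ℝ W] [Fintype ι] [DecidableEq ι]

/-- The divergence of `k u`, with respect to the density `√|det (dθ + θ ⊗ θ)|`, for a contact
field `u`. -/
theorem sum_fderiv_mul_sqrt_det (v : Module.Basis ι ℝ W) {t : W → W →L[ℝ] ℝ}
    {u : W → W} {l k : W → ℝ} {y e : W} (ht : ContDiffAt ℝ 2 t y) (hu : ContDiffAt ℝ 2 u y)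
    (hl : DifferentiableAt ℝ l y) (hk : DifferentiableAt ℝ k y)
    (hc : ∀ᶠ z in 𝓝 y, ∀ w, fderiv ℝ t z (u z) w + t z (fderiv ℝ u z w) = l z * t z w)
    (he1 : t y e = 1) (he : ∀ b, flatD t y e b = 0) (h0 : (contactMatrix v t y).det ≠ 0) :
    ∑ i, fderiv ℝ (fun z => k z * (√|(contactMatrix v t z).det| * v.repr (u z) i)) y (v i)
      = (fderiv ℝ k y (u y) + (Fintype.card ι + 1) / 2 * l y * k y)
        * √|(contactMatrix v t y).det| := by
  have : FiniteDimensional ℝ W := v.finiteDimensional_of_finite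
  obtain ⟨hd, hd'⟩ := fderiv_det_contactMatrix v ht hu hl hc he1 he
  set δ := fun z => (contactMatrix v t z).det with hδ
  have hu1 : HasFDerivAt u (fderiv ℝ u y) y := (hu.differentiableAt (by simp)).hasFDerivAt
  have hab : HasFDerivAt (fun z => |δ z|) (((SignType.sign (δ y) : ℝ)) • fderiv ℝ δ y) y :=
    HasDerivAt.comp_hasFDerivAt (h₂ := fun r : ℝ => |r|) y (hasDerivAt_abs h0) hd.hasFDerivAt
  have hpos : 0 < |δ y| := abs_pos.2 h0
  have hsq := hab.sqrt hpos.ne'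
  let C : ι → W →L[ℝ] ℝ := fun i => LinearMap.toContinuousLinearMap (v.coord i)
  have hterm : ∀ i, fderiv ℝ (fun z => k z * (√|δ z| * v.repr (u z) i)) y (v i)
      = k y * (√|δ y| * v.repr (fderiv ℝ u y (v i)) i
        + v.repr (u y) i * (1 / (2 * √|δ y|) * (SignType.sign (δ y) * fderiv ℝ δ y (v i))))
        + √|δ y| * v.repr (u y) i * fderiv ℝ k y (v i) := by
    intro i
    have h1 : HasFDerivAt (fun z => v.repr (u z) i) ((C i).comp (fderiv ℝ u y)) y :=
      (C i).hasFDerivAt.comp y hu1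
    have h2 : HasFDerivAt (fun z => k z * (√|δ z| * v.repr (u z) i)) _ y :=
      hk.hasFDerivAt.mul (hsq.mul h1)
    rw [h2.fderiv]
    simp only [add_apply, smul_apply, smul_eq_mul, ContinuousLinearMap.comp_apply]
    rfl
  have hexp : ∀ L : W →L[ℝ] ℝ, L (u y) = ∑ i, v.repr (u y) i * L (v i) := by
    intro L
    conv_lhs => rw [← v.sum_repr (u y), map_sum]
    simp
  have hsum : ∑ i, fderiv ℝ (fun z => k z * (√|δ z| * v.repr (u z) i)) y (v i)
      = k y * √|δ y| * (∑ i, v.repr (fderiv ℝ u y (v i)) i)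
        + k y * (1 / (2 * √|δ y|) * SignType.sign (δ y)) * fderiv ℝ δ y (u y)
        + √|δ y| * fderiv ℝ k y (u y) := by
    rw [hexp (fderiv ℝ δ y), hexp (fderiv ℝ k y), Finset.mul_sum, Finset.mul_sum, Finset.mul_sum,
      ← Finset.sum_add_distrib, ← Finset.sum_add_distrib]
    refine Finset.sum_congr rfl fun i _ => ?_
    rw [hterm]; ring
  -- Here sign(δ) δ = |δ| is split as √|δ| · √|δ|, so that differentiating √|δ| yields half the
  -- logarithmic derivative of δ, whatever its sign.
  have hs : (SignType.sign (δ y) : ℝ) * δ y = √|δ y| * √|δ y| := by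
    rw [Real.mul_self_sqrt hpos.le, sign_mul_self]
  have hne : √|δ y| ≠ 0 := (Real.sqrt_pos.2 hpos).ne'
  -- Half of the term -2 tr(Du) in the derivative of the determinant cancels the trace that comes
  -- from differentiating u, and half of (card ι + 1) l survives.
  rw [hsum, hd']
  have : (1 / (2 * √|δ y|) * (SignType.sign (δ y) : ℝ)) * δ y = √|δ y| / 2 := by
    rw [mul_assoc, hs]; field_simp
  change _ + k y * (1 / (2 * √|δ y|) * (SignType.sign (δ y) : ℝ)) * (δ y * _) + _ = _
  rw [mul_assoc (k y) _ (δ y * _), ← mul_assoc _ (δ y), this]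
  ring

/-- Integration by parts against the constant function 1. -/
theorem integral_fderiv_apply_eq_zero [FiniteDimensional ℝ W] [MeasurableSpace W] [BorelSpace W]
    (μ : Measure W) [μ.IsAddHaarMeasure] {F : W → ℝ} (hF : ContDiff ℝ 1 F)
    (hc : HasCompactSupport F) (v : W) : ∫ y, fderiv ℝ F y v ∂μ = 0 := by
  have h1 : Integrable (fun y => fderiv ℝ F y v) μ := by
    refine Continuous.integrable_of_hasCompactSupport ?_ ?_
    · exact (hF.continuous_fderiv (by simp)).clm_apply continuous_const
    · exact (hc.fderiv (𝕜 := ℝ)).comp_left (g := fun L : W →L[ℝ] ℝ => L v) (by simp)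
  have := integral_mul_fderiv_eq_neg_fderiv_mul_of_integrable (μ := μ) (f := fun _ => (1 : ℝ))
    (g := F) (v := v) (by simp) (by simpa using h1)
    (by simpa using hF.continuous.integrable_of_hasCompactSupport hc)
    (fun _ _ => differentiableAt_const _) (fun x _ => hF.differentiable (by simp) x)
  simpa using this

/-- Near a point outside s the factor k vanishes identically, so the behaviour of f there is
irrelevant. -/
theorem contDiff_mul_of_tsupport_subset {n : WithTop ℕ∞} {s : Set W} (hs : IsOpen s)
    {k f : W → ℝ} (hk : ContDiffOn ℝ n k s) (hf : ContDiffOn ℝ n f s) (hsupp : tsupport k ⊆ s) :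
    ContDiff ℝ n (fun y => k y * f y) := by
  rw [contDiff_iff_contDiffAt]
  intro y
  by_cases hy : y ∈ s
  · exact (hk.contDiffAt (hs.mem_nhds hy)).mul (hf.contDiffAt (hs.mem_nhds hy))
  · have h0 : (fun y => k y * f y) =ᶠ[𝓝 y] fun _ => 0 := by
      filter_upwards [(isClosed_tsupport k).isOpen_compl.mem_nhds fun h => hy (hsupp h)] with z hz
      rw [image_eq_zero_of_notMem_tsupport hz, zero_mul]
    exact contDiffAt_const.congr_of_eventuallyEq h0

theorem contDiffOn_det_contactMatrix (v : Module.Basis ι ℝ W) {t : W → W →L[ℝ] ℝ} {s : Set W}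
    (hs : IsOpen s) (ht : ContDiffOn ℝ ∞ t s) :
    ContDiffOn ℝ ∞ (fun z => (contactMatrix v t z).det) s := by
  have h1 : ContDiffOn ℝ ∞ (fderiv ℝ t) s := ht.fderiv_of_isOpen hs (by simp)
  have hf : ∀ a b, ContDiffOn ℝ ∞ (fun z => fderiv ℝ t z a b) s := fun a b =>
    (h1.clm_apply contDiffOn_const).clm_apply contDiffOn_const
  have hg : ∀ a, ContDiffOn ℝ ∞ (fun z => t z a) s := fun a => ht.clm_apply contDiffOn_const
  simp only [Matrix.det_apply]
  refine ContDiffOn.sum fun σ _ => ContDiffOn.const_smul _ (contDiffOn_prod fun i _ => ?_)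
  exact ((hf _ _).sub (hf _ _)).add ((hg _).mul (hg _))

/-- The integral of the divergence of `k u` vanishes. -/
theorem integral_divergence_eq_zero [MeasurableSpace W] [BorelSpace W]
    (μ : Measure W) [μ.IsAddHaarMeasure] (v : Module.Basis ι ℝ W) {t : W → W →L[ℝ] ℝ}
    {u e : W → W} {l k : W → ℝ} {s : Set W} (hs : IsOpen s)
    (ht : ContDiffOn ℝ ∞ t s) (hu : ContDiffOn ℝ ∞ u s) (hl : ContDiffOn ℝ ∞ l s)
    (hk : ContDiffOn ℝ ∞ k s) (hkc : HasCompactSupport k) (hks : tsupport k ⊆ s)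
    (hc : ∀ z ∈ s, ∀ w, fderiv ℝ t z (u z) w + t z (fderiv ℝ u z w) = l z * t z w)
    (he1 : ∀ z ∈ s, t z (e z) = 1) (he : ∀ z ∈ s, ∀ b, flatD t z (e z) b = 0)
    (h0 : ∀ z ∈ s, (contactMatrix v t z).det ≠ 0) :
    ∫ z in s, (fderiv ℝ k z (u z) + (Fintype.card ι + 1) / 2 * l z * k z)
        * √|(contactMatrix v t z).det| ∂μ = 0 := by
  have : FiniteDimensional ℝ W := v.finiteDimensional_of_finite
  have hden : ContDiffOn ℝ ∞ (fun z => √|(contactMatrix v t z).det|) s := fun z hz =>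
    ((contDiffOn_det_contactMatrix v hs ht).contDiffAt (hs.mem_nhds hz)).abs (h0 z hz)
      |>.sqrt (abs_ne_zero.2 (h0 z hz)) |>.contDiffWithinAt
  have hcoord : ∀ i, ContDiffOn ℝ ∞ (fun z => v.repr (u z) i) s := fun i =>
    (LinearMap.toContinuousLinearMap (v.coord i)).contDiff.comp_contDiffOn hu
  -- These are the components of k √|det| u. They are smooth on the whole space because the support
  -- of k lies in s, although t and u are controlled only on s.
  set F : ι → W → ℝ := fun i z => k z * (√|(contactMatrix v t z).det| * v.repr (u z) i) with hF
  have hF1 : ∀ i, ContDiff ℝ 1 (F i) := fun i =>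
    (contDiff_mul_of_tsupport_subset hs hk (hden.mul (hcoord i)) hks).of_le (by simp)
  have hF2 : ∀ i, HasCompactSupport (F i) := fun i => hkc.mul_right
  have hsum : ∫ z, ∑ i, fderiv ℝ (F i) z (v i) ∂μ = 0 := by
    rw [integral_finsetSum]
    · exact Finset.sum_eq_zero fun i _ => integral_fderiv_apply_eq_zero μ (hF1 i) (hF2 i) _
    · intro i _
      refine Continuous.integrable_of_hasCompactSupport ?_ ?_
      · exact ((hF1 i).continuous_fderiv (by simp)).clm_apply continuous_const
      · exact ((hF2 i).fderiv (𝕜 := ℝ)).comp_left (g := fun L : W →L[ℝ] ℝ => L (v i)) (by simp)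
  have hcl : ∀ z ∉ s, ∑ i, fderiv ℝ (F i) z (v i) = 0 := by
    intro z hz
    refine Finset.sum_eq_zero fun i _ => ?_
    have h0 : F i =ᶠ[𝓝 z] fun _ => 0 := by
      filter_upwards [(isClosed_tsupport k).isOpen_compl.mem_nhds fun h => hz (hks h)] with y hy
      rw [hF]; simp only; rw [image_eq_zero_of_notMem_tsupport hy, zero_mul]
    rw [h0.fderiv_eq]; simp
  rw [← hsum, ← setIntegral_eq_integral_of_forall_compl_eq_zero hcl]
  refine setIntegral_congr_fun hs.measurableSet fun z hz => ?_
  have hn := hs.mem_nhds hz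
  exact (sum_fderiv_mul_sqrt_det v ((ht.contDiffAt hn).of_le (by norm_cast))
    ((hu.contDiffAt hn).of_le (by norm_cast)) ((hl.contDiffAt hn).differentiableAt (by simp))
    ((hk.contDiffAt hn).differentiableAt (by simp))
    (by filter_upwards [hn] with y hy using hc y hy) (he1 z hz) (he z hz) (h0 z hz)).symm

end NormedSpace

/-! ### Calculus of functions, vector fields and 1-forms in charts -/

section Charts

variable {m : ℕ} {M : Type*} [TopologicalSpace M] [ChartedSpace (EuclideanSpace ℝ (Fin m)) M]

/-- The derivative of the chart at `x₀`. -/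
def push (x₀ x : M) : TangentSpace (𝓡 m) x →L[ℝ] EuclideanSpace ℝ (Fin m) :=
  mfderiv (𝓡 m) 𝓘(ℝ, EuclideanSpace ℝ (Fin m)) (extChartAt (𝓡 m) x₀) x

/-- The derivative of the inverse of the chart at `x₀`. -/
def pull (x₀ : M) (y : EuclideanSpace ℝ (Fin m)) :
    EuclideanSpace ℝ (Fin m) →L[ℝ] TangentSpace (𝓡 m) ((extChartAt (𝓡 m) x₀).symm y) :=
  mfderiv 𝓘(ℝ, EuclideanSpace ℝ (Fin m)) (𝓡 m) (extChartAt (𝓡 m) x₀).symm y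

/-- A vector field in the chart at `x₀`. -/
def vecInChart (u : VField m M) (x₀ : M) (y : EuclideanSpace ℝ (Fin m)) :
    EuclideanSpace ℝ (Fin m) :=
  push x₀ ((extChartAt (𝓡 m) x₀).symm y) (u ((extChartAt (𝓡 m) x₀).symm y))

theorem formInChart_apply (θ : OneForm m M) (x₀ : M) (y a : EuclideanSpace ℝ (Fin m)) :
    formInChart θ x₀ y a = θ ((extChartAt (𝓡 m) x₀).symm y) (pull x₀ y a) := rfl

theorem isOpen_target (x₀ : M) : IsOpen (extChartAt (𝓡 m) x₀).target :=
  isOpen_extChartAt_target x₀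

theorem target_mem_nhds {x₀ : M} {y : EuclideanSpace ℝ (Fin m)}
    (hy : y ∈ (extChartAt (𝓡 m) x₀).target) : (extChartAt (𝓡 m) x₀).target ∈ 𝓝 y :=
  (isOpen_target x₀).mem_nhds hy

theorem symm_mem_chart_source {x₀ : M} {y : EuclideanSpace ℝ (Fin m)}
    (hy : y ∈ (extChartAt (𝓡 m) x₀).target) :
    (extChartAt (𝓡 m) x₀).symm y ∈ (chartAt (EuclideanSpace ℝ (Fin m)) x₀).source := by
  have := (extChartAt (𝓡 m) x₀).map_target hy
  rwa [extChartAt_source] at this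

variable [IsManifold (𝓡 m) ∞ M]

theorem push_pull {x₀ : M} {y : EuclideanSpace ℝ (Fin m)}
    (hy : y ∈ (extChartAt (𝓡 m) x₀).target) (a : EuclideanSpace ℝ (Fin m)) :
    push x₀ ((extChartAt (𝓡 m) x₀).symm y) (pull x₀ y a) = a := by
  have := mfderiv_extChartAt_comp_mfderivWithin_extChartAt_symm (I := 𝓡 m) hy
  rw [ModelWithCorners.range_eq_univ, mfderivWithin_univ] at this
  exact DFunLike.congr_fun this a

theorem pull_push {x₀ : M} {y : EuclideanSpace ℝ (Fin m)}
    (hy : y ∈ (extChartAt (𝓡 m) x₀).target)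
    (w : TangentSpace (𝓡 m) ((extChartAt (𝓡 m) x₀).symm y)) :
    pull x₀ y (push x₀ ((extChartAt (𝓡 m) x₀).symm y) w) = w := by
  have := mfderivWithin_extChartAt_symm_comp_mfderiv_extChartAt (I := 𝓡 m) hy
  rw [ModelWithCorners.range_eq_univ, mfderivWithin_univ] at this
  exact DFunLike.congr_fun this w

theorem pull_vecInChart (u : VField m M) {x₀ : M} {y : EuclideanSpace ℝ (Fin m)}
    (hy : y ∈ (extChartAt (𝓡 m) x₀).target) :
    pull x₀ y (vecInChart u x₀ y) = u ((extChartAt (𝓡 m) x₀).symm y) := pull_push hy _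

theorem applyForm_symm (θ : OneForm m M) (u : VField m M) {x₀ : M} {y : EuclideanSpace ℝ (Fin m)}
    (hy : y ∈ (extChartAt (𝓡 m) x₀).target) :
    applyForm θ u ((extChartAt (𝓡 m) x₀).symm y) = formInChart θ x₀ y (vecInChart u x₀ y) := by
  rw [formInChart_apply, pull_vecInChart u hy, applyForm]

theorem mdifferentiableAt_symm {x₀ : M} {y : EuclideanSpace ℝ (Fin m)}
    (hy : y ∈ (extChartAt (𝓡 m) x₀).target) :
    MDifferentiableAt 𝓘(ℝ, EuclideanSpace ℝ (Fin m)) (𝓡 m) (extChartAt (𝓡 m) x₀).symm y := by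
  have := mdifferentiableWithinAt_extChartAt_symm (I := 𝓡 m) hy
  rwa [ModelWithCorners.range_eq_univ, mdifferentiableWithinAt_univ] at this

theorem contMDiffOn_source_iff {F : Type*} [NormedAddCommGroup F] [NormedSpace ℝ F]
    (f : M → F) (x₀ : M) :
    ContMDiffOn (𝓡 m) 𝓘(ℝ, F) ∞ f (chartAt (EuclideanSpace ℝ (Fin m)) x₀).source ↔
      ContDiffOn ℝ ∞ (fun y => f ((extChartAt (𝓡 m) x₀).symm y)) (extChartAt (𝓡 m) x₀).target := by
  constructor
  · intro h
    rw [← contMDiffOn_iff_contDiffOn]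
    exact h.comp (contMDiffOn_extChartAt_symm x₀) fun y hy => symm_mem_chart_source hy
  · intro h
    rw [← contMDiffOn_iff_contDiffOn] at h
    refine (h.comp (contMDiffOn_extChartAt (I := 𝓡 m) (n := ∞) (x := x₀)) ?_).congr ?_
    · intro x hx
      rw [← extChartAt_source (𝓡 m)] at hx
      exact (extChartAt (𝓡 m) x₀).map_source hx
    · intro x hx
      rw [← extChartAt_source (𝓡 m)] at hx
      simp only [Function.comp_apply, (extChartAt (𝓡 m) x₀).left_inv hx]

theorem smoothFun_iff (f : M → ℝ) : SmoothFun m f ↔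
    ∀ x₀ : M, ContDiffOn ℝ ∞ (fun y => f ((extChartAt (𝓡 m) x₀).symm y))
      (extChartAt (𝓡 m) x₀).target := by
  simp only [← contMDiffOn_source_iff]
  refine ⟨fun h x₀ => h.contMDiffOn, fun h x => (h x).contMDiffAt ?_⟩
  exact (chartAt (EuclideanSpace ℝ (Fin m)) x).open_source.mem_nhds (mem_chart_source _ x)

/-- Over the domain of the chart at `x₀`, the trivialization of the tangent bundle is the derivative
of the chart, so the coordinates of the section are `vecInChart`. -/
theorem smoothVField_iff (u : VField m M) : SmoothVField u ↔
    ∀ x₀ : M, ContDiffOn ℝ ∞ (vecInChart u x₀) (extChartAt (𝓡 m) x₀).target := by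
  have key : ∀ x₀ : M, ContMDiffOn (𝓡 m) (𝓡 m).tangent ∞
        (fun x => (⟨x, u x⟩ : TangentBundle (𝓡 m) M))
        (chartAt (EuclideanSpace ℝ (Fin m)) x₀).source
      ↔ ContDiffOn ℝ ∞ (vecInChart u x₀) (extChartAt (𝓡 m) x₀).target := by
    intro x₀
    have h1 := contMDiffOn_source_iff (m := m) (fun x => push x₀ x (u x)) x₀
    have h2 := Trivialization.contMDiffOn_section_baseSet_iff (IB := 𝓡 m) (n := ∞) (s := u)
      (trivializationAt (EuclideanSpace ℝ (Fin m)) (TangentSpace (𝓡 m)) x₀)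
    rw [TangentBundle.trivializationAt_baseSet] at h2
    refine h2.trans (Iff.trans ?_ h1)
    refine contMDiffOn_congr fun x hx => ?_
    rw [push, ← TangentBundle.continuousLinearMapAt_trivializationAt hx,
      Trivialization.continuousLinearMapAt_apply, Trivialization.coe_linearMapAt_of_mem]
    rwa [TangentBundle.trivializationAt_baseSet]
  simp only [← key]
  refine ⟨fun h x₀ => h.contMDiffOn, fun h x => (h x).contMDiffAt ?_⟩
  exact (chartAt (EuclideanSpace ℝ (Fin m)) x).open_source.mem_nhds (mem_chart_source _ x)

/-- In the trivialization of the cotangent bundle, θ is composed with the inverse tangent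
trivialization, which is the derivative of the inverse chart. -/
theorem SmoothForm.contDiffOn {θ : OneForm m M} (h : SmoothForm θ) (x₀ : M) :
    ContDiffOn ℝ ∞ (formInChart θ x₀) (extChartAt (𝓡 m) x₀).target := by
  have h2 := Trivialization.contMDiffOn_section_baseSet_iff (IB := 𝓡 m) (n := ∞) (s := θ)
      (trivializationAt (EuclideanSpace ℝ (Fin m) →L[ℝ] ℝ)
        (fun x : M => TangentSpace (𝓡 m) x →L[ℝ] ℝ) x₀)
  rw [hom_trivializationAt_baseSet] at h2
  have h3 := h2.1 h.contMDiffOn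
  simp only [hom_trivializationAt_apply] at h3
  have hmaps : Set.MapsTo (extChartAt (𝓡 m) x₀).symm (extChartAt (𝓡 m) x₀).target
      ((trivializationAt (EuclideanSpace ℝ (Fin m)) (TangentSpace (𝓡 m)) x₀).baseSet ∩
        (trivializationAt ℝ (fun _ : M => ℝ) x₀).baseSet) := fun y hy => ⟨by
      rw [TangentBundle.trivializationAt_baseSet]
      exact symm_mem_chart_source hy, by simp⟩
  have h4 := h3.comp (contMDiffOn_extChartAt_symm (I := 𝓡 m) x₀) hmaps
  rw [contMDiffOn_iff_contDiffOn] at h4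
  refine h4.congr fun y hy => ?_
  have hy' := symm_mem_chart_source hy
  have hs := TangentBundle.symmL_trivializationAt (I := 𝓡 m) hy'
  rw [ModelWithCorners.range_eq_univ, mfderivWithin_univ, (extChartAt (𝓡 m) x₀).right_inv hy] at hs
  simp only [Function.comp_apply]
  rw [ContinuousLinearMap.inCoordinates, hs]
  ext a
  simp [formInChart]

theorem formInChart_push (θ : OneForm m M) {x₀ x : M}
    (hx : x ∈ (extChartAt (𝓡 m) x₀).source) (w : TangentSpace (𝓡 m) x) :
    formInChart θ x₀ (extChartAt (𝓡 m) x₀ x) (push x₀ x w) = θ x w := by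
  obtain ⟨y, hy, rfl⟩ : ∃ y ∈ (extChartAt (𝓡 m) x₀).target, (extChartAt (𝓡 m) x₀).symm y = x :=
    ⟨_, (extChartAt (𝓡 m) x₀).map_source hx, (extChartAt (𝓡 m) x₀).left_inv hx⟩
  rw [(extChartAt (𝓡 m) x₀).right_inv hy, formInChart_apply, pull_push hy]

theorem vecInChart_apply (u : VField m M) {x₀ x : M} (hx : x ∈ (extChartAt (𝓡 m) x₀).source) :
    vecInChart u x₀ (extChartAt (𝓡 m) x₀ x) = push x₀ x (u x) := by
  rw [vecInChart, (extChartAt (𝓡 m) x₀).left_inv hx]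

theorem SmoothFun.mdifferentiableAt {f : M → ℝ} (hf : SmoothFun m f) (x : M) :
    MDifferentiableAt (𝓡 m) 𝓘(ℝ, ℝ) f x := (hf x).mdifferentiableAt (by simp)

theorem mfderiv_pull {f : M → ℝ} (hf : SmoothFun m f) {x₀ : M} {y : EuclideanSpace ℝ (Fin m)}
    (hy : y ∈ (extChartAt (𝓡 m) x₀).target) (a : EuclideanSpace ℝ (Fin m)) :
    mfderiv (𝓡 m) 𝓘(ℝ, ℝ) f ((extChartAt (𝓡 m) x₀).symm y) (pull x₀ y a)
      = fderiv ℝ (fun z => f ((extChartAt (𝓡 m) x₀).symm z)) y a := by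
  have := mfderiv_comp (I := 𝓘(ℝ, EuclideanSpace ℝ (Fin m))) (I' := 𝓡 m) (I'' := 𝓘(ℝ, ℝ)) y
    (hf.mdifferentiableAt _) (mdifferentiableAt_symm hy)
  rw [mfderiv_eq_fderiv] at this
  exact (DFunLike.congr_fun this a).symm

theorem dirDeriv_symm (u : VField m M) {f : M → ℝ} (hf : SmoothFun m f) {x₀ : M}
    {y : EuclideanSpace ℝ (Fin m)} (hy : y ∈ (extChartAt (𝓡 m) x₀).target) :
    dirDeriv u f ((extChartAt (𝓡 m) x₀).symm y)
      = fderiv ℝ (fun z => f ((extChartAt (𝓡 m) x₀).symm z)) y (vecInChart u x₀ y) := by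
  rw [← mfderiv_pull hf hy, pull_vecInChart u hy, dirDeriv]

theorem SmoothFun.contDiffOn {f : M → ℝ} (hf : SmoothFun m f) (x₀ : M) :
    ContDiffOn ℝ ∞ (fun z => f ((extChartAt (𝓡 m) x₀).symm z)) (extChartAt (𝓡 m) x₀).target :=
  (smoothFun_iff f).1 hf x₀

theorem SmoothVField.contDiffOn {u : VField m M} (hu : SmoothVField u) (x₀ : M) :
    ContDiffOn ℝ ∞ (vecInChart u x₀) (extChartAt (𝓡 m) x₀).target :=
  (smoothVField_iff u).1 hu x₀

theorem SmoothFun.dirDeriv {u : VField m M} (hu : SmoothVField u) {f : M → ℝ}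
    (hf : SmoothFun m f) : SmoothFun m (dirDeriv u f) := by
  refine (smoothFun_iff _).2 fun x₀ => ?_
  refine ContDiffOn.congr ?_ fun y hy => dirDeriv_symm u hf hy
  exact ((hf.contDiffOn x₀).fderiv_of_isOpen (isOpen_target x₀) (by simp)).clm_apply
    (hu.contDiffOn x₀)

theorem SmoothForm.applyForm {θ : OneForm m M} (hθ : SmoothForm θ) {u : VField m M}
    (hu : SmoothVField u) : SmoothFun m (applyForm θ u) := by
  refine (smoothFun_iff _).2 fun x₀ => ?_
  refine ContDiffOn.congr ?_ fun y hy => applyForm_symm θ u hy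
  exact (hθ.contDiffOn x₀).clm_apply (hu.contDiffOn x₀)

/-- The exterior derivative is compatible with pullbacks. -/
theorem flatD_comp {W V : Type*} [NormedAddCommGroup W] [NormedSpace ℝ W] [NormedAddCommGroup V]
    [NormedSpace ℝ V] {t : V → V →L[ℝ] ℝ} {t₀ : W → W →L[ℝ] ℝ} {τ : W → V} {y : W}
    (ht : DifferentiableAt ℝ t (τ y)) (hτ : ContDiffAt ℝ 2 τ y)
    (h : ∀ᶠ z in 𝓝 y, ∀ a, t₀ z a = t (τ z) (fderiv ℝ τ z a)) (a b : W) :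
    flatD t₀ y a b = flatD t (τ y) (fderiv ℝ τ y a) (fderiv ℝ τ y b) := by
  have h1 : HasFDerivAt τ (fderiv ℝ τ y) y := (hτ.differentiableAt (by simp)).hasFDerivAt
  have h2 : HasFDerivAt (fderiv ℝ τ) (fderiv ℝ (fderiv ℝ τ) y) y :=
    ((hτ.fderiv_right (m := 1) (by norm_num)).differentiableAt (by simp)).hasFDerivAt
  have hs : IsSymmSndFDerivAt ℝ τ y := hτ.isSymmSndFDerivAt (by simp)
  have h3 : HasFDerivAt (fun z => t (τ z)) _ y := ht.hasFDerivAt.comp y h1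
  have h4 : HasFDerivAt (fun z => (t (τ z)).comp (fderiv ℝ τ z)) _ y := h3.clm_comp h2
  have h5 : t₀ =ᶠ[𝓝 y] fun z => (t (τ z)).comp (fderiv ℝ τ z) :=
    h.mono fun z hz => ContinuousLinearMap.ext hz
  -- The second derivative of τ is symmetric, so it drops out of the antisymmetrization.
  simp only [flatD]
  rw [h5.fderiv_eq, h4.fderiv]
  simp [hs.eq a b]

/-- `extD` is defined at each point through that point's own preferred chart. Naturality of d under
the transition map allows a single fixed chart to serve for all points of its domain. -/
theorem extD_pull {θ : OneForm m M} (hθ : SmoothForm θ) {x₀ : M} {y : EuclideanSpace ℝ (Fin m)}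
    (hy : y ∈ (extChartAt (𝓡 m) x₀).target) (a b : EuclideanSpace ℝ (Fin m)) :
    extD θ ((extChartAt (𝓡 m) x₀).symm y) (pull x₀ y a) (pull x₀ y b)
      = flatD (formInChart θ x₀) y a b := by
  set x := (extChartAt (𝓡 m) x₀).symm y with hx
  have hxs : x ∈ (chartAt (EuclideanSpace ℝ (Fin m)) x).source := mem_chart_source _ x
  set τ : EuclideanSpace ℝ (Fin m) → EuclideanSpace ℝ (Fin m) :=
    fun z => extChartAt (𝓡 m) x ((extChartAt (𝓡 m) x₀).symm z) with hτ
  have hnear : ∀ᶠ z in 𝓝 y, z ∈ (extChartAt (𝓡 m) x₀).target ∧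
      (extChartAt (𝓡 m) x₀).symm z ∈ (extChartAt (𝓡 m) x).source :=
    Filter.Eventually.and (target_mem_nhds hy)
      ((continuousAt_extChartAt_symm'' hy).eventually_mem
        ((isOpen_extChartAt_source x).mem_nhds (mem_extChartAt_source x)))
  have hfd : ∀ z, z ∈ (extChartAt (𝓡 m) x₀).target →
      (extChartAt (𝓡 m) x₀).symm z ∈ (extChartAt (𝓡 m) x).source → ∀ a,
      fderiv ℝ τ z a = push x ((extChartAt (𝓡 m) x₀).symm z) (pull x₀ z a) := by
    intro z hz hz' a
    rw [extChartAt_source] at hz'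
    have := mfderiv_comp (I := 𝓘(ℝ, EuclideanSpace ℝ (Fin m))) (I' := 𝓡 m)
      (I'' := 𝓘(ℝ, EuclideanSpace ℝ (Fin m))) z
      (mdifferentiableAt_extChartAt (I := 𝓡 m) hz') (mdifferentiableAt_symm hz)
    rw [mfderiv_eq_fderiv] at this
    exact DFunLike.congr_fun this a
  have hτ2 : ContDiffAt ℝ 2 τ y := by
    rw [← contMDiffAt_iff_contDiffAt]
    have h1 : ContMDiffAt (𝓡 m) 𝓘(ℝ, EuclideanSpace ℝ (Fin m)) 2 (extChartAt (𝓡 m) x) x :=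
      contMDiffAt_extChartAt
    have h2 : ContMDiffAt 𝓘(ℝ, EuclideanSpace ℝ (Fin m)) (𝓡 m) 2 (extChartAt (𝓡 m) x₀).symm y :=
      (contMDiffOn_extChartAt_symm x₀).contMDiffAt (target_mem_nhds hy)
    exact h1.comp y h2
  have hxt : τ y ∈ (extChartAt (𝓡 m) x).target := mem_extChartAt_target x
  have key := flatD_comp (t := formInChart θ x) (t₀ := formInChart θ x₀) (τ := τ) (y := y)
    (((hθ.contDiffOn x).contDiffAt (target_mem_nhds hxt)).differentiableAt (by simp)) hτ2
    (hnear.mono fun z hz a => by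
      rw [hfd z hz.1 hz.2, formInChart_push θ hz.2, formInChart_apply]) a b
  rw [key, hfd y hy (mem_extChartAt_source x), hfd y hy (mem_extChartAt_source x)]
  rfl

theorem extD_eq {θ : OneForm m M} (hθ : SmoothForm θ) {x₀ x : M}
    (hx : x ∈ (extChartAt (𝓡 m) x₀).source) (u v : TangentSpace (𝓡 m) x) :
    extD θ x u v = flatD (formInChart θ x₀) (extChartAt (𝓡 m) x₀ x) (push x₀ x u)
      (push x₀ x v) := by
  obtain ⟨y, hy, rfl⟩ : ∃ y ∈ (extChartAt (𝓡 m) x₀).target, (extChartAt (𝓡 m) x₀).symm y = x :=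
    ⟨_, (extChartAt (𝓡 m) x₀).map_source hx, (extChartAt (𝓡 m) x₀).left_inv hx⟩
  rw [(extChartAt (𝓡 m) x₀).right_inv hy, ← extD_pull hθ hy, pull_push hy, pull_push hy]

theorem dirDeriv_eq (u : VField m M) {f : M → ℝ} (hf : SmoothFun m f) {x₀ x : M}
    (hx : x ∈ (extChartAt (𝓡 m) x₀).source) :
    dirDeriv u f x = fderiv ℝ (fun z => f ((extChartAt (𝓡 m) x₀).symm z)) (extChartAt (𝓡 m) x₀ x)
      (push x₀ x (u x)) := by
  rw [← vecInChart_apply u hx, ← dirDeriv_symm u hf ((extChartAt (𝓡 m) x₀).map_source hx),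
    (extChartAt (𝓡 m) x₀).left_inv hx]

/-- The tangent space at `x` is identified with the model space by the preferred chart at `x`, so
the derivative of that chart is the identity there. -/
theorem push_self (x : M) (w : TangentSpace (𝓡 m) x) : push x x w = w := by
  have := mfderiv_extChartAt_self (I := 𝓡 m) (x := x)
  exact DFunLike.congr_fun this w

/-- The Lie bracket of vector fields, in the preferred chart. -/
theorem push_mlieBracket (u v : VField m M) (x : M) :
    push x x (VectorField.mlieBracket (𝓡 m) u v x)
      = VectorField.lieBracket ℝ (vecInChart u x) (vecInChart v x) (extChartAt (𝓡 m) x x) := by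
  have hmem : extChartAt (𝓡 m) x x ∈ (extChartAt (𝓡 m) x).target := mem_extChartAt_target x
  -- The manifold bracket is defined by pulling fields back along the inverse chart. Near the base
  -- point this gives `vecInChart`, because the derivatives of the chart and its inverse are
  -- mutually inverse.
  have hpb : ∀ w : VField m M, VectorField.mpullbackWithin 𝓘(ℝ, EuclideanSpace ℝ (Fin m)) (𝓡 m)
      (extChartAt (𝓡 m) x).symm w (Set.range (𝓡 m)) =ᶠ[𝓝 (extChartAt (𝓡 m) x x)]
      vecInChart w x := by
    intro w
    filter_upwards [target_mem_nhds hmem] with z hz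
    rw [VectorField.mpullbackWithin_apply, ModelWithCorners.range_eq_univ, mfderivWithin_univ,
      ← pull_vecInChart w hz]
    have hinv : (mfderiv 𝓘(ℝ, EuclideanSpace ℝ (Fin m)) (𝓡 m) (extChartAt (𝓡 m) x).symm z).inverse
        (pull x z (vecInChart w x z)) = vecInChart w x z := by
      have := isInvertible_mfderivWithin_extChartAt_symm (I := 𝓡 m) hz
      rw [ModelWithCorners.range_eq_univ, mfderivWithin_univ] at this
      exact this.inverse_apply_self _
    exact hinv
  rw [push_self, ← VectorField.mlieBracketWithin_univ, VectorField.mlieBracketWithin_apply,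
    mfderiv_extChartAt_self]
  refine (DFunLike.congr_fun (ContinuousLinearMap.inverse_id (R := ℝ)
    (M := EuclideanSpace ℝ (Fin m))) _).trans ?_
  have h2 := Filter.EventuallyEq.lieBracket_vectorField_eq (𝕜 := ℝ) (hpb u) (hpb v)
  rw [Set.preimage_univ, Set.univ_inter]
  rw [ModelWithCorners.range_eq_univ] at h2 ⊢
  exact (congrFun VectorField.lieBracketWithin_univ _).trans h2

theorem flatD_add_right {W : Type*} [NormedAddCommGroup W] [NormedSpace ℝ W] (t : W → W →L[ℝ] ℝ)
    (y a b c : W) : flatD t y a (b + c) = flatD t y a b + flatD t y a c := by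
  simp only [flatD, map_add, add_apply]; ring

theorem flatD_smul_right {W : Type*} [NormedAddCommGroup W] [NormedSpace ℝ W] (t : W → W →L[ℝ] ℝ)
    (y : W) (r : ℝ) (a b : W) : flatD t y a (r • b) = r * flatD t y a b := by
  simp only [flatD, map_smul, smul_apply, smul_eq_mul]; ring

theorem extD_self_chart (θ : OneForm m M) (x : M) (u v : TangentSpace (𝓡 m) x) :
    extD θ x u v = flatD (formInChart θ x) (extChartAt (𝓡 m) x x) (push x x u) (push x x v) := rfl

theorem extD_add_right (θ : OneForm m M) (x : M) (u v w : TangentSpace (𝓡 m) x) :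
    extD θ x u (v + w) = extD θ x u v + extD θ x u w := by
  simp only [extD_self_chart, map_add, flatD_add_right]

theorem extD_smul_right (θ : OneForm m M) (x : M) (r : ℝ) (u v : TangentSpace (𝓡 m) x) :
    extD θ x u (r • v) = r * extD θ x u v := by
  simp only [extD_self_chart, map_smul, flatD_smul_right]

theorem extD_skew (θ : OneForm m M) (x : M) (u v : TangentSpace (𝓡 m) x) :
    extD θ x u v = -extD θ x v u := by
  simp only [extD]; ring

theorem extD_add_left (θ : OneForm m M) (x : M) (u v w : TangentSpace (𝓡 m) x) :
    extD θ x (u + v) w = extD θ x u w + extD θ x v w := by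
  rw [extD_skew, extD_add_right, extD_skew θ x u, extD_skew θ x v]; ring

theorem extD_smul_left (θ : OneForm m M) (x : M) (r : ℝ) (u v : TangentSpace (𝓡 m) x) :
    extD θ x (r • u) v = r * extD θ x u v := by
  rw [extD_skew, extD_smul_right, extD_skew θ x u]; ring

/-- The bracket acts on functions as the commutator. -/
theorem dirDeriv_mlieBracket {u v : VField m M} (hu : SmoothVField u) (hv : SmoothVField v)
    {f : M → ℝ} (hf : SmoothFun m f) (x : M) :
    dirDeriv (VectorField.mlieBracket (𝓡 m) u v) f x
      = dirDeriv u (dirDeriv v f) x - dirDeriv v (dirDeriv u f) x := by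
  have hx := mem_extChartAt_source (I := 𝓡 m) x
  have hy : extChartAt (𝓡 m) x x ∈ (extChartAt (𝓡 m) x).target := mem_extChartAt_target x
  have hn := target_mem_nhds hy
  rw [dirDeriv_eq _ hf hx, push_mlieBracket, dirDeriv_eq _ (hf.dirDeriv hv) hx,
    dirDeriv_eq _ (hf.dirDeriv hu) hx, ← vecInChart_apply u hx, ← vecInChart_apply v hx,
    VectorField.lieBracket]
  set k := fun z => f ((extChartAt (𝓡 m) x).symm z) with hk
  set y := extChartAt (𝓡 m) x x
  have hkc : ContDiffAt ℝ ∞ k y := (hf.contDiffOn x).contDiffAt hn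
  have hk2 : HasFDerivAt (fderiv ℝ k) (fderiv ℝ (fderiv ℝ k) y) y :=
    ((hkc.fderiv_right (m := 1) (by norm_cast)).differentiableAt (by simp)).hasFDerivAt
  have hs : IsSymmSndFDerivAt ℝ k y := hkc.isSymmSndFDerivAt (by simp; norm_cast)
  have hd : ∀ w : VField m M, SmoothVField w →
      fderiv ℝ (fun z => dirDeriv w f ((extChartAt (𝓡 m) x).symm z)) y
        = (fderiv ℝ k y).comp (fderiv ℝ (vecInChart w x) y)
          + (fderiv ℝ (fderiv ℝ k) y).flip (vecInChart w x y) := by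
    intro w hw
    have h1 : HasFDerivAt (vecInChart w x) (fderiv ℝ (vecInChart w x) y) y :=
      (((hw.contDiffOn x).contDiffAt hn).differentiableAt (by simp)).hasFDerivAt
    have h2 : (fun z => dirDeriv w f ((extChartAt (𝓡 m) x).symm z))
        =ᶠ[𝓝 y] fun z => fderiv ℝ k z (vecInChart w x z) := by
      filter_upwards [hn] with z hz using dirDeriv_symm w hf hz
    rw [h2.fderiv_eq]
    exact (hk2.clm_apply h1).fderiv
  rw [hd u hu, hd v hv]
  simp only [add_apply, ContinuousLinearMap.comp_apply, ContinuousLinearMap.flip_apply, map_sub]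
  -- The Hessian terms of f agree by symmetry and cancel, leaving only first derivatives of the
  -- fields.
  rw [hs.eq (vecInChart u x y) (vecInChart v x y)]
  ring

/-- Cartan's formula for the Lie derivative of a 1-form. -/
theorem lieDerivForm_eq {θ : OneForm m M} (hθ : SmoothForm θ) {u v : VField m M}
    (hu : SmoothVField u) (hv : SmoothVField v) (x : M) :
    lieDerivForm θ u v x = dirDeriv v (applyForm θ u) x + extD θ x (u x) (v x) := by
  have hx := mem_extChartAt_source (I := 𝓡 m) x
  have hy : extChartAt (𝓡 m) x x ∈ (extChartAt (𝓡 m) x).target := mem_extChartAt_target x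
  have hn := target_mem_nhds hy
  rw [lieDerivForm, dirDeriv_eq _ (hθ.applyForm hv) hx, dirDeriv_eq _ (hθ.applyForm hu) hx,
    extD_eq hθ hx, ← formInChart_push θ hx, push_mlieBracket, ← vecInChart_apply u hx,
    ← vecInChart_apply v hx, VectorField.lieBracket]
  set y := extChartAt (𝓡 m) x x
  have ht : HasFDerivAt (formInChart θ x) (fderiv ℝ (formInChart θ x) y) y :=
      (((hθ.contDiffOn x).contDiffAt hn).differentiableAt (by simp)).hasFDerivAt
  have hd : ∀ w : VField m M, SmoothVField w →
      fderiv ℝ (fun z => applyForm θ w ((extChartAt (𝓡 m) x).symm z)) y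
        = (formInChart θ x y).comp (fderiv ℝ (vecInChart w x) y)
          + (fderiv ℝ (formInChart θ x) y).flip (vecInChart w x y) := by
    intro w hw
    have h1 : HasFDerivAt (vecInChart w x) (fderiv ℝ (vecInChart w x) y) y :=
      (((hw.contDiffOn x).contDiffAt hn).differentiableAt (by simp)).hasFDerivAt
    have h2 : (fun z => applyForm θ w ((extChartAt (𝓡 m) x).symm z))
        =ᶠ[𝓝 y] fun z => formInChart θ x z (vecInChart w x z) := by
      filter_upwards [hn] with z hz using applyForm_symm θ w hz
    rw [h2.fderiv_eq]
    exact (ht.clm_apply h1).fderiv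
  rw [hd u hu, hd v hv, flatD]
  simp only [add_apply, ContinuousLinearMap.comp_apply, ContinuousLinearMap.flip_apply, map_sub]
  ring

theorem isManifold_minSmoothness (k : ℕ) : IsManifold (𝓡 m) (minSmoothness ℝ k) M := by
  rw [minSmoothness_of_isRCLikeNormedField]
  exact IsManifold.of_le (n := ∞) (by norm_cast; exact le_top)

theorem SmoothVField.mlieBracket {u v : VField m M} (hu : SmoothVField u) (hv : SmoothVField v) :
    SmoothVField (VectorField.mlieBracket (𝓡 m) u v) := by
  have : IsManifold (𝓡 m) (((⊤ : ℕ∞) : WithTop ℕ∞) + 1) M := by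
    simpa using (inferInstance : IsManifold (𝓡 m) ∞ M)
  have : IsManifold (𝓡 m) (minSmoothness ℝ 2) M := isManifold_minSmoothness 2
  exact ContDiff.mlieBracket_vectorField (n := ⊤) (m := ⊤) hu hv (by simp)

/-- The Jacobi identity in commutator form, needed to show that contact fields are closed under the
bracket. -/
theorem mlieBracket_jacobi {u v w : VField m M} (hu : SmoothVField u) (hv : SmoothVField v)
    (hw : SmoothVField w) (x : M) :
    VectorField.mlieBracket (𝓡 m) (VectorField.mlieBracket (𝓡 m) u v) w x
      = VectorField.mlieBracket (𝓡 m) u (VectorField.mlieBracket (𝓡 m) v w) x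
        - VectorField.mlieBracket (𝓡 m) v (VectorField.mlieBracket (𝓡 m) u w) x := by
  have : IsManifold (𝓡 m) (minSmoothness ℝ 2) M := isManifold_minSmoothness 2
  have : IsManifold (𝓡 m) (minSmoothness ℝ 3) M := isManifold_minSmoothness 3
  have h2 : minSmoothness ℝ 2 ≤ ∞ := by simp; norm_cast
  rw [VectorField.leibniz_identity_mlieBracket_apply ((hu x).of_le h2) ((hv x).of_le h2)
    ((hw x).of_le h2), add_sub_cancel_right]

theorem SmoothVField.add {u v : VField m M} (hu : SmoothVField u) (hv : SmoothVField v) :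
    SmoothVField (u + v) := ContMDiff.add_section hu hv

theorem SmoothVField.const_smul {u : VField m M} (hu : SmoothVField u) (r : ℝ) :
    SmoothVField (r • u) := ContMDiff.const_smul_section hu

/-- Every tangent vector extends to a smooth vector field. -/
theorem exists_smoothVField [T2Space M] (x : M) (w : TangentSpace (𝓡 m) x) :
    ∃ v : VField m M, SmoothVField v ∧ v x = w := by
  obtain ⟨s, hs, hsm⟩ := FiberBundle.exists_contMDiffOn_extend (𝓡 m) (k := ∞)
    (EuclideanSpace ℝ (Fin m)) w
  -- The bump function cuts the local extension off inside the set where it is smooth and equals 1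
  -- at x.
  obtain ⟨f, -, hf⟩ := (SmoothBumpFunction.nhds_basis_tsupport (I := 𝓡 m) x).mem_iff.1
    (interior_mem_nhds.2 hs)
  refine ⟨fun z => f z • FiberBundle.extend (EuclideanSpace ℝ (Fin m)) w z, ?_, ?_⟩
  · exact ContMDiffOn.smul_section_of_tsupport f.contMDiff.contMDiffOn isOpen_interior hf
      (hsm.mono interior_subset)
  · simp

end Charts

set_option synthInstance.maxHeartbeats 400000 in
theorem contDiff_flip {W : Type*} [NormedAddCommGroup W] [NormedSpace ℝ W] {n : WithTop ℕ∞} :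
    ContDiff ℝ n (fun L : W →L[ℝ] W →L[ℝ] ℝ => L.flip) :=
  IsBoundedLinearMap.contDiff
    (ContinuousLinearMap.isBoundedLinearMap (𝕜 := ℝ) (E := W →L[ℝ] W →L[ℝ] ℝ)
      (F := W →L[ℝ] W →L[ℝ] ℝ)
      (ContinuousLinearMap.flipₗᵢ ℝ W W ℝ).toContinuousLinearEquiv.toContinuousLinearMap)

/-! ### The Reeb field and nondegeneracy of dθ + θ ⊗ θ -/

section Contact

variable {m : ℕ} {M : Type*} [TopologicalSpace M] [ChartedSpace (EuclideanSpace ℝ (Fin m)) M]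
  [IsManifold (𝓡 m) ∞ M]

theorem SmoothFun.add {f h : M → ℝ} (hf : SmoothFun m f) (hh : SmoothFun m h) :
    SmoothFun m (fun x => f x + h x) := ContMDiff.add hf hh

theorem SmoothFun.sub {f h : M → ℝ} (hf : SmoothFun m f) (hh : SmoothFun m h) :
    SmoothFun m (fun x => f x - h x) := ContMDiff.sub hf hh

theorem SmoothFun.mul {f h : M → ℝ} (hf : SmoothFun m f) (hh : SmoothFun m h) :
    SmoothFun m (fun x => f x * h x) := ContMDiff.mul hf hh

theorem smoothFun_const (c : ℝ) : SmoothFun m (fun _ : M => c) := contMDiff_const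

theorem SmoothFun.differentiableAt_chart {f : M → ℝ} (hf : SmoothFun m f) (x : M) :
    DifferentiableAt ℝ (fun z => f ((extChartAt (𝓡 m) x).symm z)) (extChartAt (𝓡 m) x x) :=
  ((hf.contDiffOn x).contDiffAt (target_mem_nhds (mem_extChartAt_target x))).differentiableAt
    (by simp)

/-- The differential of a function, as a 1-form. -/
def differential (f : M → ℝ) : OneForm m M := fun x => mfderiv (𝓡 m) 𝓘(ℝ, ℝ) f x

theorem dirDeriv_def (u : VField m M) (f : M → ℝ) (x : M) :
    dirDeriv u f x = differential f x (u x) := rfl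

theorem differential_eq {f : M → ℝ} (hf : SmoothFun m f) (x : M) (w : TangentSpace (𝓡 m) x) :
    differential f x w = fderiv ℝ (fun z => f ((extChartAt (𝓡 m) x).symm z))
      (extChartAt (𝓡 m) x x) (push x x w) := by
  classical
  have := dirDeriv_eq (Function.update (0 : VField m M) x w) hf (mem_extChartAt_source (I := 𝓡 m) x)
  rwa [dirDeriv_def, Function.update_self] at this

theorem formInChart_differential {f : M → ℝ} (hf : SmoothFun m f) {x₀ : M}
    {y : EuclideanSpace ℝ (Fin m)} (hy : y ∈ (extChartAt (𝓡 m) x₀).target) :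
    formInChart (differential f) x₀ y
      = fderiv ℝ (fun z => f ((extChartAt (𝓡 m) x₀).symm z)) y :=
  ContinuousLinearMap.ext fun a => mfderiv_pull hf hy a

theorem differential_add {f h : M → ℝ} (hf : SmoothFun m f) (hh : SmoothFun m h)
    (x : M) (w : TangentSpace (𝓡 m) x) :
    differential (fun x => f x + h x) x w = differential f x w + differential h x w := by
  rw [differential_eq (hf.add hh), differential_eq hf, differential_eq hh]
  rw [fderiv_fun_add (hf.differentiableAt_chart x) (hh.differentiableAt_chart x)]
  rfl

theorem differential_sub {f h : M → ℝ} (hf : SmoothFun m f) (hh : SmoothFun m h)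
    (x : M) (w : TangentSpace (𝓡 m) x) :
    differential (fun x => f x - h x) x w = differential f x w - differential h x w := by
  rw [differential_eq (hf.sub hh), differential_eq hf, differential_eq hh]
  rw [fderiv_fun_sub (hf.differentiableAt_chart x) (hh.differentiableAt_chart x)]
  rfl

theorem differential_mul {f h : M → ℝ} (hf : SmoothFun m f) (hh : SmoothFun m h)
    (x : M) (w : TangentSpace (𝓡 m) x) :
    differential (fun x => f x * h x) x w
      = f x * differential h x w + h x * differential f x w := by
  rw [differential_eq (hf.mul hh), differential_eq hf, differential_eq hh]
  rw [fderiv_fun_mul (hf.differentiableAt_chart x) (hh.differentiableAt_chart x)]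
  simp only [add_apply, smul_apply, smul_eq_mul, extChartAt_to_inv]

theorem differential_const (c : ℝ) (x : M) (w : TangentSpace (𝓡 m) x) :
    differential (fun _ => c) x w = 0 := by
  rw [differential_eq (smoothFun_const c)]
  simp

theorem differential_const_mul {f : M → ℝ} (hf : SmoothFun m f) (c : ℝ)
    (x : M) (w : TangentSpace (𝓡 m) x) :
    differential (fun x => c * f x) x w = c * differential f x w := by
  rw [differential_mul (smoothFun_const c) hf, differential_const]; ring

theorem dirDeriv_add (u v : VField m M) (f : M → ℝ) (x : M) :
    dirDeriv (u + v) f x = dirDeriv u f x + dirDeriv v f x :=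
  map_add (mfderiv (𝓡 m) 𝓘(ℝ, ℝ) f x) (u x) (v x)

theorem dirDeriv_smul (r : ℝ) (u : VField m M) (f : M → ℝ) (x : M) :
    dirDeriv (r • u) f x = r * dirDeriv u f x :=
  map_smul (mfderiv (𝓡 m) 𝓘(ℝ, ℝ) f x) r (u x)

/-- A smooth 1-form on an odd-dimensional manifold with an associated metric. -/
structure ContactMetric (θ : OneForm m M) (g : SmoothMetric m M) : Prop where
  odd : Odd m
  smooth : SmoothForm θ
  assoc : IsAssociated θ g

/-- The bilinear form `dθ + θ ⊗ θ`. -/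
def contactBilin (θ : OneForm m M) (x : M) (u v : TangentSpace (𝓡 m) x) : ℝ :=
  extD θ x u v + θ x u * θ x v

variable {θ : OneForm m M} {g : SmoothMetric m M}

/-- `reeb` is a choice, so existence must be proved. Odd dimension gives e ≠ 0 in the kernel of dθ.
Then |φe|² = dθ(φe, e) = 0, and φ²e = 0 makes e equal to θ(e) times the chosen vector, about which
nothing else is needed. Hence θ(e) ≠ 0, and e can be rescaled. -/
theorem ContactMetric.reeb_spec (h : ContactMetric θ g) (x : M) :
    θ x (reeb θ x) = 1 ∧ ∀ v, extD θ x (reeb θ x) v = 0 := by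
  refine Classical.epsilon_spec (p := fun e : TangentSpace (𝓡 m) x =>
    θ x e = 1 ∧ ∀ v : TangentSpace (𝓡 m) x, extD θ x e v = 0) ?_
  obtain ⟨e, he0, he⟩ : ∃ e : TangentSpace (𝓡 m) x, e ≠ 0 ∧ ∀ v, extD θ x v e = 0 :=
    exists_ne_zero_of_skew h.odd (fun a b => extD θ x a b)
    (fun a b c => extD_add_right θ x a b c) (fun r a b => extD_smul_right θ x r a b)
    (fun a b => extD_skew θ x a b)
  obtain ⟨-, φ, -, hφ2, hφ⟩ := h.assoc
  have hφe : φ x e = 0 := by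
    have h1 := hφ x (φ x e) e
    rw [he] at h1
    by_contra hne
    exact absurd h1 (g.pos x _ hne).ne
  have h2 := hφ2 x e
  rw [hφe, map_zero] at h2
  have hθe : θ x e ≠ 0 := by
    intro h3
    rw [h3, zero_smul, add_zero] at h2
    exact he0 (neg_eq_zero.1 h2.symm)
  refine ⟨(θ x e)⁻¹ • e, ?_, fun v => ?_⟩
  · rw [map_smul, smul_eq_mul, inv_mul_cancel₀ hθe]
  · rw [extD_smul_left, extD_skew, he]; simp

theorem ContactMetric.reeb_apply (h : ContactMetric θ g) (x : M) : θ x (reeb θ x) = 1 :=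
  (h.reeb_spec x).1

theorem ContactMetric.extD_reeb (h : ContactMetric θ g) (x : M) (v : TangentSpace (𝓡 m) x) :
    extD θ x (reeb θ x) v = 0 := (h.reeb_spec x).2 v

theorem ContactMetric.extD_reeb_right (h : ContactMetric θ g) (x : M) (v : TangentSpace (𝓡 m) x) :
    extD θ x v (reeb θ x) = 0 := by rw [extD_skew, h.extD_reeb, neg_zero]

theorem contactBilin_add_left (x : M) (u v w : TangentSpace (𝓡 m) x) :
    contactBilin θ x (u + v) w = contactBilin θ x u w + contactBilin θ x v w := by
  simp only [contactBilin, extD_add_left, map_add]; ring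

theorem contactBilin_smul_left (x : M) (r : ℝ) (u v : TangentSpace (𝓡 m) x) :
    contactBilin θ x (r • u) v = r * contactBilin θ x u v := by
  simp only [contactBilin, extD_smul_left, map_smul, smul_eq_mul]; ring

/-- Testing against E gives θ(u) = 0; testing against φu then gives (u, φ²u) = -|u|² = 0. -/
theorem ContactMetric.contactBilin_nondegenerate (h : ContactMetric θ g) {x : M}
    {u : TangentSpace (𝓡 m) x} (hu : ∀ v, contactBilin θ x u v = 0) : u = 0 := by
  have h1 := hu (reeb θ x)
  rw [contactBilin, h.extD_reeb_right, h.reeb_apply, zero_add, mul_one] at h1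
  obtain ⟨-, φ, -, hφ2, hφ⟩ := h.assoc
  have h2 := hu (φ x u)
  rw [contactBilin, h1, zero_mul, add_zero, hφ, hφ2, h1, zero_smul, add_zero, map_neg,
    neg_eq_zero] at h2
  by_contra hne
  exact absurd h2 (g.pos x u hne).ne'

theorem ContactMetric.eq_of_contactBilin (h : ContactMetric θ g) {x : M}
    {u w : TangentSpace (𝓡 m) x} (hu : ∀ v, contactBilin θ x u v = contactBilin θ x w v) :
    u = w := by
  rw [← sub_eq_zero]
  refine h.contactBilin_nondegenerate fun v => ?_
  rw [sub_eq_add_neg, ← neg_one_smul ℝ w, contactBilin_add_left, contactBilin_smul_left, hu]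
  ring

/-- The form `dθ + θ ⊗ θ` in a chart. -/
def bilinInChart (θ : OneForm m M) (x₀ : M) (y : EuclideanSpace ℝ (Fin m)) :
    EuclideanSpace ℝ (Fin m) →L[ℝ] EuclideanSpace ℝ (Fin m) →L[ℝ] ℝ :=
  fderiv ℝ (formInChart θ x₀) y - (fderiv ℝ (formInChart θ x₀) y).flip
    + (formInChart θ x₀ y).smulRight (formInChart θ x₀ y)

theorem bilinInChart_apply (hθ : SmoothForm θ) {x₀ : M} {y : EuclideanSpace ℝ (Fin m)}
    (hy : y ∈ (extChartAt (𝓡 m) x₀).target) (a b : EuclideanSpace ℝ (Fin m)) :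
    bilinInChart θ x₀ y a b
      = contactBilin θ ((extChartAt (𝓡 m) x₀).symm y) (pull x₀ y a) (pull x₀ y b) := by
  rw [contactBilin, extD_pull hθ hy, ← formInChart_apply, ← formInChart_apply]
  rfl

theorem ContactMetric.isInvertible_bilinInChart (h : ContactMetric θ g) {x₀ : M}
    {y : EuclideanSpace ℝ (Fin m)} (hy : y ∈ (extChartAt (𝓡 m) x₀).target) :
    (bilinInChart θ x₀ y).IsInvertible := by
  have hinj : Function.Injective (bilinInChart θ x₀ y) := by
    rw [injective_iff_map_eq_zero]
    intro a ha
    have h0 : pull x₀ y a = 0 := by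
      refine h.contactBilin_nondegenerate fun v => ?_
      rw [← pull_push hy v, ← bilinInChart_apply h.smooth hy, ha]; rfl
    rw [← push_pull hy a, h0, map_zero]
  have hfin : Module.finrank ℝ (EuclideanSpace ℝ (Fin m))
      = Module.finrank ℝ (EuclideanSpace ℝ (Fin m) →L[ℝ] ℝ) := by
    rw [LinearMap.toContinuousLinearMap.finrank_eq.symm]
    exact (Subspace.dual_finrank_eq).symm
  let e := LinearMap.linearEquivOfInjective
    (bilinInChart θ x₀ y : EuclideanSpace ℝ (Fin m) →ₗ[ℝ] EuclideanSpace ℝ (Fin m) →L[ℝ] ℝ)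
    hinj hfin
  exact ⟨e.toContinuousLinearEquiv, by ext; rfl⟩

theorem contDiffOn_bilinInChart (hθ : SmoothForm θ) (x₀ : M) :
    ContDiffOn ℝ ∞ (bilinInChart θ x₀) (extChartAt (𝓡 m) x₀).target := by
  have h1 := hθ.contDiffOn x₀
  have h2 := h1.fderiv_of_isOpen (isOpen_target x₀) (m := ∞) (by simp)
  refine (h2.sub ?_).add (h1.smulRight h1)
  exact contDiff_flip.comp_contDiffOn h2

/-- A smooth 1-form is represented by a smooth vector field via `dθ + θ ⊗ θ`. -/
theorem ContactMetric.exists_vField (h : ContactMetric θ g) (α : OneForm m M)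
    (hα : ∀ x₀ : M, ContDiffOn ℝ ∞ (formInChart α x₀) (extChartAt (𝓡 m) x₀).target) :
    ∃ u : VField m M, SmoothVField u ∧ ∀ x v, contactBilin θ x (u x) v = α x v := by
  have hex : ∀ x, ∃ u : TangentSpace (𝓡 m) x, ∀ v, contactBilin θ x u v = α x v := by
    intro x
    have hy : extChartAt (𝓡 m) x x ∈ (extChartAt (𝓡 m) x).target := mem_extChartAt_target x
    obtain ⟨e, he⟩ := h.isInvertible_bilinInChart hy
    -- The base point is rewritten as the inverse chart applied to its coordinates, so that `pull`
    -- lands in the right tangent space.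
    suffices H : ∃ u : TangentSpace (𝓡 m) ((extChartAt (𝓡 m) x).symm (extChartAt (𝓡 m) x x)),
        ∀ v, contactBilin θ _ u v = α _ v by rwa [extChartAt_to_inv] at H
    refine ⟨pull x _ (e.symm (formInChart α x (extChartAt (𝓡 m) x x))), fun v => ?_⟩
    rw [← pull_push hy v, ← bilinInChart_apply h.smooth hy, ← he, ← formInChart_apply]
    simp
  choose u hu using hex
  refine ⟨u, (smoothVField_iff u).2 fun x₀ => ?_, hu⟩
  -- In a chart the solution is the inverse of the form applied to α; it is smooth because inversion
  -- of linear maps is.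
  have heq : ∀ y ∈ (extChartAt (𝓡 m) x₀).target,
      vecInChart u x₀ y = (bilinInChart θ x₀ y).inverse (formInChart α x₀ y) := by
    intro y hy
    have h1 : bilinInChart θ x₀ y (vecInChart u x₀ y) = formInChart α x₀ y := by
      ext b
      rw [bilinInChart_apply h.smooth hy, pull_vecInChart u hy, hu, formInChart_apply]
    rw [← h1, (h.isInvertible_bilinInChart hy).inverse_apply_self]
  refine ContDiffOn.congr ?_ heq
  intro y hy
  have hn := target_mem_nhds hy
  obtain ⟨e, he⟩ := h.isInvertible_bilinInChart hy
  have h2 : ContDiffAt ℝ ∞ (fun z => (bilinInChart θ x₀ z).inverse) y := by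
    refine ContDiffAt.comp y (?_ : ContDiffAt ℝ ∞ ContinuousLinearMap.inverse _)
      ((contDiffOn_bilinInChart h.smooth x₀).contDiffAt hn)
    rw [← he]
    exact contDiffAt_map_inverse e
  exact (h2.clm_apply ((hα x₀).contDiffAt hn)).contDiffWithinAt

end Contact

/-! ### Contact fields and their stream functions -/

section ContactFields

variable {m : ℕ} {M : Type*} [TopologicalSpace M] [ChartedSpace (EuclideanSpace ℝ (Fin m)) M]
  [IsManifold (𝓡 m) ∞ M] {θ : OneForm m M} {g : SmoothMetric m M}

/-- E is the field that represents θ itself under dθ + θ ⊗ θ. -/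
theorem ContactMetric.smoothVField_reeb (h : ContactMetric θ g) : SmoothVField (reeb θ) := by
  obtain ⟨u, hu, hu'⟩ := h.exists_vField θ h.smooth.contDiffOn
  convert hu using 1
  funext x
  refine (h.eq_of_contactBilin fun v => ?_).symm
  rw [hu', contactBilin, h.extD_reeb, h.reeb_apply, zero_add, one_mul]

theorem ContactMetric.smooth_reebDeriv (h : ContactMetric θ g) {f : M → ℝ} (hf : SmoothFun m f) :
    SmoothFun m (dirDeriv (reeb θ) f) := hf.dirDeriv h.smoothVField_reeb

/-- Contact fields, described pointwise. -/
theorem ContactMetric.isContactField_iff [T2Space M] (h : ContactMetric θ g) {u : VField m M} :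
    IsContactField θ u ↔ SmoothVField u ∧ ∀ x (w : TangentSpace (𝓡 m) x),
      differential (applyForm θ u) x w + extD θ x (u x) w
        = dirDeriv (reeb θ) (applyForm θ u) x * θ x w := by
  constructor
  · rintro ⟨hu, l, hl⟩
    have key : ∀ x (w : TangentSpace (𝓡 m) x),
        differential (applyForm θ u) x w + extD θ x (u x) w = l x * θ x w := by
      intro x w
      obtain ⟨v, hv, rfl⟩ := exists_smoothVField x w
      rw [← hl v hv x, lieDerivForm_eq h.smooth hu hv]
      rfl
    refine ⟨hu, fun x w => ?_⟩
    -- Evaluation on E identifies the multiplier l as E(θ(u)).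
    have h1 := key x (reeb θ x)
    rw [h.extD_reeb_right, h.reeb_apply, add_zero, mul_one] at h1
    rw [key, ← h1]
    rfl
  · rintro ⟨hu, hl⟩
    refine ⟨hu, dirDeriv (reeb θ) (applyForm θ u), fun v hv x => ?_⟩
    rw [lieDerivForm_eq h.smooth hu hv, ← hl]
    rfl

variable [T2Space M]

theorem ContactMetric.smooth_stream (h : ContactMetric θ g) {u : VField m M}
    (hu : IsContactField θ u) : SmoothFun m (applyForm θ u) := h.smooth.applyForm hu.1

/-- The pointwise contact equation expresses ι_u dθ through θ(u), and the pair (ι_u dθ, θ(u))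
determines u by nondegeneracy. -/
theorem ContactMetric.contact_ext (h : ContactMetric θ g) {u v : VField m M}
    (hu : IsContactField θ u) (hv : IsContactField θ v) (huv : applyForm θ u = applyForm θ v) :
    u = v := by
  funext x
  refine h.eq_of_contactBilin fun w => ?_
  have h1 := (h.isContactField_iff.1 hu).2 x w
  have h2 := (h.isContactField_iff.1 hv).2 x w
  have h3 : θ x (u x) = θ x (v x) := congrFun huv x
  rw [huv] at h1
  rw [contactBilin, contactBilin, h3]
  linarith

/-- The field u is obtained by solving β(u, ·) = (E(f) + f) θ - df for β = dθ + θ ⊗ θ. Evaluation on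
E yields θ(u) = f, after which the equation becomes the contact equation with multiplier E(f). -/
theorem ContactMetric.exists_contactField (h : ContactMetric θ g) {f : M → ℝ}
    (hf : SmoothFun m f) : ∃ u, IsContactField θ u ∧ ∀ x, θ x (u x) = f x := by
  set α : OneForm m M := fun x => (dirDeriv (reeb θ) f x + f x) • θ x -
    differential f x with hα
  obtain ⟨u, hu, hu'⟩ := h.exists_vField α fun x₀ => by
    have h1 : ContDiffOn ℝ ∞ (fun y =>
        (dirDeriv (reeb θ) f ((extChartAt (𝓡 m) x₀).symm y) + f ((extChartAt (𝓡 m) x₀).symm y))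
          • formInChart θ x₀ y - fderiv ℝ (fun z => f ((extChartAt (𝓡 m) x₀).symm z)) y)
        (extChartAt (𝓡 m) x₀).target :=
      ((((h.smooth_reebDeriv hf).contDiffOn x₀).add (hf.contDiffOn x₀)).smul
        (h.smooth.contDiffOn x₀)).sub
        ((hf.contDiffOn x₀).fderiv_of_isOpen (isOpen_target x₀) (by simp))
    refine h1.congr fun y hy => ?_
    ext a
    rw [formInChart_apply, sub_apply, ← formInChart_differential hf hy]
    rfl
  have hα' : ∀ x w, α x w = (dirDeriv (reeb θ) f x + f x) * θ x w
      - differential f x w := fun x w => rfl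
  have hθu : ∀ x, θ x (u x) = f x := by
    intro x
    have h1 := hu' x (reeb θ x)
    rw [hα', contactBilin, h.extD_reeb_right, h.reeb_apply] at h1
    have h2 : differential f x (reeb θ x) = dirDeriv (reeb θ) f x := rfl
    rw [h2] at h1
    linarith
  have hs : applyForm θ u = f := funext hθu
  refine ⟨u, h.isContactField_iff.2 ⟨hu, fun x w => ?_⟩, hθu⟩
  have h1 := hu' x w
  rw [hα', contactBilin, hθu] at h1
  rw [hs]
  linarith

theorem ContactMetric.contactOp_spec (h : ContactMetric θ g) {f : M → ℝ} (hf : SmoothFun m f) :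
    IsContactField θ (contactOp θ f) ∧ ∀ x, θ x (contactOp θ f x) = f x :=
  Classical.epsilon_spec (p := fun u : VField m M => IsContactField θ u ∧ ∀ x, θ x (u x) = f x)
    (h.exists_contactField hf)

theorem ContactMetric.isContactField_contactOp (h : ContactMetric θ g) {f : M → ℝ}
    (hf : SmoothFun m f) : IsContactField θ (contactOp θ f) := (h.contactOp_spec hf).1

theorem ContactMetric.applyForm_contactOp (h : ContactMetric θ g) {f : M → ℝ}
    (hf : SmoothFun m f) : applyForm θ (contactOp θ f) = f := funext (h.contactOp_spec hf).2

theorem ContactMetric.contactOp_applyForm (h : ContactMetric θ g) {u : VField m M}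
    (hu : IsContactField θ u) : contactOp θ (applyForm θ u) = u :=
  h.contact_ext (h.isContactField_contactOp (h.smooth_stream hu)) hu
    (h.applyForm_contactOp (h.smooth_stream hu))

theorem ContactMetric.isContactField_add (h : ContactMetric θ g) {u v : VField m M}
    (hu : IsContactField θ u) (hv : IsContactField θ v) : IsContactField θ (u + v) := by
  have hs : applyForm θ (u + v) = fun x => applyForm θ u x + applyForm θ v x :=
    funext fun x => map_add (θ x) (u x) (v x)
  obtain ⟨hu1, hu2⟩ := h.isContactField_iff.1 hu
  obtain ⟨hv1, hv2⟩ := h.isContactField_iff.1 hv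
  refine h.isContactField_iff.2 ⟨hu1.add hv1, fun x w => ?_⟩
  rw [hs, dirDeriv_def, differential_add (h.smooth_stream hu) (h.smooth_stream hv),
    differential_add (h.smooth_stream hu) (h.smooth_stream hv), Pi.add_apply, extD_add_left,
    ← dirDeriv_def, ← dirDeriv_def]
  linear_combination hu2 x w + hv2 x w

theorem ContactMetric.isContactField_smul (h : ContactMetric θ g) (r : ℝ) {u : VField m M}
    (hu : IsContactField θ u) : IsContactField θ (r • u) := by
  have hs : applyForm θ (r • u) = fun x => r * applyForm θ u x :=
    funext fun x => map_smul (θ x) r (u x)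
  obtain ⟨hu1, hu2⟩ := h.isContactField_iff.1 hu
  refine h.isContactField_iff.2 ⟨hu1.const_smul r, fun x w => ?_⟩
  rw [hs, dirDeriv_def, differential_const_mul (h.smooth_stream hu),
    differential_const_mul (h.smooth_stream hu), Pi.smul_apply, extD_smul_left, ← dirDeriv_def]
  linear_combination r * hu2 x w

theorem ContactMetric.isContactField_neg (h : ContactMetric θ g) {u : VField m M}
    (hu : IsContactField θ u) : IsContactField θ (-u) := by
  rw [← neg_one_smul ℝ u]
  exact h.isContactField_smul _ hu

theorem ContactMetric.isContactField_sub (h : ContactMetric θ g) {u v : VField m M}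
    (hu : IsContactField θ u) (hv : IsContactField θ v) : IsContactField θ (u - v) := by
  rw [sub_eq_add_neg]
  exact h.isContactField_add hu (h.isContactField_neg hv)

/-- `θ([u,w]) = u(θ(w)) - E(θ(u)) θ(w)` for a contact field `u`. -/
theorem ContactMetric.applyForm_mlieBracket (h : ContactMetric θ g) {u w : VField m M}
    (hu : IsContactField θ u) (hw : SmoothVField w) :
    applyForm θ (VectorField.mlieBracket (𝓡 m) u w) = fun x =>
      dirDeriv u (applyForm θ w) x - dirDeriv (reeb θ) (applyForm θ u) x * applyForm θ w x := by
  funext x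
  have h1 := (h.isContactField_iff.1 hu).2 x (w x)
  rw [← dirDeriv_def, ← lieDerivForm_eq h.smooth hu.1 hw, lieDerivForm] at h1
  simp only [applyForm] at h1 ⊢
  linarith

theorem ContactMetric.isContactField_mlieBracket (h : ContactMetric θ g) {u v : VField m M}
    (hu : IsContactField θ u) (hv : IsContactField θ v) :
    IsContactField θ (VectorField.mlieBracket (𝓡 m) u v) := by
  have hl := h.smooth_reebDeriv (h.smooth_stream hu)
  have hk := h.smooth_reebDeriv (h.smooth_stream hv)
  -- The multiplier comes from L_[u,v] = [L_u, L_v]: it is u(l_v) - v(l_u), since the products l_u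
  -- l_v cancel.
  refine ⟨hu.1.mlieBracket hv.1, fun x => dirDeriv u (dirDeriv (reeb θ) (applyForm θ v)) x
    - dirDeriv v (dirDeriv (reeb θ) (applyForm θ u)) x, fun w hw x => ?_⟩
  have hf := h.smooth.applyForm hw
  have huw : SmoothVField (VectorField.mlieBracket (𝓡 m) u w) := hu.1.mlieBracket hw
  have hvw : SmoothVField (VectorField.mlieBracket (𝓡 m) v w) := hv.1.mlieBracket hw
  have e1 := congrFun (h.applyForm_mlieBracket hu hvw) x
  have e2 := congrFun (h.applyForm_mlieBracket hv huw) x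
  rw [h.applyForm_mlieBracket hv hw, dirDeriv_def u, differential_sub (hf.dirDeriv hv.1) (hk.mul hf),
    differential_mul hk hf] at e1
  rw [h.applyForm_mlieBracket hu hw, dirDeriv_def v, differential_sub (hf.dirDeriv hu.1) (hl.mul hf),
    differential_mul hl hf] at e2
  rw [lieDerivForm, dirDeriv_mlieBracket hu.1 hv.1 hf, mlieBracket_jacobi hu.1 hv.1 hw, map_sub]
  simp only [applyForm, dirDeriv_def] at e1 e2 ⊢
  rw [e1, e2]
  ring

end ContactFields

/-! ### The Riemannian determinant in terms of θ -/

section Gram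

variable {m : ℕ} {M : Type*} [TopologicalSpace M] [ChartedSpace (EuclideanSpace ℝ (Fin m)) M]
  [IsManifold (𝓡 m) ∞ M] {θ : OneForm m M} {g : SmoothMetric m M}

/-- The standard basis of Euclidean space. -/
abbrev stdBasis (m : ℕ) : Module.Basis (Fin m) ℝ (EuclideanSpace ℝ (Fin m)) :=
  (EuclideanSpace.basisFun (Fin m) ℝ).toBasis

theorem stdBasis_apply (i : Fin m) : stdBasis m i = EuclideanSpace.single i 1 := by simp

theorem gram_apply (g : SmoothMetric m M) (x₀ : M) (y : EuclideanSpace ℝ (Fin m)) (i j : Fin m) :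
    gram g x₀ y i j = g.inner ((extChartAt (𝓡 m) x₀).symm y) (pull x₀ y (stdBasis m i))
      (pull x₀ y (stdBasis m j)) := by
  rw [stdBasis_apply, stdBasis_apply]; rfl

theorem inner_pull_left (g : SmoothMetric m M) (x₀ : M) (y a : EuclideanSpace ℝ (Fin m))
    (w : TangentSpace (𝓡 m) ((extChartAt (𝓡 m) x₀).symm y)) :
    g.inner _ (pull x₀ y a) w
      = ∑ i, (stdBasis m).repr a i * g.inner _ (pull x₀ y (stdBasis m i)) w := by
  conv_lhs => rw [← (stdBasis m).sum_repr a, map_sum, map_sum]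
  simp only [map_smul, sum_apply, smul_apply, smul_eq_mul]

theorem inner_pull (g : SmoothMetric m M) (x₀ : M) (y a b : EuclideanSpace ℝ (Fin m)) :
    g.inner _ (pull x₀ y a) (pull x₀ y b)
      = ∑ i, ∑ j, (stdBasis m).repr a i * gram g x₀ y i j * (stdBasis m).repr b j := by
  rw [inner_pull_left]
  refine Finset.sum_congr rfl fun i _ => ?_
  rw [g.symm, inner_pull_left, Finset.mul_sum]
  refine Finset.sum_congr rfl fun j _ => ?_
  rw [gram_apply, g.symm]; ring

theorem gram_posDef (g : SmoothMetric m M) {x₀ : M} {y : EuclideanSpace ℝ (Fin m)}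
    (hy : y ∈ (extChartAt (𝓡 m) x₀).target) : (gram g x₀ y).PosDef := by
  refine Matrix.PosDef.of_dotProduct_mulVec_pos ?_ fun v hv => ?_
  · ext i j
    rw [Matrix.conjTranspose_apply, gram_apply, gram_apply, g.symm]
    simp
  · set a : EuclideanSpace ℝ (Fin m) := WithLp.toLp 2 v with ha
    have ha0 : a ≠ 0 := fun h0 => hv (by simpa [ha] using h0)
    have hp : pull x₀ y a ≠ 0 := fun h0 => ha0 (by rw [← push_pull hy a, h0, map_zero])
    have h1 := g.pos _ _ hp
    rw [inner_pull] at h1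
    refine lt_of_lt_of_eq h1 ?_
    simp only [dotProduct, Matrix.mulVec, Finset.mul_sum]
    refine Finset.sum_congr rfl fun i _ => Finset.sum_congr rfl fun j _ => ?_
    simp [ha, mul_assoc]

theorem det_gram_pos (g : SmoothMetric m M) {x₀ : M} {y : EuclideanSpace ℝ (Fin m)}
    (hy : y ∈ (extChartAt (𝓡 m) x₀).target) : 0 < (gram g x₀ y).det :=
  (gram_posDef g hy).det_pos

/-- Take ψ = φ + θ ⊗ E. It fixes E, and its square is -1 on the kernel of θ, so ψ⁴ = 1. -/
theorem ContactMetric.exists_fourth_root (h : ContactMetric θ g) (x : M) :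
    ∃ ψ : TangentSpace (𝓡 m) x →L[ℝ] TangentSpace (𝓡 m) x, (∀ u, ψ (ψ (ψ (ψ u))) = u) ∧
      ∀ u v, contactBilin θ x u v = g.inner x u (ψ v) := by
  obtain ⟨hθ, φ, -, hφ2, hφ⟩ := h.assoc
  have hφR : φ x (reeb θ x) = 0 := by
    by_contra hne
    have h1 := g.pos x _ hne
    rw [← hφ, h.extD_reeb_right] at h1
    exact h1.ne rfl
  have hθφ : ∀ u, θ x (φ x u) = 0 := fun u => by
    rw [hθ, g.symm, ← hφ, h.extD_reeb]
  refine ⟨φ x + (θ x).smulRight (reeb θ x), ?_, ?_⟩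
  · have h1 : ∀ u, (φ x + (θ x).smulRight (reeb θ x)) u = φ x u + θ x u • reeb θ x := fun u => rfl
    have h2 : ∀ u, (φ x + (θ x).smulRight (reeb θ x)) ((φ x + (θ x).smulRight (reeb θ x)) u)
        = -u + (2 * θ x u) • reeb θ x := by
      intro u
      rw [h1, h1, map_add, map_smul, hφR, smul_zero, add_zero, hφ2, map_add, hθφ, map_smul,
        h.reeb_apply, smul_eq_mul, mul_one, zero_add, two_mul, add_smul, add_assoc]
    intro u
    rw [h2 u, h2, map_add, map_neg, map_smul, h.reeb_apply, smul_eq_mul, mul_one]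
    module
  · intro u v
    have h1 : (φ x + (θ x).smulRight (reeb θ x)) v = φ x v + θ x v • reeb θ x := rfl
    rw [h1, map_add, ← hφ, map_smul, ← hθ, contactBilin, smul_eq_mul, mul_comm (θ x v)]

/-- The matrix of dθ + θ ⊗ θ is the Gram matrix times that of ψ, and ψ⁴ = 1 forces |det ψ| = 1. Thus
the Riemannian density is the one whose derivative along contact fields is known. -/
theorem ContactMetric.det_gram (h : ContactMetric θ g) {x₀ : M} {y : EuclideanSpace ℝ (Fin m)}
    (hy : y ∈ (extChartAt (𝓡 m) x₀).target) :
    (gram g x₀ y).det = |(contactMatrix (stdBasis m) (formInChart θ x₀) y).det| := by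
  obtain ⟨ψ, hψ4, hψ⟩ := h.exists_fourth_root ((extChartAt (𝓡 m) x₀).symm y)
  let T : EuclideanSpace ℝ (Fin m) →ₗ[ℝ] EuclideanSpace ℝ (Fin m) :=
    (((push x₀ ((extChartAt (𝓡 m) x₀).symm y)).comp ψ).comp (pull x₀ y)).toLinearMap
  have hT : ∀ a, pull x₀ y (T a) = ψ (pull x₀ y a) := fun a => pull_push hy _
  have hT4 : T * T * T * T = 1 := by
    refine LinearMap.ext fun a => ?_
    change T (T (T (T a))) = a
    rw [← push_pull hy (T (T (T (T a)))), hT, hT, hT, hT, hψ4, push_pull hy]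
  have hdet : |LinearMap.det T| = 1 := by
    have h1 := congrArg LinearMap.det hT4
    rw [map_mul, map_mul, map_mul, map_one] at h1
    have h2 : |LinearMap.det T| ^ 4 = 1 := by
      rw [← abs_pow, show LinearMap.det T ^ 4
        = LinearMap.det T * LinearMap.det T * LinearMap.det T * LinearMap.det T by ring, h1, abs_one]
    exact (pow_eq_one_iff_of_nonneg (abs_nonneg _) (by norm_num)).1 h2
  have hmat : contactMatrix (stdBasis m) (formInChart θ x₀) y
      = gram g x₀ y * LinearMap.toMatrix (stdBasis m) (stdBasis m) T := by
    ext i j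
    have h1 : contactMatrix (stdBasis m) (formInChart θ x₀) y i j
        = contactBilin θ _ (pull x₀ y (stdBasis m i)) (pull x₀ y (stdBasis m j)) :=
      bilinInChart_apply h.smooth hy _ _
    rw [h1, hψ, ← hT, g.symm, inner_pull_left, Matrix.mul_apply]
    refine Finset.sum_congr rfl fun k _ => ?_
    rw [gram_apply, g.symm, LinearMap.toMatrix_apply, mul_comm]
  rw [hmat, Matrix.det_mul, LinearMap.det_toMatrix, abs_mul, hdet, mul_one,
    abs_of_pos (det_gram_pos g hy)]

/-- The derivative of a change of charts. -/
theorem hasFDerivAt_chart_change {x₀ x₁ : M} {y : EuclideanSpace ℝ (Fin m)}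
    (hy : y ∈ (extChartAt (𝓡 m) x₀).target)
    (hy' : (extChartAt (𝓡 m) x₀).symm y ∈ (extChartAt (𝓡 m) x₁).source) :
    HasFDerivAt (fun z => extChartAt (𝓡 m) x₁ ((extChartAt (𝓡 m) x₀).symm z))
      ((push x₁ ((extChartAt (𝓡 m) x₀).symm y)).comp (pull x₀ y)) y := by
  rw [extChartAt_source] at hy'
  have h1 := (mdifferentiableAt_extChartAt (I := 𝓡 m) hy').hasMFDerivAt
  have h2 := (mdifferentiableAt_symm hy).hasMFDerivAt
  exact (h1.comp y h2).hasFDerivAt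

theorem inner_push (g : SmoothMetric m M) {x₁ x : M} (hx : x ∈ (extChartAt (𝓡 m) x₁).source)
    (v w : TangentSpace (𝓡 m) x) :
    g.inner x v w = ∑ i, ∑ j, (stdBasis m).repr (push x₁ x v) i
      * gram g x₁ (extChartAt (𝓡 m) x₁ x) i j * (stdBasis m).repr (push x₁ x w) j := by
  obtain ⟨y, hy, rfl⟩ : ∃ y ∈ (extChartAt (𝓡 m) x₁).target, (extChartAt (𝓡 m) x₁).symm y = x :=
    ⟨_, (extChartAt (𝓡 m) x₁).map_source hx, (extChartAt (𝓡 m) x₁).left_inv hx⟩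
  rw [(extChartAt (𝓡 m) x₁).right_inv hy, ← inner_pull, pull_push hy, pull_push hy]

theorem det_gram_chart_change (g : SmoothMetric m M) {x₀ x₁ : M} {y : EuclideanSpace ℝ (Fin m)}
    (hy' : (extChartAt (𝓡 m) x₀).symm y ∈ (extChartAt (𝓡 m) x₁).source) :
    √(gram g x₀ y).det
      = |((push x₁ ((extChartAt (𝓡 m) x₀).symm y)).comp (pull x₀ y)).det|
        * √(gram g x₁ (extChartAt (𝓡 m) x₁ ((extChartAt (𝓡 m) x₀).symm y))).det := by
  set D : EuclideanSpace ℝ (Fin m) →L[ℝ] EuclideanSpace ℝ (Fin m) :=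
    (push x₁ ((extChartAt (𝓡 m) x₀).symm y)).comp (pull x₀ y) with hD
  set D' := LinearMap.toMatrix (stdBasis m) (stdBasis m) (D : _ →ₗ[ℝ] _) with hD'
  have hmat : gram g x₀ y = D'.transpose
      * gram g x₁ (extChartAt (𝓡 m) x₁ ((extChartAt (𝓡 m) x₀).symm y)) * D' := by
    ext i j
    rw [gram_apply, inner_push g hy', Matrix.mul_apply, Finset.sum_comm]
    refine Finset.sum_congr rfl fun k _ => ?_
    rw [Matrix.mul_apply, Finset.sum_mul]
    refine Finset.sum_congr rfl fun l _ => ?_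
    rw [Matrix.transpose_apply, hD', LinearMap.toMatrix_apply, LinearMap.toMatrix_apply]
    rfl
  have hdet : D'.det = D.det := LinearMap.det_toMatrix _ _
  rw [hmat, Matrix.det_mul, Matrix.det_mul, Matrix.det_transpose, hdet, mul_right_comm,
    Real.sqrt_mul (mul_self_nonneg _), Real.sqrt_mul_self_eq_abs]

end Gram

/-! ### The Riemannian volume measure -/

section Volume

variable {m : ℕ} {M : Type*} [TopologicalSpace M] [ChartedSpace (EuclideanSpace ℝ (Fin m)) M]
  [IsManifold (𝓡 m) ∞ M] [MeasurableSpace M] [BorelSpace M]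
  {θ : OneForm m M} {g : SmoothMetric m M}

/-- The volume density in a chart. -/
def density (g : SmoothMetric m M) (x₀ : M) (y : EuclideanSpace ℝ (Fin m)) : ENNReal :=
  ENNReal.ofReal √(gram g x₀ y).det

open Classical in
-- The inverse chart is controlled only on its target; a constant extension outside gives a globally
-- measurable representative.
theorem exists_measurable_symm (x₀ : M) :
    ∃ F : EuclideanSpace ℝ (Fin m) → M, Measurable F ∧
      ∀ y ∈ (extChartAt (𝓡 m) x₀).target, F y = (extChartAt (𝓡 m) x₀).symm y :=
  ⟨(extChartAt (𝓡 m) x₀).target.piecewise (extChartAt (𝓡 m) x₀).symm (fun _ => x₀),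
    (continuousOn_extChartAt_symm x₀).measurable_piecewise continuousOn_const
      (isOpen_target x₀).measurableSet,
    fun _ hy => Set.piecewise_eq_of_mem _ _ _ hy⟩

theorem measurableSet_target_inter_preimage (x₀ : M) {A : Set M} (hA : MeasurableSet A) :
    MeasurableSet ((extChartAt (𝓡 m) x₀).target ∩ (extChartAt (𝓡 m) x₀).symm ⁻¹' A) := by
  obtain ⟨F, hF, hF'⟩ := exists_measurable_symm (m := m) x₀
  have : (extChartAt (𝓡 m) x₀).target ∩ (extChartAt (𝓡 m) x₀).symm ⁻¹' A
      = (extChartAt (𝓡 m) x₀).target ∩ F ⁻¹' A := by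
    ext y
    refine and_congr_right fun hy => ?_
    rw [Set.mem_preimage, Set.mem_preimage, hF' y hy]
  rw [this]
  exact (isOpen_target x₀).measurableSet.inter (hF hA)

theorem ae_mem_target (g : SmoothMetric m M) (x₀ : M) :
    ∀ᵐ y ∂(((volume : Measure (EuclideanSpace ℝ (Fin m))).restrict
      (extChartAt (𝓡 m) x₀).target).withDensity (density g x₀)),
      y ∈ (extChartAt (𝓡 m) x₀).target :=
  withDensity_absolutelyContinuous _ _ (ae_restrict_mem (isOpen_target x₀).measurableSet)

theorem aemeasurable_symm (g : SmoothMetric m M) (x₀ : M) :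
    AEMeasurable (extChartAt (𝓡 m) x₀).symm
      (((volume : Measure (EuclideanSpace ℝ (Fin m))).restrict
      (extChartAt (𝓡 m) x₀).target).withDensity (density g x₀)) := by
  obtain ⟨F, hF, hF'⟩ := exists_measurable_symm (m := m) x₀
  exact ⟨F, hF, (ae_mem_target g x₀).mono fun y hy => (hF' y hy).symm⟩

theorem chartVolume_apply (g : SmoothMetric m M) (x₀ : M) {A : Set M} (hA : MeasurableSet A) :
    chartVolume g x₀ A = ∫⁻ y in (extChartAt (𝓡 m) x₀).target ∩ (extChartAt (𝓡 m) x₀).symm ⁻¹' A,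
      density g x₀ y := by
  obtain ⟨F, hF, hF'⟩ := exists_measurable_symm (m := m) x₀
  have h1 : chartVolume g x₀ = Measure.map F (((volume : Measure (EuclideanSpace ℝ (Fin m))).restrict
      (extChartAt (𝓡 m) x₀).target).withDensity (density g x₀)) :=
    Measure.map_congr ((ae_mem_target g x₀).mono fun y hy => (hF' y hy).symm)
  rw [h1, Measure.map_apply hF hA, withDensity_apply _ (hF hA), Measure.restrict_restrict (hF hA)]
  congr 2
  ext y
  rw [Set.inter_comm]
  refine and_congr_right fun hy => ?_
  rw [Set.mem_preimage, Set.mem_preimage, hF' y hy]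

/-- Change of variables: the Jacobian of the transition map is exactly the factor by which √det g
changes. -/
theorem chartVolume_congr (g : SmoothMetric m M) {x₀ x₁ : M} {A : Set M} (hA : MeasurableSet A)
    (h0 : A ⊆ (extChartAt (𝓡 m) x₀).source) (h1 : A ⊆ (extChartAt (𝓡 m) x₁).source) :
    chartVolume g x₀ A = chartVolume g x₁ A := by
  rw [chartVolume_apply g x₀ hA, chartVolume_apply g x₁ hA]
  set s := (extChartAt (𝓡 m) x₀).target ∩ (extChartAt (𝓡 m) x₀).symm ⁻¹' A with hs
  set τ := fun z => extChartAt (𝓡 m) x₁ ((extChartAt (𝓡 m) x₀).symm z) with hτ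
  have himg : τ '' s = (extChartAt (𝓡 m) x₁).target ∩ (extChartAt (𝓡 m) x₁).symm ⁻¹' A := by
    ext y
    constructor
    · rintro ⟨z, ⟨hz, hzA⟩, rfl⟩
      refine ⟨(extChartAt (𝓡 m) x₁).map_source (h1 hzA), ?_⟩
      rw [Set.mem_preimage, hτ]
      simp only
      rw [(extChartAt (𝓡 m) x₁).left_inv (h1 hzA)]
      exact hzA
    · rintro ⟨hy, hyA⟩
      refine ⟨extChartAt (𝓡 m) x₀ ((extChartAt (𝓡 m) x₁).symm y),
        ⟨(extChartAt (𝓡 m) x₀).map_source (h0 hyA), ?_⟩, ?_⟩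
      · rw [Set.mem_preimage, (extChartAt (𝓡 m) x₀).left_inv (h0 hyA)]
        exact hyA
      · rw [hτ]
        simp only
        rw [(extChartAt (𝓡 m) x₀).left_inv (h0 hyA), (extChartAt (𝓡 m) x₁).right_inv hy]
  have hinj : Set.InjOn τ s := by
    rintro y ⟨hy, hyA⟩ z ⟨hz, hzA⟩ hyz
    have := (extChartAt (𝓡 m) x₁).injOn (h1 hyA) (h1 hzA) hyz
    exact (extChartAt (𝓡 m) x₀).symm.injOn hy hz this
  rw [← himg, lintegral_image_eq_lintegral_abs_det_fderiv_mul volume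
    (measurableSet_target_inter_preimage x₀ hA)
    (fun y hy => (hasFDerivAt_chart_change hy.1 (h1 hy.2)).hasFDerivWithinAt) hinj]
  refine setLIntegral_congr_fun (measurableSet_target_inter_preimage x₀ hA) fun y hy => ?_
  simp only [density]
  rw [det_gram_chart_change g (h1 hy.2), ENNReal.ofReal_mul (abs_nonneg _)]

theorem chartVolume_inter_source (g : SmoothMetric m M) (x₀ : M) {A : Set M}
    (hA : MeasurableSet A) :
    chartVolume g x₀ A = chartVolume g x₀ (A ∩ (extChartAt (𝓡 m) x₀).source) := by
  rw [chartVolume_apply g x₀ hA,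
    chartVolume_apply g x₀ (hA.inter (isOpen_extChartAt_source x₀).measurableSet)]
  congr 2
  ext y
  refine and_congr_right fun hy => ?_
  simp only [Set.mem_preimage, Set.mem_inter_iff, (extChartAt (𝓡 m) x₀).map_target hy, and_true]

variable [CompactSpace M]

/-- On the domain of a chart, the Riemannian volume is the chart measure. -/
theorem riemVolume_apply (g : SmoothMetric m M) (x₀ : M) {A : Set M} (hA : MeasurableSet A)
    (h0 : A ⊆ (extChartAt (𝓡 m) x₀).source) : riemVolume g A = chartVolume g x₀ A := by
  obtain ⟨s, hs, hcov⟩ := countable_cover_nhds_of_sigmaCompact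
    (fun x : M => extChartAt_source_mem_nhds (I := 𝓡 m) x)
  have hne : s.Nonempty := by
    by_contra hne
    rw [Set.not_nonempty_iff_eq_empty] at hne
    have : x₀ ∈ (Set.univ : Set M) := trivial
    rw [← hcov, hne] at this
    simp at this
  obtain ⟨c, rfl⟩ := hs.exists_eq_range hne
  rw [Set.biUnion_range] at hcov
  set U : ℕ → Set M := fun i => (extChartAt (𝓡 m) (c i)).source with hU
  have hUm : ∀ i, MeasurableSet (U i) := fun i => (isOpen_extChartAt_source (c i)).measurableSet
  have hBm : ∀ i, MeasurableSet (disjointed U i) := MeasurableSet.disjointed hUm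
  have hBU : ∀ i, disjointed U i ⊆ U i := disjointed_subset U
  have hsplit : ∀ (μ : Measure M) {A : Set M}, MeasurableSet A →
      μ A = ∑' i, μ (A ∩ disjointed U i) := by
    intro μ A hA
    rw [← measure_iUnion (fun i j hij => ((disjoint_disjointed U hij).mono
      Set.inter_subset_right Set.inter_subset_right)) fun i => hA.inter (hBm i),
      ← Set.inter_iUnion, iUnion_disjointed, hcov, Set.inter_univ]
  -- ν is glued from chart measures on disjoint pieces of a countable cover. By compatibility on
  -- overlaps it dominates every chart measure, and piecewise it lies below their supremum, so it is
  -- that supremum.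
  let ν : Measure M := Measure.sum fun i => (chartVolume g (c i)).restrict (disjointed U i)
  have hν : ∀ {A : Set M}, MeasurableSet A →
      ν A = ∑' i, chartVolume g (c i) (A ∩ disjointed U i) := by
    intro A hA
    rw [Measure.sum_apply _ hA]
    exact tsum_congr fun i => Measure.restrict_apply hA
  have hν' : ∀ (x : M) {A : Set M}, MeasurableSet A → A ⊆ (extChartAt (𝓡 m) x).source →
      ν A = chartVolume g x A := by
    intro x A hA h
    rw [hν hA, hsplit (chartVolume g x) hA]
    exact tsum_congr fun i => chartVolume_congr g (hA.inter (hBm i))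
      (Set.inter_subset_right.trans (hBU i)) (Set.inter_subset_left.trans h)
  have hle : ∀ x, chartVolume g x ≤ ν := fun x => Measure.le_iff.2 fun A hA => by
    rw [chartVolume_inter_source g x hA, ← hν' x
      (hA.inter (isOpen_extChartAt_source x).measurableSet) Set.inter_subset_right]
    exact measure_mono Set.inter_subset_left
  have hge : ν ≤ riemVolume g := Measure.le_iff.2 fun A hA => by
    rw [hν hA, hsplit (riemVolume g) hA]
    exact ENNReal.tsum_le_tsum fun i => le_iSup (chartVolume g) (c i) _
  have heq : riemVolume g = ν := le_antisymm (iSup_le hle) hge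
  rw [heq, hν' x₀ hA h0]

theorem riemVolume_restrict (g : SmoothMetric m M) (x₀ : M) :
    (riemVolume g).restrict (extChartAt (𝓡 m) x₀).source = chartVolume g x₀ := by
  ext A hA
  rw [Measure.restrict_apply hA, chartVolume_inter_source g x₀ hA]
  exact riemVolume_apply g x₀ (hA.inter (isOpen_extChartAt_source x₀).measurableSet)
    Set.inter_subset_right

/-- Continuity of the density is read off from the smooth form θ through `ContactMetric.det_gram`.
-/
theorem ContactMetric.continuousOn_sqrt_det (h : ContactMetric θ g) (x₀ : M) :
    ContinuousOn (fun y => √(gram g x₀ y).det) (extChartAt (𝓡 m) x₀).target := by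
  have h1 : ContinuousOn (fun y => √|(contactMatrix (stdBasis m) (formInChart θ x₀) y).det|)
      (extChartAt (𝓡 m) x₀).target :=
    (contDiffOn_det_contactMatrix _ (isOpen_target x₀)
      (h.smooth.contDiffOn x₀)).continuousOn.abs.sqrt
  exact h1.congr fun y hy => by rw [h.det_gram hy]

/-- The density is bounded on small closed coordinate balls, so the measure is locally finite; M is
compact. -/
theorem ContactMetric.isFiniteMeasure (h : ContactMetric θ g) :
    IsFiniteMeasure (riemVolume g) := by
  have : IsLocallyFiniteMeasure (riemVolume g) := by
    refine ⟨fun x => ?_⟩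
    have hy : extChartAt (𝓡 m) x x ∈ (extChartAt (𝓡 m) x).target := mem_extChartAt_target x
    obtain ⟨r, hr, hball⟩ := Metric.nhds_basis_closedBall.mem_iff.1 (target_mem_nhds hy)
    set K := Metric.closedBall (extChartAt (𝓡 m) x x) r
    set U := (extChartAt (𝓡 m) x).source ∩ extChartAt (𝓡 m) x ⁻¹' (Metric.ball (extChartAt (𝓡 m) x x) r)
      with hU
    have hUo : IsOpen U := (continuousOn_extChartAt x).isOpen_inter_preimage
      (isOpen_extChartAt_source x) Metric.isOpen_ball
    refine ⟨U, hUo.mem_nhds ⟨mem_extChartAt_source x, Metric.mem_ball_self hr⟩, ?_⟩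
    rw [riemVolume_apply g x hUo.measurableSet Set.inter_subset_left,
      chartVolume_apply g x hUo.measurableSet]
    have hsub : (extChartAt (𝓡 m) x).target ∩ (extChartAt (𝓡 m) x).symm ⁻¹' U ⊆ K := by
      rintro y ⟨hy, -, hyU⟩
      rw [Set.mem_preimage, (extChartAt (𝓡 m) x).right_inv hy] at hyU
      exact Metric.ball_subset_closedBall hyU
    refine (lintegral_mono_set hsub).trans_lt ?_
    exact ((((h.continuousOn_sqrt_det x).mono hball).integrableOn_compact
      (isCompact_closedBall _ _)).lintegral_lt_top)
  exact ⟨isCompact_univ.measure_lt_top⟩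

/-- The density is strictly positive in every chart. This is what makes the L² product definite on
smooth functions. -/
theorem ContactMetric.isOpenPosMeasure (h : ContactMetric θ g) :
    (riemVolume g).IsOpenPosMeasure := by
  refine ⟨fun U hU ⟨x, hx⟩ h0 => ?_⟩
  set V := U ∩ (extChartAt (𝓡 m) x).source with hV
  have hVo : IsOpen V := hU.inter (isOpen_extChartAt_source x)
  have h1 : riemVolume g V = 0 := measure_mono_null Set.inter_subset_left h0
  rw [riemVolume_apply g x hVo.measurableSet Set.inter_subset_right,
    chartVolume_apply g x hVo.measurableSet] at h1
  set s := (extChartAt (𝓡 m) x).target ∩ (extChartAt (𝓡 m) x).symm ⁻¹' V with hs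
  have hso : IsOpen s := (continuousOn_extChartAt_symm x).isOpen_inter_preimage
    (isOpen_target x) hVo
  have hmem : extChartAt (𝓡 m) x x ∈ s := by
    refine ⟨mem_extChartAt_target x, ?_⟩
    rw [Set.mem_preimage, extChartAt_to_inv]
    exact ⟨hx, mem_extChartAt_source x⟩
  have hpos : ∀ y ∈ s, density g x y ≠ 0 := fun y hy =>
    (ENNReal.ofReal_pos.2 (Real.sqrt_pos.2 (det_gram_pos g hy.1))).ne'
  have h2 : volume s = 0 := by
    have hm : AEMeasurable (density g x)
        ((volume : Measure (EuclideanSpace ℝ (Fin m))).restrict s) :=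
      (((h.continuousOn_sqrt_det x).mono Set.inter_subset_left).aemeasurable
        hso.measurableSet).ennreal_ofReal
    rw [lintegral_eq_zero_iff' hm, Filter.EventuallyEq,
      ae_restrict_iff' hso.measurableSet] at h1
    refine measure_mono_null (fun y hy => ?_) h1
    simpa using ⟨hy, hpos y hy⟩
  exact (hso.measure_pos volume ⟨_, hmem⟩).ne' h2

theorem ContactMetric.integral_eq (h : ContactMetric θ g) (x₀ : M) {F : M → ℝ}
    (hF : Continuous F) (hsupp : ∀ x ∉ (extChartAt (𝓡 m) x₀).source, F x = 0) :
    ∫ x, F x ∂(riemVolume g) = ∫ y in (extChartAt (𝓡 m) x₀).target,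
      F ((extChartAt (𝓡 m) x₀).symm y)
        * √|(contactMatrix (stdBasis m) (formInChart θ x₀) y).det| := by
  rw [← setIntegral_eq_integral_of_forall_compl_eq_zero hsupp, riemVolume_restrict]
  have h1 : chartVolume g x₀ = (((volume : Measure (EuclideanSpace ℝ (Fin m))).restrict
      (extChartAt (𝓡 m) x₀).target).withDensity (density g x₀)).map (extChartAt (𝓡 m) x₀).symm :=
    rfl
  rw [h1, integral_map (aemeasurable_symm g x₀) hF.aestronglyMeasurable,
    integral_withDensity_eq_integral_toReal_smul₀]
  · refine setIntegral_congr_fun (isOpen_target x₀).measurableSet fun y hy => ?_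
    simp only [density, smul_eq_mul]
    rw [ENNReal.toReal_ofReal (Real.sqrt_nonneg _), h.det_gram hy, mul_comm]
  · exact ((h.continuousOn_sqrt_det x₀).aemeasurable
      (isOpen_target x₀).measurableSet).ennreal_ofReal
  · exact Filter.Eventually.of_forall fun y => ENNReal.ofReal_lt_top

end Volume

/-! ### The divergence theorem for contact fields -/

section Divergence

variable {m : ℕ} {M : Type*} [TopologicalSpace M] [ChartedSpace (EuclideanSpace ℝ (Fin m)) M]
  [IsManifold (𝓡 m) ∞ M] {θ : OneForm m M} {g : SmoothMetric m M}

theorem SmoothFun.continuous {f : M → ℝ} (hf : SmoothFun m f) : Continuous f :=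
  ContMDiff.continuous hf

theorem SmoothFun.sum {ι : Type*} (s : Finset ι) {f : ι → M → ℝ} (hf : ∀ i, SmoothFun m (f i)) :
    SmoothFun m (fun x => ∑ i ∈ s, f i x) := by
  classical
  induction s using Finset.induction_on with
  | empty => simpa using smoothFun_const (m := m) (M := M) 0
  | insert i s hi ih =>
    simp only [Finset.sum_insert hi]
    exact (hf i).add ih

theorem differential_sum {ι : Type*} (s : Finset ι) {f : ι → M → ℝ} (hf : ∀ i, SmoothFun m (f i))
    (x : M) (w : TangentSpace (𝓡 m) x) :
    differential (fun x => ∑ i ∈ s, f i x) x w = ∑ i ∈ s, differential (f i) x w := by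
  classical
  induction s using Finset.induction_on with
  | empty => simpa using differential_const (m := m) 0 x w
  | insert i s hi ih =>
    simp only [Finset.sum_insert hi]
    rw [differential_add (hf i) (SmoothFun.sum s hf), ih]

theorem differential_eq_zero {f : M → ℝ} {x : M} (hx : x ∉ tsupport f)
    (w : TangentSpace (𝓡 m) x) : differential f x w = 0 := by
  have h0 : f =ᶠ[𝓝 x] fun _ => 0 := by
    filter_upwards [(isClosed_tsupport f).isOpen_compl.mem_nhds hx] with z hz
      using image_eq_zero_of_notMem_tsupport hz
  have h1 : differential f x = differential (m := m) (fun _ => (0 : ℝ)) x := h0.mfderiv_eq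
  rw [h1, differential_const]

variable [T2Space M]

/-- The equation `L_u θ = l θ` in a chart. -/
theorem ContactMetric.contact_equation_chart (h : ContactMetric θ g) {u : VField m M}
    (hu : IsContactField θ u) {x₀ : M} {y : EuclideanSpace ℝ (Fin m)}
    (hy : y ∈ (extChartAt (𝓡 m) x₀).target) (w : EuclideanSpace ℝ (Fin m)) :
    fderiv ℝ (formInChart θ x₀) y (vecInChart u x₀ y) w
        + formInChart θ x₀ y (fderiv ℝ (vecInChart u x₀) y w)
      = dirDeriv (reeb θ) (applyForm θ u) ((extChartAt (𝓡 m) x₀).symm y)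
        * formInChart θ x₀ y w := by
  have hn := target_mem_nhds hy
  have h1 := (h.isContactField_iff.1 hu).2 _ (pull x₀ y w)
  rw [← pull_vecInChart u hy, extD_pull h.smooth hy, ← formInChart_apply, ← formInChart_apply,
    formInChart_differential (h.smooth_stream hu) hy] at h1
  have ht : HasFDerivAt (formInChart θ x₀) (fderiv ℝ (formInChart θ x₀) y) y :=
      (((h.smooth.contDiffOn x₀).contDiffAt hn).differentiableAt (by simp)).hasFDerivAt
  have hv : HasFDerivAt (vecInChart u x₀) (fderiv ℝ (vecInChart u x₀) y) y :=
      (((hu.1.contDiffOn x₀).contDiffAt hn).differentiableAt (by simp)).hasFDerivAt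
  have h2 : (fun z => applyForm θ u ((extChartAt (𝓡 m) x₀).symm z))
      =ᶠ[𝓝 y] fun z => formInChart θ x₀ z (vecInChart u x₀ z) := by
    filter_upwards [hn] with z hz using applyForm_symm θ u hz
  rw [h2.fderiv_eq, (ht.clm_apply hv).fderiv, flatD] at h1
  simp only [add_apply, ContinuousLinearMap.comp_apply, ContinuousLinearMap.flip_apply] at h1
  linarith

variable [MeasurableSpace M] [BorelSpace M] [CompactSpace M]

theorem ContactMetric.integral_divergence_of_tsupport (h : ContactMetric θ g) {u : VField m M}
    (hu : IsContactField θ u) {k : M → ℝ} (hk : SmoothFun m k) {x₀ : M}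
    (hks : tsupport k ⊆ (extChartAt (𝓡 m) x₀).source) :
    ∫ x, (dirDeriv u k x + (m + 1) / 2 * dirDeriv (reeb θ) (applyForm θ u) x * k x)
      ∂(riemVolume g) = 0 := by
  have hl := h.smooth_reebDeriv (h.smooth_stream hu)
  rw [h.integral_eq x₀ ((hk.dirDeriv hu.1).add (((smoothFun_const _).mul hl).mul hk)).continuous]
  swap
  · intro x hx
    have hx' : x ∉ tsupport k := fun h => hx (hks h)
    rw [dirDeriv_def, differential_eq_zero hx', image_eq_zero_of_notMem_tsupport hx']
    ring
  set T := (extChartAt (𝓡 m) x₀).target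
  -- Outside the target the inverse chart takes meaningless values, so k is extended by zero before
  -- its support is taken.
  set kc : EuclideanSpace ℝ (Fin m) → ℝ :=
    T.indicator fun y => k ((extChartAt (𝓡 m) x₀).symm y) with hkc
  have hkT : ∀ y ∈ T, kc y = k ((extChartAt (𝓡 m) x₀).symm y) := fun y hy =>
    Set.indicator_of_mem hy _
  set K := extChartAt (𝓡 m) x₀ '' tsupport k with hK
  have hKc : IsCompact K :=
    (isClosed_tsupport k).isCompact.image_of_continuousOn ((continuousOn_extChartAt x₀).mono hks)
  have hKT : K ⊆ T := by
    rintro _ ⟨x, hx, rfl⟩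
    exact (extChartAt (𝓡 m) x₀).map_source (hks hx)
  have hsupp : Function.support kc ⊆ K := by
    intro y hy
    have hyT : y ∈ T := by
      by_contra hne
      exact hy (Set.indicator_of_notMem hne _)
    rw [Function.mem_support, hkT y hyT] at hy
    exact ⟨_, subset_tsupport k hy, (extChartAt (𝓡 m) x₀).right_inv hyT⟩
  have hts : tsupport kc ⊆ K := closure_minimal hsupp hKc.isClosed
  have key := integral_divergence_eq_zero volume (stdBasis m) (isOpen_target x₀)
    (h.smooth.contDiffOn x₀) (hu.1.contDiffOn x₀) (hl.contDiffOn x₀)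
    ((hk.contDiffOn x₀).congr hkT) (HasCompactSupport.of_support_subset_isCompact hKc hsupp)
    (hts.trans hKT) (fun z hz w => h.contact_equation_chart hu hz w)
    (e := vecInChart (reeb θ) x₀)
    (fun z hz => by rw [← applyForm_symm θ _ hz]; exact h.reeb_apply _)
    (fun z hz b => by rw [← extD_pull h.smooth hz, pull_vecInChart _ hz, h.extD_reeb])
    (fun z hz => by
      have := det_gram_pos g hz
      rw [h.det_gram hz] at this
      exact abs_pos.1 this)
  rw [← key]
  refine setIntegral_congr_fun (isOpen_target x₀).measurableSet fun y hy => ?_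
  have heq : kc =ᶠ[𝓝 y] fun z => k ((extChartAt (𝓡 m) x₀).symm z) := by
    filter_upwards [target_mem_nhds hy] with z hz using hkT z hz
  rw [dirDeriv_symm u hk hy, heq.fderiv_eq, hkT y hy, Fintype.card_fin]

/-- The divergence theorem for contact fields. -/
theorem ContactMetric.integral_divergence (h : ContactMetric θ g) {u : VField m M}
    (hu : IsContactField θ u) {k : M → ℝ} (hk : SmoothFun m k) :
    ∫ x, (dirDeriv u k x + (m + 1) / 2 * dirDeriv (reeb θ) (applyForm θ u) x * k x)
      ∂(riemVolume g) = 0 := by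
  have hfin := h.isFiniteMeasure
  have hl := h.smooth_reebDeriv (h.smooth_stream hu)
  obtain ⟨t, ht⟩ := CompactSpace.elim_nhds_subcover (fun x : M => (extChartAt (𝓡 m) x).source)
    (fun x => extChartAt_source_mem_nhds x)
  -- A partition of unity subordinate to finitely many charts reduces the claim to functions
  -- supported in one chart.
  obtain ⟨ρ, hρ⟩ := SmoothPartitionOfUnity.exists_isSubordinate (𝓡 m) (s := Set.univ) isClosed_univ
    (fun i : t => (extChartAt (𝓡 m) (i : M)).source) (fun i => isOpen_extChartAt_source _)
    (fun x _ => by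
      have : x ∈ ⋃ y ∈ t, (extChartAt (𝓡 m) y).source := by rw [ht]; trivial
      simpa using this)
  have hρs : ∀ i, SmoothFun m (ρ i) := fun i => (ρ i).contMDiff
  have hsum : ∀ x, ∑ i, ρ i x = 1 := fun x => by
    rw [← finsum_eq_sum_of_fintype]; exact ρ.sum_eq_one trivial
  have hdsum : ∀ x, ∑ i, dirDeriv u (ρ i) x = 0 := fun x => by
    have h1 := differential_sum Finset.univ hρs x (u x)
    have h2 : (fun x => ∑ i, ρ i x) = fun _ => (1 : ℝ) := funext hsum
    rw [h2, differential_const] at h1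
    exact h1.symm
  have hks : ∀ i, SmoothFun m (fun x => ρ i x * k x) := fun i => (hρs i).mul hk
  -- The extra terms u(ρᵢ) k sum to zero because the ρᵢ sum to the constant 1.
  have hpt : ∀ x, dirDeriv u k x + (m + 1) / 2 * dirDeriv (reeb θ) (applyForm θ u) x * k x
      = ∑ i, (dirDeriv u (fun x => ρ i x * k x) x
        + (m + 1) / 2 * dirDeriv (reeb θ) (applyForm θ u) x * (ρ i x * k x)) := by
    intro x
    have h1 : ∀ i, dirDeriv u (fun x => ρ i x * k x) x
        + (m + 1) / 2 * dirDeriv (reeb θ) (applyForm θ u) x * (ρ i x * k x)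
        = ρ i x * (dirDeriv u k x + (m + 1) / 2 * dirDeriv (reeb θ) (applyForm θ u) x * k x)
          + dirDeriv u (ρ i) x * k x := by
      intro i
      rw [dirDeriv_def, differential_mul (hρs i) hk, ← dirDeriv_def, ← dirDeriv_def]
      ring
    simp only [h1]
    rw [Finset.sum_add_distrib, ← Finset.sum_mul, ← Finset.sum_mul, hsum, hdsum]
    ring
  simp only [hpt]
  rw [integral_finsetSum]
  · refine Finset.sum_eq_zero fun i _ => ?_
    refine h.integral_divergence_of_tsupport hu (hks i) (x₀ := i) ?_
    exact (closure_mono (Function.support_mul_subset_left _ _)).trans (hρ i)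
  · intro i _
    exact (((hks i).dirDeriv hu.1).add
      (((smoothFun_const _).mul hl).mul (hks i))).continuous.integrable_of_hasCompactSupport
        (HasCompactSupport.of_compactSpace _)

theorem ContactMetric.isContactField_reeb (h : ContactMetric θ g) : IsContactField θ (reeb θ) := by
  have h1 : applyForm θ (reeb θ) = fun _ => 1 := funext h.reeb_apply
  refine h.isContactField_iff.2 ⟨h.smoothVField_reeb, fun x w => ?_⟩
  rw [h1, differential_const, dirDeriv_def, differential_const, h.extD_reeb]
  ring

/-- E is the contact field with stream function 1, whose multiplier is E(1) = 0, so E is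
divergence-free. -/
theorem ContactMetric.integral_reebDeriv (h : ContactMetric θ g) {k : M → ℝ}
    (hk : SmoothFun m k) : ∫ x, dirDeriv (reeb θ) k x ∂(riemVolume g) = 0 := by
  rw [← h.integral_divergence h.isContactField_reeb hk]
  have h1 : applyForm θ (reeb θ) = fun _ => 1 := funext h.reeb_apply
  refine integral_congr_ae (Filter.Eventually.of_forall fun x => ?_)
  simp only
  rw [h1, dirDeriv_def (reeb θ) (fun _ => (1 : ℝ)), differential_const]
  ring

theorem ContactMetric.integrable (h : ContactMetric θ g) {f : M → ℝ} (hf : SmoothFun m f) :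
    Integrable f (riemVolume g) := by
  have := h.isFiniteMeasure
  exact hf.continuous.integrable_of_hasCompactSupport (HasCompactSupport.of_compactSpace _)

/-- A continuous function vanishing almost everywhere vanishes everywhere, since the volume charges
every nonempty open set. -/
theorem ContactMetric.eq_zero_of_integral_sq (h : ContactMetric θ g) {f : M → ℝ}
    (hf : SmoothFun m f) (h0 : ∫ x, f x * f x ∂(riemVolume g) = 0) (x : M) : f x = 0 := by
  have := h.isOpenPosMeasure
  rw [integral_eq_zero_iff_of_nonneg (fun x => mul_self_nonneg (f x))
    (h.integrable (hf.mul hf))] at h0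
  have h1 := (Continuous.ae_eq_iff_eq _ (hf.mul hf).continuous continuous_const).1 h0
  exact mul_self_eq_zero.1 (congrFun h1 x)

end Divergence

/-! ### The Levi-Civita connection, the operator B and the curvature -/

section Curvature

variable {m : ℕ} {M : Type*} [TopologicalSpace M] [ChartedSpace (EuclideanSpace ℝ (Fin m)) M]
  [IsManifold (𝓡 m) ∞ M] {θ : OneForm m M} {g : SmoothMetric m M}

theorem applyForm_add (u v : VField m M) :
    applyForm θ (u + v) = fun x => applyForm θ u x + applyForm θ v x :=
  funext fun x => map_add (θ x) (u x) (v x)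

theorem applyForm_sub (u v : VField m M) :
    applyForm θ (u - v) = fun x => applyForm θ u x - applyForm θ v x :=
  funext fun x => map_sub (θ x) (u x) (v x)

theorem applyForm_neg (u : VField m M) :
    applyForm θ (-u) = fun x => -applyForm θ u x :=
  funext fun x => map_neg (θ x) (u x)

theorem applyForm_smul (r : ℝ) (u : VField m M) :
    applyForm θ (r • u) = fun x => r * applyForm θ u x :=
  funext fun x => map_smul (θ x) r (u x)

theorem dirDeriv_fun_add (u : VField m M) {f h : M → ℝ} (hf : SmoothFun m f)
    (hh : SmoothFun m h) (x : M) :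
    dirDeriv u (fun x => f x + h x) x = dirDeriv u f x + dirDeriv u h x :=
  differential_add hf hh x (u x)

theorem dirDeriv_fun_mul (u : VField m M) {f h : M → ℝ} (hf : SmoothFun m f)
    (hh : SmoothFun m h) (x : M) :
    dirDeriv u (fun x => f x * h x) x = f x * dirDeriv u h x + h x * dirDeriv u f x :=
  differential_mul hf hh x (u x)

theorem dirDeriv_const_mul (u : VField m M) {f : M → ℝ} (hf : SmoothFun m f) (r : ℝ) (x : M) :
    dirDeriv u (fun x => r * f x) x = r * dirDeriv u f x :=
  differential_const_mul hf r x (u x)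

/-- The stream function of `∇_X Y`. -/
def connectionStream (θ : OneForm m M) (X Y : VField m M) (x : M) : ℝ :=
  1 / 2 * (dirDeriv X (applyForm θ Y) x - applyForm θ Y x * dirDeriv (reeb θ) (applyForm θ X) x
    + (m + 5) / 2 * (applyForm θ X x * dirDeriv (reeb θ) (applyForm θ Y) x
      + applyForm θ Y x * dirDeriv (reeb θ) (applyForm θ X) x))

/-- The stream function of `B(X,Y)`. -/
def coadjointStream (θ : OneForm m M) (X Y : VField m M) (x : M) : ℝ :=
  dirDeriv Y (applyForm θ X) x + (m + 3) / 2 * (applyForm θ X x * dirDeriv (reeb θ) (applyForm θ Y) x)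

variable [T2Space M]

theorem ContactMetric.smooth_connectionStream (h : ContactMetric θ g) {X Y : VField m M}
    (hX : IsContactField θ X) (hY : IsContactField θ Y) :
    SmoothFun m (connectionStream θ X Y) := by
  have sX := h.smooth_stream hX
  have sY := h.smooth_stream hY
  have eX := h.smooth_reebDeriv sX
  have eY := h.smooth_reebDeriv sY
  exact (smoothFun_const (1 / 2)).mul (((sY.dirDeriv hX.1).sub (sY.mul eX)).add
    ((smoothFun_const ((m + 5) / 2)).mul ((sX.mul eY).add (sY.mul eX))))

theorem ContactMetric.smooth_coadjointStream (h : ContactMetric θ g) {X Y : VField m M}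
    (hX : IsContactField θ X) (hY : IsContactField θ Y) :
    SmoothFun m (coadjointStream θ X Y) := by
  have sX := h.smooth_stream hX
  have eY := h.smooth_reebDeriv (h.smooth_stream hY)
  exact (sX.dirDeriv hY.1).add ((smoothFun_const ((m + 3) / 2)).mul (sX.mul eY))

/-- `θ([X,Y])` is antisymmetric in `X` and `Y`. -/
theorem ContactMetric.stream_mlieBracket_skew (h : ContactMetric θ g) {X Y : VField m M}
    (hX : IsContactField θ X) (hY : IsContactField θ Y) (x : M) :
    applyForm θ (VectorField.mlieBracket (𝓡 m) X Y) x
      = -(dirDeriv Y (applyForm θ X) x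
        - dirDeriv (reeb θ) (applyForm θ Y) x * applyForm θ X x) := by
  have h1 := congrFun (h.applyForm_mlieBracket hY hX.1) x
  rw [← h1, VectorField.mlieBracket_swap]
  exact map_neg (θ x) _

variable [MeasurableSpace M]

theorem streamInner_eq (X Y : VField m M) :
    streamInner θ g X Y = ∫ x, applyForm θ X x * applyForm θ Y x ∂(riemVolume g) := rfl

theorem streamInner_comm (X Y : VField m M) : streamInner θ g X Y = streamInner θ g Y X := by
  simp only [streamInner, mul_comm]

variable [BorelSpace M] [CompactSpace M]

theorem ContactMetric.integrable_stream_mul (h : ContactMetric θ g) {X Y : VField m M}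
    (hX : IsContactField θ X) (hY : IsContactField θ Y) :
    Integrable (fun x => applyForm θ X x * applyForm θ Y x) (riemVolume g) :=
  h.integrable ((h.smooth_stream hX).mul (h.smooth_stream hY))

theorem ContactMetric.streamInner_sub_left (h : ContactMetric θ g) {X Y Z : VField m M}
    (hX : IsContactField θ X) (hY : IsContactField θ Y) (hZ : IsContactField θ Z) :
    streamInner θ g (X - Y) Z = streamInner θ g X Z - streamInner θ g Y Z := by
  rw [streamInner_eq, streamInner_eq, streamInner_eq,
    ← integral_sub (h.integrable_stream_mul hX hZ) (h.integrable_stream_mul hY hZ)]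
  simp only [applyForm_sub, sub_mul]

/-- Pairing X - Y with itself and using definiteness gives equal stream functions, hence equal
fields. -/
theorem ContactMetric.streamInner_ext (h : ContactMetric θ g) {X Y : VField m M}
    (hX : IsContactField θ X) (hY : IsContactField θ Y)
    (hXY : ∀ Z, IsContactField θ Z → streamInner θ g X Z = streamInner θ g Y Z) : X = Y := by
  have hD := h.isContactField_sub hX hY
  have h0 : streamInner θ g (X - Y) (X - Y) = 0 := by
    rw [h.streamInner_sub_left hX hY hD, hXY _ hD, sub_self]
  have h1 := h.eq_zero_of_integral_sq (h.smooth_stream hD) h0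
  refine h.contact_ext hX hY (funext fun x => ?_)
  have h2 := h1 x
  rw [applyForm_sub] at h2
  exact sub_eq_zero.1 h2

/-- The antisymmetric part of `connectionStream` is half the bracket, which gives zero torsion. The
symmetric Reeb term corrects the divergence of X so that ∇_X becomes skew. -/
theorem ContactMetric.isLeviCivita_contactOp (h : ContactMetric θ g) :
    IsLeviCivita θ g fun X Y => contactOp θ (connectionStream θ X Y) := by
  have mem : ∀ X Y, IsContactField θ X → IsContactField θ Y →
      IsContactField θ (contactOp θ (connectionStream θ X Y)) := fun X Y hX hY =>
    h.isContactField_contactOp (h.smooth_connectionStream hX hY)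
  have str : ∀ X Y, IsContactField θ X → IsContactField θ Y →
      applyForm θ (contactOp θ (connectionStream θ X Y)) = connectionStream θ X Y :=
    fun X Y hX hY => h.applyForm_contactOp (h.smooth_connectionStream hX hY)
  refine ⟨mem, ?_, ?_, ?_, ?_, ?_, ?_⟩
  · intro X X' Y hX hX' hY
    have hs := h.isContactField_add hX hX'
    refine h.contact_ext (mem _ _ hs hY) (h.isContactField_add (mem _ _ hX hY) (mem _ _ hX' hY))
      (funext fun x => ?_)
    rw [applyForm_add, str _ _ hs hY, str _ _ hX hY, str _ _ hX' hY]
    simp only [connectionStream]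
    rw [applyForm_add, dirDeriv_add, dirDeriv_fun_add _ (h.smooth_stream hX) (h.smooth_stream hX')]
    ring
  · intro c X Y hX hY
    have hs := h.isContactField_smul c hX
    refine h.contact_ext (mem _ _ hs hY) (h.isContactField_smul c (mem _ _ hX hY))
      (funext fun x => ?_)
    rw [applyForm_smul, str _ _ hs hY, str _ _ hX hY]
    simp only [connectionStream]
    rw [applyForm_smul, dirDeriv_smul, dirDeriv_const_mul _ (h.smooth_stream hX)]
    ring
  · intro X Y Y' hX hY hY'
    have hs := h.isContactField_add hY hY'
    refine h.contact_ext (mem _ _ hX hs) (h.isContactField_add (mem _ _ hX hY) (mem _ _ hX hY'))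
      (funext fun x => ?_)
    rw [applyForm_add, str _ _ hX hs, str _ _ hX hY, str _ _ hX hY']
    simp only [connectionStream]
    rw [applyForm_add, dirDeriv_fun_add _ (h.smooth_stream hY) (h.smooth_stream hY'),
      dirDeriv_fun_add _ (h.smooth_stream hY) (h.smooth_stream hY')]
    ring
  · intro c X Y hX hY
    have hs := h.isContactField_smul c hY
    refine h.contact_ext (mem _ _ hX hs) (h.isContactField_smul c (mem _ _ hX hY))
      (funext fun x => ?_)
    rw [applyForm_smul, str _ _ hX hs, str _ _ hX hY]
    simp only [connectionStream]
    rw [applyForm_smul, dirDeriv_const_mul _ (h.smooth_stream hY),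
      dirDeriv_const_mul _ (h.smooth_stream hY)]
    ring
  · intro X Y hX hY
    refine h.contact_ext (h.isContactField_sub (mem _ _ hX hY) (mem _ _ hY hX))
      (h.isContactField_mlieBracket hX hY) (funext fun x => ?_)
    have e1 := congrFun (h.applyForm_mlieBracket hX hY.1) x
    have e2 := h.stream_mlieBracket_skew hX hY x
    rw [applyForm_sub, str _ _ hX hY, str _ _ hY hX]
    simp only [connectionStream] at e1 ⊢
    linear_combination -(1 / 2) * e1 - (1 / 2) * e2
  · intro X Y Z hX hY hZ
    have sX := h.smooth_stream hX
    have sY := h.smooth_stream hY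
    have sZ := h.smooth_stream hZ
    rw [streamInner_eq, streamInner_eq, str _ _ hX hY, str _ _ hX hZ,
      ← integral_add (h.integrable ((h.smooth_connectionStream hX hY).mul sZ))
        (h.integrable (sY.mul (h.smooth_connectionStream hX hZ)))]
    have i1 := h.integral_divergence hX (sY.mul sZ)
    have i2 := h.integral_reebDeriv (sX.mul (sY.mul sZ))
    have d1 := ((sY.mul sZ).dirDeriv hX.1).add
      (((smoothFun_const ((m + 1) / 2)).mul (h.smooth_reebDeriv sX)).mul (sY.mul sZ))
    have d2 := h.smooth_reebDeriv (sX.mul (sY.mul sZ))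
    -- This fixes the constant c = (m+5)/2. Writing the symmetric terms as (c/2) E(θ(X)θ(Y)θ(Z))
    -- leaves E(θ(X))θ(Y)θ(Z) with coefficient c/2 - 1, which must be half of (m+1)/2 to complete
    -- the divergence of X.
    have key : ∀ x, connectionStream θ X Y x * applyForm θ Z x
        + applyForm θ Y x * connectionStream θ X Z x
        = 1 / 2 * (dirDeriv X (fun x => applyForm θ Y x * applyForm θ Z x) x
          + (m + 1) / 2 * dirDeriv (reeb θ) (applyForm θ X) x
            * (applyForm θ Y x * applyForm θ Z x))
        + (m + 5) / 4 * dirDeriv (reeb θ)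
          (fun x => applyForm θ X x * (applyForm θ Y x * applyForm θ Z x)) x := by
      intro x
      rw [dirDeriv_fun_mul _ sX (sY.mul sZ), dirDeriv_fun_mul _ sY sZ, dirDeriv_fun_mul _ sY sZ]
      simp only [connectionStream]
      ring
    simp only [key]
    rw [integral_add ((h.integrable d1).const_mul _) ((h.integrable d2).const_mul _),
      integral_const_mul, integral_const_mul, i1, i2]
    ring

theorem ContactMetric.isLeviCivita_leviCivita (h : ContactMetric θ g) :
    IsLeviCivita θ g (leviCivita θ g) :=
  Classical.epsilon_spec (p := IsLeviCivita θ g) ⟨_, h.isLeviCivita_contactOp⟩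

/-- Uniqueness of the Levi-Civita connection. -/
theorem ContactMetric.isLeviCivita_unique (h : ContactMetric θ g)
    {N N' : VField m M → VField m M → VField m M} (hN : IsLeviCivita θ g N)
    (hN' : IsLeviCivita θ g N') {X Y : VField m M} (hX : IsContactField θ X)
    (hY : IsContactField θ Y) : N X Y = N' X Y := by
  -- Koszul's formula on the Lie algebra; the terms differentiating inner products are absent
  -- because these are constant on right-invariant fields.
  have koszul : ∀ {N : VField m M → VField m M → VField m M}, IsLeviCivita θ g N →
      ∀ Z, IsContactField θ Z → 2 * streamInner θ g (N X Y) Z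
        = streamInner θ g (VectorField.mlieBracket (𝓡 m) X Y) Z
          - streamInner θ g (VectorField.mlieBracket (𝓡 m) Y Z) X
          + streamInner θ g (VectorField.mlieBracket (𝓡 m) Z X) Y := by
    intro N hN Z hZ
    rw [← hN.torsion_free _ _ hX hY, ← hN.torsion_free _ _ hY hZ, ← hN.torsion_free _ _ hZ hX,
      h.streamInner_sub_left (hN.mem _ _ hX hY) (hN.mem _ _ hY hX) hZ,
      h.streamInner_sub_left (hN.mem _ _ hY hZ) (hN.mem _ _ hZ hY) hX,
      h.streamInner_sub_left (hN.mem _ _ hZ hX) (hN.mem _ _ hX hZ) hY]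
    have m1 := hN.metric _ _ _ hX hY hZ
    have m2 := hN.metric _ _ _ hY hX hZ
    have m3 := hN.metric _ _ _ hZ hX hY
    rw [streamInner_comm Y] at m1
    rw [streamInner_comm X] at m2 m3
    linarith
  refine h.streamInner_ext (hN.mem _ _ hX hY) (hN'.mem _ _ hX hY) fun Z hZ => ?_
  have h1 := koszul hN Z hZ
  have h2 := koszul hN' Z hZ
  linarith

/-- `leviCivita` is a choice, but uniqueness pins its values down on contact fields. -/
theorem ContactMetric.applyForm_leviCivita (h : ContactMetric θ g) {X Y : VField m M}
    (hX : IsContactField θ X) (hY : IsContactField θ Y) :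
    applyForm θ (leviCivita θ g X Y) = connectionStream θ X Y := by
  rw [h.isLeviCivita_unique h.isLeviCivita_leviCivita h.isLeviCivita_contactOp hX hY,
    h.applyForm_contactOp (h.smooth_connectionStream hX hY)]

theorem ContactMetric.isB_contactOp (h : ContactMetric θ g) {X Y : VField m M}
    (hX : IsContactField θ X) (hY : IsContactField θ Y) :
    IsB θ g X Y (contactOp θ (coadjointStream θ X Y)) := by
  have hs := h.smooth_coadjointStream hX hY
  refine ⟨h.isContactField_contactOp hs, fun Z hZ => ?_⟩
  have sX := h.smooth_stream hX
  have sY := h.smooth_stream hY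
  have sZ := h.smooth_stream hZ
  have hA : IsContactField θ (adOp Y Z) := h.isContactField_neg (h.isContactField_mlieBracket hY hZ)
  have i1 := h.integral_divergence hY (sX.mul sZ)
  rw [← sub_eq_zero, streamInner_eq, streamInner_eq, h.applyForm_contactOp hs,
    ← integral_sub (h.integrable (hs.mul sZ)) (h.integrable_stream_mul hX hA), ← i1]
  -- Moving Y off Z costs its divergence (m+1)/2 E(θ(Y)), and the bracket supplies one more E(θ(Y));
  -- together they give the coefficient (m+3)/2 in `coadjointStream`.
  refine integral_congr_ae (Filter.Eventually.of_forall fun x => ?_)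
  simp only [adOp, applyForm_neg, h.applyForm_mlieBracket hY hZ.1, coadjointStream]
  rw [dirDeriv_fun_mul _ sX sZ]
  ring

theorem ContactMetric.isB_opB (h : ContactMetric θ g) {X Y : VField m M}
    (hX : IsContactField θ X) (hY : IsContactField θ Y) : IsB θ g X Y (opB θ g X Y) :=
  Classical.epsilon_spec (p := IsB θ g X Y) ⟨_, h.isB_contactOp hX hY⟩

theorem ContactMetric.applyForm_opB (h : ContactMetric θ g) {X Y : VField m M}
    (hX : IsContactField θ X) (hY : IsContactField θ Y) :
    applyForm θ (opB θ g X Y) = coadjointStream θ X Y := by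
  have h1 := h.isB_opB hX hY
  have h2 := h.isB_contactOp hX hY
  rw [h.streamInner_ext h1.1 h2.1 fun Z hZ => (h1.2 Z hZ).trans (h2.2 Z hZ).symm,
    h.applyForm_contactOp (h.smooth_coadjointStream hX hY)]

/-- The function whose square is the integrand of the curvature formula. -/
def curvatureDefect (θ : OneForm m M) (X Y : VField m M) (x : M) : ℝ :=
  dirDeriv X (applyForm θ Y) x - applyForm θ Y x * dirDeriv (reeb θ) (applyForm θ X) x
    - (m + 5) / 2 * (applyForm θ X x * dirDeriv (reeb θ) (applyForm θ Y) x
      - applyForm θ Y x * dirDeriv (reeb θ) (applyForm θ X) x)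

theorem ContactMetric.smooth_curvatureDefect (h : ContactMetric θ g) {X Y : VField m M}
    (hX : IsContactField θ X) (hY : IsContactField θ Y) :
    SmoothFun m (curvatureDefect θ X Y) := by
  have sX := h.smooth_stream hX
  have sY := h.smooth_stream hY
  have eX := h.smooth_reebDeriv sX
  have eY := h.smooth_reebDeriv sY
  exact ((sY.dirDeriv hX.1).sub (sY.mul eX)).sub
    ((smoothFun_const ((m + 5) / 2)).mul ((sX.mul eY).sub (sY.mul eX)))

theorem ContactMetric.integrable_curvatureDefect_sq (h : ContactMetric θ g) {X Y : VField m M}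
    (hX : IsContactField θ X) (hY : IsContactField θ Y) :
    Integrable (fun x => curvatureDefect θ X Y x ^ 2) (riemVolume g) := by
  simp only [sq]
  exact h.integrable ((h.smooth_curvatureDefect hX hY).mul (h.smooth_curvatureDefect hX hY))

/-- `X(θ(X)) = E(θ(X)) θ(X)` for a contact field `X`. -/
theorem ContactMetric.dirDeriv_stream_self (h : ContactMetric θ g) {X : VField m M}
    (hX : IsContactField θ X) (x : M) :
    dirDeriv X (applyForm θ X) x = dirDeriv (reeb θ) (applyForm θ X) x * applyForm θ X x := by
  have e1 := congrFun (h.applyForm_mlieBracket hX hX.1) x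
  have e2 := h.stream_mlieBracket_skew hX hX x
  linarith

/-- Once the outer derivatives are moved by skewness of ∇, the integrand is a quarter of the squared
defect plus divergences of the fields θ(X)θ([X,Y]) Y and θ(X)θ(Y)θ([X,Y]) E, which integrate to
zero. -/
theorem ContactMetric.curvC_eq (h : ContactMetric θ g) {X Y : VField m M}
    (hX : IsContactField θ X) (hY : IsContactField θ Y) :
    curvC θ g X Y = 1 / 4 * ∫ x, curvatureDefect θ X Y x ^ 2 ∂(riemVolume g) := by
  have hL := h.isLeviCivita_leviCivita
  have hP := h.isContactField_mlieBracket hX hY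
  have hXX := hL.mem _ _ hX hX
  have hXY := hL.mem _ _ hX hY
  have hYX := hL.mem _ _ hY hX
  have hYY := hL.mem _ _ hY hY
  have hPY := hL.mem _ _ hP hY
  have sX := h.smooth_stream hX
  have sY := h.smooth_stream hY
  have sP := h.smooth_stream hP
  -- Metric compatibility gives C = ⟨∇_X Y, ∇_Y X⟩ - ⟨∇_Y Y, ∇_X X⟩ - ⟨∇_[X,Y] Y, X⟩, in which no
  -- connection is iterated.
  have e1 : curvC θ g X Y = ∫ x, (connectionStream θ X Y x * connectionStream θ Y X x
      - connectionStream θ Y Y x * connectionStream θ X X x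
      - connectionStream θ (VectorField.mlieBracket (𝓡 m) X Y) Y x * applyForm θ X x)
        ∂(riemVolume g) := by
    have m1 := hL.metric _ _ _ hX hYY hX
    have m2 := hL.metric _ _ _ hY hXY hX
    rw [integral_sub
        (h.integrable (((h.smooth_connectionStream hX hY).mul (h.smooth_connectionStream hY hX)).sub
          ((h.smooth_connectionStream hY hY).mul (h.smooth_connectionStream hX hX))))
        (h.integrable ((h.smooth_connectionStream hP hY).mul sX)),
      integral_sub
        (h.integrable ((h.smooth_connectionStream hX hY).mul (h.smooth_connectionStream hY hX)))
        (h.integrable ((h.smooth_connectionStream hY hY).mul (h.smooth_connectionStream hX hX))),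
      ← h.applyForm_leviCivita hX hY, ← h.applyForm_leviCivita hY hX,
      ← h.applyForm_leviCivita hY hY, ← h.applyForm_leviCivita hX hX,
      ← h.applyForm_leviCivita hP hY, ← streamInner_eq, ← streamInner_eq, ← streamInner_eq,
      curvC, curvatureTensor,
      h.streamInner_sub_left
        (h.isContactField_sub (hL.mem _ _ hX hYY) (hL.mem _ _ hY hXY)) hPY hX,
      h.streamInner_sub_left (hL.mem _ _ hX hYY) (hL.mem _ _ hY hXY) hX]
    linarith
  have i1 := h.integral_divergence hY (sX.mul sP)
  have i2 := h.integral_reebDeriv (sX.mul (sY.mul sP))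
  have d1 := ((sX.mul sP).dirDeriv hY.1).add
    (((smoothFun_const ((m + 1) / 2)).mul (h.smooth_reebDeriv sY)).mul (sX.mul sP))
  have d2 := h.smooth_reebDeriv (sX.mul (sY.mul sP))
  have key : ∀ x, connectionStream θ X Y x * connectionStream θ Y X x
      - connectionStream θ Y Y x * connectionStream θ X X x
      - connectionStream θ (VectorField.mlieBracket (𝓡 m) X Y) Y x * applyForm θ X x
      = 1 / 4 * curvatureDefect θ X Y x ^ 2
        + (1 / 2 * (dirDeriv Y (fun x => applyForm θ X x *
            applyForm θ (VectorField.mlieBracket (𝓡 m) X Y) x) x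
          + (m + 1) / 2 * dirDeriv (reeb θ) (applyForm θ Y) x
            * (applyForm θ X x * applyForm θ (VectorField.mlieBracket (𝓡 m) X Y) x))
        + -((m + 5) / 4) * dirDeriv (reeb θ)
          (fun x => applyForm θ X x * (applyForm θ Y x
            * applyForm θ (VectorField.mlieBracket (𝓡 m) X Y) x)) x) := by
    intro x
    rw [dirDeriv_fun_mul _ sX (sY.mul sP), dirDeriv_fun_mul _ sY sP, dirDeriv_fun_mul _ sX sP]
    have p1 := congrFun (h.applyForm_mlieBracket hX hY.1) x
    have p2 := h.stream_mlieBracket_skew hX hY x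
    have q1 := congrFun (h.applyForm_mlieBracket hP hY.1) x
    have q2 := h.stream_mlieBracket_skew hP hY x
    simp only [connectionStream, curvatureDefect, h.dirDeriv_stream_self hX,
      h.dirDeriv_stream_self hY] at p1 q1 ⊢
    generalize VectorField.mlieBracket (𝓡 m) X Y = P at *
    -- All derivatives along X and P = [X,Y] are eliminated in favour of θ(P), derivatives along E
    -- and Y(θ(P)); what remains is a polynomial identity.
    have r1 : dirDeriv X (applyForm θ Y) x = applyForm θ P x
        + dirDeriv (reeb θ) (applyForm θ X) x * applyForm θ Y x := by linarith
    have r2 : dirDeriv Y (applyForm θ X) x = -applyForm θ P x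
        + dirDeriv (reeb θ) (applyForm θ Y) x * applyForm θ X x := by linarith
    have r3 : dirDeriv P (applyForm θ Y) x = -dirDeriv Y (applyForm θ P) x
        + dirDeriv (reeb θ) (applyForm θ Y) x * applyForm θ P x
        + dirDeriv (reeb θ) (applyForm θ P) x * applyForm θ Y x := by linarith
    rw [r1, r2, r3]
    ring
  rw [e1]
  simp only [key]
  rw [integral_add ((h.integrable_curvatureDefect_sq hX hY).const_mul _)
      (h.integrable (((smoothFun_const (1 / 2)).mul d1).add
        ((smoothFun_const (-((m + 5) / 4))).mul d2))),
    integral_add ((h.integrable d1).const_mul _) ((h.integrable d2).const_mul _),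
    integral_const_mul, integral_const_mul, integral_const_mul, i1, i2]
  ring

/-- No integration by parts is needed. Put f = θ(X), h = θ(Y), P = θ([X,Y]), c = (m+5)/2 and D = f
E(h) - h E(f). Then a, b and d have stream functions -P/2, (cD - 2P)/2 and c(f E(h) + h E(f))/2,
while B_X and B_Y have c f E(f)/2 and c h E(h)/2. The combination is (P - cD)²/4. -/
theorem ContactMetric.arnoldC_eq (h : ContactMetric θ g) {X Y : VField m M}
    (hX : IsContactField θ X) (hY : IsContactField θ Y) :
    arnoldC θ g X Y = 1 / 4 * ∫ x, curvatureDefect θ X Y x ^ 2 ∂(riemVolume g) := by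
  have hA : IsContactField θ (adOp X Y) := h.isContactField_neg (h.isContactField_mlieBracket hX hY)
  have hXX := (h.isB_opB hX hX).1
  have hXY := (h.isB_opB hX hY).1
  have hYX := (h.isB_opB hY hX).1
  have hYY := (h.isB_opB hY hY).1
  have hd := h.isContactField_smul (1 / 2) (h.isContactField_add hXY hYX)
  have hb := h.isContactField_smul (1 / 2) (h.isContactField_sub hXY hYX)
  have ha := h.isContactField_smul (1 / 2) hA
  have hBX := h.isContactField_smul (1 / 2) hXX
  have hBY := h.isContactField_smul (1 / 2) hYY
  rw [arnoldC]
  simp only [streamInner_eq]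
  have i1 := (h.smooth_stream hd).mul (h.smooth_stream hd)
  have i2 := (smoothFun_const 2).mul ((h.smooth_stream ha).mul (h.smooth_stream hb))
  have i3 := (smoothFun_const 3).mul ((h.smooth_stream ha).mul (h.smooth_stream ha))
  have i4 := (smoothFun_const 4).mul ((h.smooth_stream hBX).mul (h.smooth_stream hBY))
  rw [← integral_const_mul, ← integral_const_mul, ← integral_const_mul, ← integral_const_mul,
    ← integral_add (h.integrable i1) (h.integrable i2),
    ← integral_sub (h.integrable (i1.add i2)) (h.integrable i3),
    ← integral_sub (h.integrable ((i1.add i2).sub i3)) (h.integrable i4)]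
  refine integral_congr_ae (Filter.Eventually.of_forall fun x => ?_)
  have p1 := congrFun (h.applyForm_mlieBracket hX hY.1) x
  have p2 := h.stream_mlieBracket_skew hX hY x
  simp only [applyForm_smul, applyForm_add, applyForm_sub, applyForm_neg, adOp,
    h.applyForm_opB hX hX, h.applyForm_opB hX hY, h.applyForm_opB hY hX, h.applyForm_opB hY hY,
    coadjointStream, curvatureDefect, h.dirDeriv_stream_self hX, h.dirDeriv_stream_self hY]
    at p1 ⊢
  have r1 : dirDeriv X (applyForm θ Y) x = applyForm θ (VectorField.mlieBracket (𝓡 m) X Y) x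
      + dirDeriv (reeb θ) (applyForm θ X) x * applyForm θ Y x := by linarith
  have r2 : dirDeriv Y (applyForm θ X) x = -applyForm θ (VectorField.mlieBracket (𝓡 m) X Y) x
      + dirDeriv (reeb θ) (applyForm θ Y) x * applyForm θ X x := by linarith
  rw [r1, r2]
  ring

theorem ContactMetric.curvC_nonneg (h : ContactMetric θ g) {X Y : VField m M}
    (hX : IsContactField θ X) (hY : IsContactField θ Y) : 0 ≤ curvC θ g X Y := by
  rw [h.curvC_eq hX hY]
  exact mul_nonneg (by norm_num) (integral_nonneg fun x => sq_nonneg _)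

theorem ContactMetric.streamInner_self_pos (h : ContactMetric θ g) {X : VField m M}
    (hX : IsContactField θ X) (h0 : X ≠ 0) : 0 < streamInner θ g X X := by
  refine lt_of_le_of_ne (integral_nonneg fun x => mul_self_nonneg _) fun hne => h0 ?_
  have hz : IsContactField θ (0 : VField m M) := by
    simpa using h.isContactField_smul 0 hX
  refine h.contact_ext hX hz (funext fun x => ?_)
  rw [h.eq_zero_of_integral_sq (h.smooth_stream hX) hne.symm x]
  exact (map_zero (θ x)).symm

theorem ContactMetric.areaSq_pos (h : ContactMetric θ g) {X Y : VField m M}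
    (hX : IsContactField θ X) (hY : IsContactField θ Y) (hli : LinearIndependent ℝ ![X, Y]) :
    0 < areaSq θ g X Y := by
  rw [LinearIndependent.pair_iff] at hli
  have hX0 : X ≠ 0 := by
    rintro rfl
    simpa using hli 1 0 (by simp)
  have hXX := h.streamInner_self_pos hX hX0
  -- Gram–Schmidt: subtracting the projection of Y onto X turns |X ∧ Y|² into |X|² |Y - tX|².
  set t := streamInner θ g X Y / streamInner θ g X X with ht
  have hZ := h.isContactField_sub hY (h.isContactField_smul t hX)
  have hZ0 : Y - t • X ≠ 0 := by
    intro h0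
    have := (hli (-t) 1 (by rw [← h0]; module)).2
    exact one_ne_zero this
  have hZZ := h.streamInner_self_pos hZ hZ0
  have e : streamInner θ g (Y - t • X) (Y - t • X)
      = streamInner θ g Y Y - 2 * t * streamInner θ g X Y + t ^ 2 * streamInner θ g X X := by
    simp only [streamInner_eq]
    have i1 := (h.smooth_stream hY).mul (h.smooth_stream hY)
    have i2 := (smoothFun_const (2 * t)).mul ((h.smooth_stream hX).mul (h.smooth_stream hY))
    have i3 := (smoothFun_const (t ^ 2)).mul ((h.smooth_stream hX).mul (h.smooth_stream hX))
    rw [← integral_const_mul, ← integral_const_mul,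
      ← integral_sub (h.integrable i1) (h.integrable i2),
      ← integral_add (h.integrable (i1.sub i2)) (h.integrable i3)]
    refine integral_congr_ae (Filter.Eventually.of_forall fun x => ?_)
    simp only [applyForm_sub, applyForm_smul]
    ring
  have hpos := mul_pos hXX hZZ
  have e2 : streamInner θ g X X * streamInner θ g (Y - t • X) (Y - t • X) = areaSq θ g X Y := by
    rw [e, areaSq, ht]
    field_simp
    ring
  rwa [e2] at hpos

/-- As η is surjective, the condition X ∘ η = U determines X, so the choice in `rightTranslate` is
harmless. -/
theorem rightTranslate_eq (η : M ≃ₘ^∞⟮𝓡 m, 𝓡 m⟯ M) {U : (x : M) → TangentSpace (𝓡 m) (η x)}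
    {X : VField m M} (hX : ∀ x, X (η x) = U x) : rightTranslate η U = X := by
  have h1 : ∀ x, rightTranslate η U (η x) = U x :=
    Classical.epsilon_spec (p := fun X : VField m M => ∀ x, X (η x) = U x) ⟨X, hX⟩
  funext y
  obtain ⟨x, rfl⟩ := η.surjective y
  exact (h1 x).trans (hX x).symm

theorem ContactMetric.areaSqAt_pos_and_sectionalCurvAt_nonneg (h : ContactMetric θ g)
    (η : M ≃ₘ^∞⟮𝓡 m, 𝓡 m⟯ M) {U V : (x : M) → TangentSpace (𝓡 m) (η x)}
    (hU : IsTangentAt θ η U) (hV : IsTangentAt θ η V) (hli : LinearIndependent ℝ ![U, V]) :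
    0 < areaSqAt θ g η U V ∧ 0 ≤ sectionalCurvAt θ g η U V := by
  obtain ⟨X, hX, hXU⟩ := hU
  obtain ⟨Y, hY, hYV⟩ := hV
  rw [areaSqAt, sectionalCurvAt, rightTranslate_eq η hXU, rightTranslate_eq η hYV]
  -- A linear relation between X and Y, composed with η, is one between U and V.
  have hXY : LinearIndependent ℝ ![X, Y] := by
    rw [LinearIndependent.pair_iff] at hli ⊢
    intro s t hst
    refine hli s t (funext fun x => ?_)
    have := congrFun hst (η x)
    rw [Pi.add_apply, Pi.smul_apply, Pi.smul_apply, hXU, hYV] at this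
    exact this
  have hpos := h.areaSq_pos hX hY hXY
  exact ⟨hpos, div_nonneg (h.curvC_nonneg hX hY) hpos.le⟩

end Curvature

theorem IsKContact.contactMetric {n : ℕ} {M : Type*} [TopologicalSpace M]
    [ChartedSpace (EuclideanSpace ℝ (Fin (2 * n + 1))) M] [IsManifold (𝓡 (2 * n + 1)) ∞ M]
    {θ : OneForm (2 * n + 1) M} {g : SmoothMetric (2 * n + 1) M} (hK : IsKContact θ g) :
    ContactMetric θ g :=
  ⟨⟨n, rfl⟩, hK.contact.1, hK.associated⟩

end ContactCurvature

end

theorem mainTheorem1 (n : ℕ) {M : Type*} [TopologicalSpace M] [T2Space M] [CompactSpace M]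
    [ChartedSpace (EuclideanSpace ℝ (Fin (2 * n + 1))) M] [IsManifold (𝓡 (2 * n + 1)) ∞ M]
    [MeasurableSpace M] [BorelSpace M]
    (θ : OneForm (2 * n + 1) M) (g : SmoothMetric (2 * n + 1) M) (hK : IsKContact θ g) :
    -- the contact operator is well defined
    (∀ f : M → ℝ, SmoothFun (2 * n + 1) f →
      IsContactField θ (contactOp θ f) ∧ (∀ x, θ x (contactOp θ f x) = f x) ∧
      ∀ u, IsContactField θ u → (∀ x, θ x (u x) = f x) → u = contactOp θ f) ∧
    -- the Levi-Civita connection and the operator `B` exist on the Lie algebra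
    IsLeviCivita θ g (leviCivita θ g) ∧
    (∀ X Y, IsContactField θ X → IsContactField θ Y → IsB θ g X Y (opB θ g X Y)) ∧
    -- the explicit formula for the unnormalized curvature
    (∀ f h : M → ℝ, SmoothFun (2 * n + 1) f → SmoothFun (2 * n + 1) h →
      curvC θ g (contactOp θ f) (contactOp θ h)
          = arnoldC θ g (contactOp θ f) (contactOp θ h) ∧
      Integrable (fun x => (contactPoisson θ f h x
        - ((n : ℝ) + 3) * (f x * dirDeriv (reeb θ) h x - h x * dirDeriv (reeb θ) f x)) ^ 2)
        (riemVolume g) ∧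
      curvC θ g (contactOp θ f) (contactOp θ h)
        = 1 / 4 * ∫ x, (contactPoisson θ f h x
            - ((n : ℝ) + 3) * (f x * dirDeriv (reeb θ) h x - h x * dirDeriv (reeb θ) f x)) ^ 2
          ∂(riemVolume g)) ∧
    -- the sectional curvature is nonnegative everywhere on the group
    ∀ η : M ≃ₘ^∞⟮𝓡 (2 * n + 1), 𝓡 (2 * n + 1)⟯ M, IsContactomorphism θ η →
      ∀ U V : (x : M) → TangentSpace (𝓡 (2 * n + 1)) (η x),
        IsTangentAt θ η U → IsTangentAt θ η V → LinearIndependent ℝ ![U, V] →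
          0 < areaSqAt θ g η U V ∧ 0 ≤ sectionalCurvAt θ g η U V := by

  have h := hK.contactMetric
  -- For m = 2n+1 the constant (m+5)/2 is n+3.
  have defect : ∀ f k : M → ℝ, SmoothFun (2 * n + 1) f → SmoothFun (2 * n + 1) k → ∀ x,
      contactPoisson θ f k x
        - ((n : ℝ) + 3) * (f x * dirDeriv (reeb θ) k x - k x * dirDeriv (reeb θ) f x)
      = curvatureDefect θ (contactOp θ f) (contactOp θ k) x := by
    intro f k hf hk x
    rw [curvatureDefect, contactPoisson, h.applyForm_contactOp hf, h.applyForm_contactOp hk]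
    push_cast
    ring
  refine ⟨fun f hf => ⟨h.isContactField_contactOp hf, (h.contactOp_spec hf).2, fun u hu huf => ?_⟩,
    h.isLeviCivita_leviCivita, fun X Y hX hY => h.isB_opB hX hY, fun f k hf hk => ?_,
    fun η _ U V hU hV hli => h.areaSqAt_pos_and_sectionalCurvAt_nonneg η hU hV hli⟩
  · have huf' : applyForm θ u = f := funext huf
    rw [← huf', h.contactOp_applyForm hu]
  · have hX := h.isContactField_contactOp hf
    have hY := h.isContactField_contactOp hk
    simp only [defect f k hf hk]
    exact ⟨(h.curvC_eq hX hY).trans (h.arnoldC_eq hX hY).symm,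
      h.integrable_curvatureDefect_sq hX hY, h.curvC_eq hX hY⟩
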